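/- Let $M$ be a smooth (Hausdorff, finite-dimensional) manifold with a hypercomplex structure $(I,J,K)$, i.e. integrable complex structures with $IJ=-JI=K$, and let $g$ be a Riemannian metric on $M$. For ${\bf a}=(a,b,c)\in S^2\subset\mathbb R^3$ put $I_{\bf a}=aI+bJ+cK$. Let $Z=M\times S^2$ be the twistor space, with the tautological complex structure $\mathcal I_{(x,{\bf a})}=(I_{\bf a},I_{S^2})$, where $I_{S^2}$ is the canonical complex structure $v\mapsto {\bf a}\times v$ of $T_{\bf a}S^2={\bf a}^\perp$ (so $S^2\cong\mathbb{CP}^1$); let $\pi:Z\to S^2$ be the projection and $s_{\bf a}:M\to Z$, $s_{\bf a}(x)=(x,{\bf a})$. Let $P_I$ be the bivector on $M$ dual to the form $\omega_I(X,Y)=g(IX,Y)$, that is $P_I(\alpha,\beta)=\beta(\omega_I^{-1}\alpha)$ with $\omega_I: X\mapsto \omega_I(X,\cdot)$, and let $\mathcal P$ be the bivector field on $Z$ whose value at $(x,{\bf a})$ is the $(2,0)$-part of $(s_{\bf a})_*P_I$ with respect to $\mathcal I$. A holomorphic Poisson structure on $(Z,\mathcal I)$ is a smooth bivector field $P$ of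 type $(2,0)$ which is holomorphic ($\bar\partial P=0$, i.e. $[X,P]^{2,0}=0$ for all vector fields $X$ of type $(0,1)$) and satisfies $[P,P]=0$. The leaf of its symplectic foliation through a point is the set of all points reachable from it along finitely many trajectories of real parts of Hamiltonian vector fields $P(df)$, with $f$ a smooth complex function. The metric $g$ is hyperhermitian if it is Hermitian for $I$, $J$ and $K$, and hyperkähler if moreover $\omega_I,\omega_J,\omega_K$ are closed. (1) If $g$ is hyperkähler, then $\mathcal P$ is a holomorphic Poisson structure on $Z$, and it vanishes on the two fibres of $\pi$ over the points $(\pm1,0,0)$, which correspond to $I$ and $-I$ ($\lambda=\infty$ and $\lambda=0$ in $\mathbb{CP}^1$). The leaf through a point of $Z$ not on these two fibres is the connected component of the fibre of $\pi$ containing it (hence the whole fibre if $M$ is connected), and the leaf through a point of $\pi^{-1}(0)\cup\pi^{-1}(\infty)$ is that single point. (2) Conversely, if $g$ is hyperhermitian and $\mathcal P$ is a holomorphic Poisson structure on $Z$, then $g$ is hyperkähler. -/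

import Mathlib

open scoped Manifold ContDiff Bundle

noncomputable section

/-! ### Complex bivector fields on an almost complex manifold -/

section Bivectors

variable {F : Type*} [NormedAddCommGroup F] [NormedSpace ℝ F]
  {H : Type*} [TopologicalSpace H] (𝓜 : ModelWithCorners ℝ F H)
  {N : Type*} [TopologicalSpace N] [ChartedSpace H N]

/-- A field of real endomorphisms of the tangent spaces. -/
abbrev EndField (N : Type*) [TopologicalSpace N] [ChartedSpace H N] : Type _ :=
  ∀ p : N, TangentSpace 𝓜 p →L[ℝ] TangentSpace 𝓜 p

/-- The complexified cotangent space `T*_p N ⊗ ℂ = Hom_ℝ(T_p N, ℂ)`. -/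
abbrev ComplexCotangent (p : N) : Type _ := TangentSpace 𝓜 p →L[ℝ] ℂ

/-- A complex bivector at `p`, an element of `Λ²(T_p N ⊗ ℂ)`, is seen as a (skew) `ℂ`-bilinear form
on the complexified cotangent space. Skewness is demanded separately where it matters. -/
abbrev ComplexBivector (p : N) : Type _ :=
  ComplexCotangent 𝓜 p →ₗ[ℂ] ComplexCotangent 𝓜 p →ₗ[ℂ] ℂ

/-- A field of complex bivectors. -/
abbrev BivectorField (N : Type*) [TopologicalSpace N] [ChartedSpace H N] : Type _ :=
  ∀ p : N, ComplexBivector 𝓜 p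

/-- The real covector `β` as a complex covector. -/
def complexifyCovector {p : N} (β : TangentSpace 𝓜 p →L[ℝ] ℝ) : ComplexCotangent 𝓜 p :=
  Complex.ofRealCLM.comp β

/-- A complex covector `α` is of type `(1,0)` for `J` if `α (J v) = i α(v)`. -/
def IsCovectorOneZero {p : N} (J : TangentSpace 𝓜 p →L[ℝ] TangentSpace 𝓜 p)
    (α : ComplexCotangent 𝓜 p) : Prop :=
  ∀ v, α (J v) = Complex.I * α v

/-- The projection `α ↦ α^{1,0} = ½ (α - i α ∘ J)` onto the covectors of type `(1,0)`. -/
def oneZeroPart {p : N} (J : TangentSpace 𝓜 p →L[ℝ] TangentSpace 𝓜 p) :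
    ComplexCotangent 𝓜 p →ₗ[ℂ] ComplexCotangent 𝓜 p where
  toFun α := (1 / 2 : ℂ) • (α - Complex.I • α.comp J)
  map_add' α β := by
    ext v
    simp only [smul_apply, sub_apply,
      add_apply, ContinuousLinearMap.comp_apply, smul_eq_mul]
    ring
  map_smul' c α := by
    ext v
    simp only [smul_apply, sub_apply,
      ContinuousLinearMap.comp_apply, smul_eq_mul, RingHom.id_apply]
    ring

/-- The `(2,0)`-part of a bivector: `P^{2,0}(α, β) = P(α^{1,0}, β^{1,0})`. -/
def twoZeroPart {p : N} (J : TangentSpace 𝓜 p →L[ℝ] TangentSpace 𝓜 p)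
    (P : ComplexBivector 𝓜 p) : ComplexBivector 𝓜 p :=
  P.compl₁₂ (oneZeroPart 𝓜 J) (oneZeroPart 𝓜 J)

/-- The bracket `{f, h} = P(df, dh)` of two complex valued functions. -/
def poissonBracket (P : BivectorField 𝓜 N) (f h : N → ℂ) (q : N) : ℂ :=
  P q (mvfderiv 𝓜 f q) (mvfderiv 𝓜 h q)

/-- Smooth complex valued functions near `p`. -/
abbrev SmoothFunAt (f : N → ℂ) (p : N) : Prop := ContMDiffAt 𝓜 𝓘(ℝ, ℂ) ∞ f p

/-- Smooth real vector fields near `p`. -/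
abbrev SmoothVectorAt [IsManifold 𝓜 ∞ N] (V : ∀ q : N, TangentSpace 𝓜 q) (p : N) : Prop :=
  ContMDiffAt 𝓜 𝓜.tangent ∞ (fun q => (⟨q, V q⟩ : TangentBundle 𝓜 N)) p

/-- `P` is a smooth section of the bundle of complex bivectors: it is skew and the bracket of smooth
functions is smooth. -/
def IsSmoothBivector (P : BivectorField 𝓜 N) : Prop :=
  (∀ q (α : ComplexCotangent 𝓜 q), P q α α = 0) ∧
  ∀ (p : N) (f h : N → ℂ), SmoothFunAt 𝓜 f p → SmoothFunAt 𝓜 h p →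
    SmoothFunAt 𝓜 (poissonBracket 𝓜 P f h) p

/-- The value `[P, P](df, dg, dh)` at `p` of the Schouten bracket of a bivector field with
itself, namely `2 ({f,{g,h}} + {g,{h,f}} + {h,{f,g}})`. -/
def schoutenSelf (P : BivectorField 𝓜 N) (f g h : N → ℂ) (p : N) : ℂ :=
  2 * (poissonBracket 𝓜 P f (poissonBracket 𝓜 P g h) p +
    poissonBracket 𝓜 P g (poissonBracket 𝓜 P h f) p +
    poissonBracket 𝓜 P h (poissonBracket 𝓜 P f g) p)

/-- `[P, P] = 0`. (Differentials of local functions exhaust the covectors at each point.) -/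
def SchoutenVanishes (P : BivectorField 𝓜 N) : Prop :=
  ∀ (p : N) (f g h : N → ℂ), SmoothFunAt 𝓜 f p → SmoothFunAt 𝓜 g p → SmoothFunAt 𝓜 h p →
    schoutenSelf 𝓜 P f g h p = 0

/-- `P` is of type `(2,0)` for the almost complex structure `J`. -/
def IsTypeTwoZero (J : EndField 𝓜 N) (P : BivectorField 𝓜 N) : Prop :=
  ∀ q, twoZeroPart 𝓜 (J q) (P q) = P q

/-- The derivative `X f` of a complex function along the complex vector field
`X = ½ (V + i J V)`, the `(0,1)`-part of the real vector field `V`. -/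
def derivZeroOne (J : EndField 𝓜 N) (V : ∀ q : N, TangentSpace 𝓜 q) (f : N → ℂ) (q : N) : ℂ :=
  (1 / 2 : ℂ) * (mvfderiv 𝓜 f q (V q) + Complex.I * mvfderiv 𝓜 f q (J q (V q)))

/-- The value `(L_X P)(df, dh)` at `p` of the Lie derivative of `P` along the `(0,1)`-part `X` of
`V`, that is, `X{f,h} - {Xf,h} - {f,Xh}`. -/
def lieDerivZeroOne (J : EndField 𝓜 N) (P : BivectorField 𝓜 N) (V : ∀ q : N, TangentSpace 𝓜 q)
    (f h : N → ℂ) (p : N) : ℂ :=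
  derivZeroOne 𝓜 J V (poissonBracket 𝓜 P f h) p -
    poissonBracket 𝓜 P (derivZeroOne 𝓜 J V f) h p -
    poissonBracket 𝓜 P f (derivZeroOne 𝓜 J V h) p

/-- A `(2,0)`-bivector `P` satisfies `∂̄P = 0`, i.e. is a holomorphic section of `Λ²T^{1,0}`: the
`(2,0)`-part `∂̄_X P = [X, P]^{2,0}` vanishes for every `(0,1)`-vector field `X`. The `(2,0)`-part at
`p` is detected by covectors at `p` of type `(1,0)`. In holomorphic coordinates `z`, taking
`X = ∂/∂z̄_k`, `f = z_i`, `h = z_j`, this says `∂P^{ij}/∂z̄_k = 0`. -/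
def DbarVanishes [IsManifold 𝓜 ∞ N] (J : EndField 𝓜 N) (P : BivectorField 𝓜 N) : Prop :=
  ∀ (p : N) (V : ∀ q : N, TangentSpace 𝓜 q) (f h : N → ℂ), SmoothVectorAt 𝓜 V p →
    SmoothFunAt 𝓜 f p → SmoothFunAt 𝓜 h p →
    IsCovectorOneZero 𝓜 (J p) (mvfderiv 𝓜 f p) → IsCovectorOneZero 𝓜 (J p) (mvfderiv 𝓜 h p) →
    lieDerivZeroOne 𝓜 J P V f h p = 0

/-- Holomorphic Poisson structures: smooth bivector fields of type `(2,0)` that are holomorphic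
and satisfy `[P, P] = 0`. -/
structure IsHolomorphicPoisson [IsManifold 𝓜 ∞ N] (J : EndField 𝓜 N) (P : BivectorField 𝓜 N) : Prop where
  smooth : IsSmoothBivector 𝓜 P
  typeTwoZero : IsTypeTwoZero 𝓜 J P
  holomorphic : DbarVanishes 𝓜 J P
  poisson : SchoutenVanishes 𝓜 P

/-- `V` is the real part of the Hamiltonian vector field `X_f = P(df)`, which is determined by
`β(X_f) = P(df, β)`. -/
def IsRealHamiltonianField (P : BivectorField 𝓜 N) (f : N → ℂ)
    (V : ∀ q : N, TangentSpace 𝓜 q) : Prop :=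
  ∀ q (β : TangentSpace 𝓜 q →L[ℝ] ℝ),
    β (V q) = (P q (mvfderiv 𝓜 f q) (complexifyCovector 𝓜 β)).re

/-- `q` is reached from `p` along a trajectory of the real part of a Hamiltonian vector field. -/
def HamiltonianStep (P : BivectorField 𝓜 N) (p q : N) : Prop :=
  ∃ (f : N → ℂ) (V : ∀ q : N, TangentSpace 𝓜 q) (γ : ℝ → N),
    ContMDiff 𝓜 𝓘(ℝ, ℂ) ∞ f ∧ IsRealHamiltonianField 𝓜 P f V ∧
    IsMIntegralCurveOn γ V (Set.Icc 0 1) ∧ γ 0 = p ∧ γ 1 = q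

/-- The leaf through `p` of the symplectic foliation: all points that can be joined to `p` by
finitely many trajectories of (real parts of) Hamiltonian vector fields. -/
def symplecticLeaf (P : BivectorField 𝓜 N) (p : N) : Set N :=
  {q | Relation.EqvGen (HamiltonianStep 𝓜 P) p q}

end Bivectors

/-! ### Hypercomplex, hyperhermitian and hyperkähler manifolds -/

section Hypercomplex

variable (E : Type*) [NormedAddCommGroup E] [NormedSpace ℝ E]
  (M : Type*) [TopologicalSpace M] [ChartedSpace E M]

/-- `J` is a smooth section of the endomorphism bundle of the tangent bundle. -/
def SmoothEndField [IsManifold 𝓘(ℝ, E) ∞ M] (J : EndField 𝓘(ℝ, E) M) : Prop :=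
  ContMDiff 𝓘(ℝ, E) (𝓘(ℝ, E).prod 𝓘(ℝ, E →L[ℝ] E)) ∞
    (fun x => Bundle.TotalSpace.mk' (E →L[ℝ] E)
      (E := fun x : M => TangentSpace 𝓘(ℝ, E) x →L[ℝ] TangentSpace 𝓘(ℝ, E) x) x (J x))

variable {E M}

/-- The Nijenhuis tensor of `J` vanishes:
`[JV, JW] - J[JV, W] - J[V, JW] - [V, W] = 0` when `J² = -1`. -/
def NijenhuisVanishes [IsManifold 𝓘(ℝ, E) ∞ M] (J : EndField 𝓘(ℝ, E) M) : Prop :=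
  ∀ (x : M) (V W : ∀ y : M, TangentSpace 𝓘(ℝ, E) y),
    SmoothVectorAt 𝓘(ℝ, E) V x → SmoothVectorAt 𝓘(ℝ, E) W x →
    VectorField.mlieBracket 𝓘(ℝ, E) (fun y => J y (V y)) (fun y => J y (W y)) x
      - J x (VectorField.mlieBracket 𝓘(ℝ, E) (fun y => J y (V y)) W x)
      - J x (VectorField.mlieBracket 𝓘(ℝ, E) V (fun y => J y (W y)) x)
      - VectorField.mlieBracket 𝓘(ℝ, E) V W x = 0

/-- A complex structure: a smooth integrable almost complex structure. -/
structure IsComplexStructure [IsManifold 𝓘(ℝ, E) ∞ M] (J : EndField 𝓘(ℝ, E) M) : Prop where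
  smooth : SmoothEndField E M J
  sq : ∀ x v, J x (J x v) = -v
  integrable : NijenhuisVanishes J

variable (E M) in
/-- A hypercomplex structure: complex structures `I, J, K` with `IJ = -JI = K`. -/
structure HypercomplexStructure [IsManifold 𝓘(ℝ, E) ∞ M] where
  I : EndField 𝓘(ℝ, E) M
  J : EndField 𝓘(ℝ, E) M
  K : EndField 𝓘(ℝ, E) M
  complex_I : IsComplexStructure I
  complex_J : IsComplexStructure J
  complex_K : IsComplexStructure K
  I_J : ∀ x v, I x (J x v) = K x v
  J_I : ∀ x v, J x (I x v) = -K x v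

variable (E M) in
/-- Smooth Riemannian metrics on `M`. -/
abbrev RiemannianMetricOn [IsManifold 𝓘(ℝ, E) ∞ M] : Type _ :=
  Bundle.ContMDiffRiemannianMetric 𝓘(ℝ, E) ∞ E (fun x : M => TangentSpace 𝓘(ℝ, E) x)

/-- The fundamental form `ω(X, Y) = g(JX, Y)`. -/
def fundamentalForm [IsManifold 𝓘(ℝ, E) ∞ M] (g : RiemannianMetricOn E M) (J : EndField 𝓘(ℝ, E) M)
    (x : M) : TangentSpace 𝓘(ℝ, E) x →L[ℝ] TangentSpace 𝓘(ℝ, E) x →L[ℝ] ℝ :=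
  (g.inner x).comp (J x)

/-- `dσ = 0` for a 2-form `σ`, by the invariant formula for the exterior derivative. -/
def IsClosedTwoForm [IsManifold 𝓘(ℝ, E) ∞ M]
    (σ : ∀ x : M, TangentSpace 𝓘(ℝ, E) x →L[ℝ] TangentSpace 𝓘(ℝ, E) x →L[ℝ] ℝ) : Prop :=
  ∀ (x : M) (X Y Z : ∀ y : M, TangentSpace 𝓘(ℝ, E) y),
    SmoothVectorAt 𝓘(ℝ, E) X x → SmoothVectorAt 𝓘(ℝ, E) Y x → SmoothVectorAt 𝓘(ℝ, E) Z x →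
    mvfderiv 𝓘(ℝ, E) (fun y => σ y (Y y) (Z y)) x (X x)
      - mvfderiv 𝓘(ℝ, E) (fun y => σ y (X y) (Z y)) x (Y x)
      + mvfderiv 𝓘(ℝ, E) (fun y => σ y (X y) (Y y)) x (Z x)
      - σ x (VectorField.mlieBracket 𝓘(ℝ, E) X Y x) (Z x)
      + σ x (VectorField.mlieBracket 𝓘(ℝ, E) X Z x) (Y x)
      - σ x (VectorField.mlieBracket 𝓘(ℝ, E) Y Z x) (X x) = 0

/-- The real bivector `σ⁻¹ ∈ Λ²T_xM` dual to a nondegenerate 2-form `σ`, where `σ` is regarded as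
the isomorphism `X ↦ σ(X, ·)` from `T` to `T*`: `σ⁻¹(α, β) = β(σ⁻¹(α))`, extended
`ℂ`-bilinearly to complex covectors. -/
def dualBivector {x : M}
    (σ : TangentSpace 𝓘(ℝ, E) x →L[ℝ] TangentSpace 𝓘(ℝ, E) x →L[ℝ] ℝ) :
    ComplexBivector 𝓘(ℝ, E) x :=
  LinearMap.mk₂ ℂ
    (fun α β => β (σ.inverse (Complex.reCLM.comp α)) +
      Complex.I * β (σ.inverse (Complex.imCLM.comp α)))
    (by
      intro α α' β
      simp only [ContinuousLinearMap.comp_add, map_add]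
      ring)
    (by
      intro c α β
      have hre : Complex.reCLM.comp (c • α) =
          c.re • Complex.reCLM.comp α - c.im • Complex.imCLM.comp α := by
        ext v; simp
      have him : Complex.imCLM.comp (c • α) =
          c.re • Complex.imCLM.comp α + c.im • Complex.reCLM.comp α := by
        ext v; simp
      rw [hre, him]
      simp only [map_add, map_sub, map_smul, Complex.real_smul, smul_eq_mul]
      conv_rhs => rw [← Complex.re_add_im c]
      linear_combination (-(c.im : ℂ) * β (σ.inverse (Complex.imCLM.comp α))) * Complex.I_sq)
    (by
      intro α β β'
      simp only [add_apply]
      ring)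
    (by
      intro c α β
      simp only [smul_apply, smul_eq_mul]
      ring)

/-- `g` is Hermitian for `J`. -/
def IsHermitianFor [IsManifold 𝓘(ℝ, E) ∞ M] (g : RiemannianMetricOn E M)
    (J : EndField 𝓘(ℝ, E) M) : Prop :=
  ∀ x v w, g.inner x (J x v) (J x w) = g.inner x v w

end Hypercomplex

/-! ### The sphere of complex structures -/

/-- The unit sphere `S² ⊆ ℝ³`. -/
abbrev S2 : Type := Metric.sphere (0 : EuclideanSpace ℝ (Fin 3)) 1

/-- The differential at `a` of the inclusion `S² → ℝ³`; it identifies `T_aS²` with the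
orthogonal complement of `a`. -/
abbrev S2.dIncl (a : S2) : TangentSpace (𝓡 2) a →L[ℝ] EuclideanSpace ℝ (Fin 3) :=
  mvfderiv (𝓡 2) ((↑) : S2 → EuclideanSpace ℝ (Fin 3)) a

theorem S2.exists_rotation (a : S2) :
    ∃ J : TangentSpace (𝓡 2) a →L[ℝ] TangentSpace (𝓡 2) a,
      ∀ v, (S2.dIncl a (J v)).ofLp =
        crossProduct (a : EuclideanSpace ℝ (Fin 3)).ofLp (S2.dIncl a v).ofLp := by
  have : Fact (Module.finrank ℝ (EuclideanSpace ℝ (Fin 3)) = 2 + 1) := ⟨by simp⟩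
  have hinj : Function.Injective (S2.dIncl a) := injective_mvfderiv_subtypeVal_sphere (n := 2) a
  have hrange : (S2.dIncl a).range = (ℝ ∙ (a : EuclideanSpace ℝ (Fin 3)))ᗮ :=
    range_mvfderiv_subtypeVal (n := 2) a
  have hex : ∀ v, ∃ w, S2.dIncl a w = WithLp.toLp 2
      (crossProduct (a : EuclideanSpace ℝ (Fin 3)).ofLp (S2.dIncl a v).ofLp) := by
    intro v
    have hmem : WithLp.toLp 2
        (crossProduct (a : EuclideanSpace ℝ (Fin 3)).ofLp (S2.dIncl a v).ofLp) ∈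
        (S2.dIncl a).range := by
      rw [hrange, Submodule.mem_orthogonal_singleton_iff_inner_right,
        EuclideanSpace.inner_eq_star_dotProduct, dotProduct_comm]
      simp [dot_self_cross]
    exact hmem
  choose w hw using hex
  let L : TangentSpace (𝓡 2) a →ₗ[ℝ] TangentSpace (𝓡 2) a :=
    { toFun := w
      map_add' := fun u v => hinj (by simp [hw, map_add])
      map_smul' := fun c v => hinj (by simp [hw, map_smul]) }
  have : FiniteDimensional ℝ (TangentSpace (𝓡 2) a) :=
    inferInstanceAs (FiniteDimensional ℝ (EuclideanSpace ℝ (Fin 2)))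
  have : T2Space (TangentSpace (𝓡 2) a) :=
    inferInstanceAs (T2Space (EuclideanSpace ℝ (Fin 2)))
  refine ⟨⟨L, L.continuous_of_finiteDimensional⟩, fun v => ?_⟩
  change (S2.dIncl a (w v)).ofLp = _
  rw [hw]

/-- The canonical complex structure of `S²`: at `a` it is the rotation `v ↦ a × v` of
`T_aS² = a^⊥`. -/
def S2.complexStructure : EndField (𝓡 2) S2 := fun a => (S2.exists_rotation a).choose

theorem S2.complexStructure_spec (a : S2) (v : TangentSpace (𝓡 2) a) :
    (S2.dIncl a (S2.complexStructure a v)).ofLp =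
      crossProduct (a : EuclideanSpace ℝ (Fin 3)).ofLp (S2.dIncl a v).ofLp :=
  (S2.exists_rotation a).choose_spec v

/-- The point `(1, 0, 0)`, which corresponds to `I`. -/
def S2.poleI : S2 := ⟨EuclideanSpace.single 0 1, by simp⟩

/-! ### The twistor space -/

section Twistor

variable {E : Type*} [NormedAddCommGroup E] [NormedSpace ℝ E]
  {M : Type*} [TopologicalSpace M] [ChartedSpace E M] [IsManifold 𝓘(ℝ, E) ∞ M]

/-- The model of the twistor space `Z = M × S²`. -/
abbrev twistorModel (E : Type*) [NormedAddCommGroup E] [NormedSpace ℝ E] :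
    ModelWithCorners ℝ (E × EuclideanSpace ℝ (Fin 2)) (ModelProd E (EuclideanSpace ℝ (Fin 2))) :=
  𝓘(ℝ, E).prod (𝓡 2)

namespace HypercomplexStructure

variable (Q : HypercomplexStructure E M) (g : RiemannianMetricOn E M)

/-- A hyperhermitian metric. -/
def IsHyperhermitian : Prop :=
  IsHermitianFor g Q.I ∧ IsHermitianFor g Q.J ∧ IsHermitianFor g Q.K

/-- A hyperkähler metric: hyperhermitian, with closed fundamental forms for `I`, `J` and `K`. -/
def IsHyperkahler : Prop :=
  Q.IsHyperhermitian g ∧ IsClosedTwoForm (fundamentalForm g Q.I) ∧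
    IsClosedTwoForm (fundamentalForm g Q.J) ∧ IsClosedTwoForm (fundamentalForm g Q.K)

/-- `I_a = a₁ I + a₂ J + a₃ K`. -/
def structureAt (a : S2) : EndField 𝓘(ℝ, E) M := fun x =>
  (a : EuclideanSpace ℝ (Fin 3)) 0 • Q.I x + (a : EuclideanSpace ℝ (Fin 3)) 1 • Q.J x +
    (a : EuclideanSpace ℝ (Fin 3)) 2 • Q.K x

/-- The tautological complex structure of the twistor space `Z = M × S²`, equal to
`(I_a, I_{S²})` at `(x, a)`. -/
def twistorStructure : EndField (twistorModel E) (M × S2) := fun z =>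
  (Q.structureAt z.2 z.1).prodMap (S2.complexStructure z.2)

/-- The bivector `P_I` on `M` dual to the fundamental form of `I`. -/
def bivectorI : BivectorField 𝓘(ℝ, E) M := fun x => dualBivector (fundamentalForm g Q.I x)

/-- The push-forward `(s_a)_* P` at `(x, a)` of a bivector at `x` by the section
`s_a(y) = (y, a)` of the projection `π : Z → S²`. -/
def pushSection (x : M) (a : S2) (P : ComplexBivector 𝓘(ℝ, E) x) :
    ComplexBivector (twistorModel E) ((x, a) : M × S2) :=
  let pullback : ComplexCotangent (twistorModel E) ((x, a) : M × S2) →ₗ[ℂ]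
      ComplexCotangent 𝓘(ℝ, E) x :=
    { toFun := fun α => α.comp (mfderiv 𝓘(ℝ, E) (twistorModel E) (fun y : M => (y, a)) x)
      map_add' := fun _ _ => rfl
      map_smul' := fun _ _ => rfl }
  P.compl₁₂ pullback pullback

/-- The bivector field `𝒫` on the twistor space: at `(x, a)`, the `(2,0)`-part of
`(s_a)_* P_I` with respect to the tautological complex structure. -/
def twistorBivector : BivectorField (twistorModel E) (M × S2) := fun z =>
  twoZeroPart (twistorModel E) (Q.twistorStructure z) (pushSection z.1 z.2 (Q.bivectorI g z.1))

end HypercomplexStructure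

end Twistor

end

/-!
A hyperhermitian metric identifies the imaginary quaternions with the bivectors spanned by
`P_I, P_J, P_K`, dual to `ω_I, ω_J, ω_K`. Quaternion algebra gives the `(2,0)`-part of `P_I` for
`I_n`, `n ∈ S²`: it is `∑ u_k(n) P_k` with `u(n) = ½ (e - ⟨e, n⟩ n - i n × e)` and `e = (1, 0, 0)`
(`IsQuaternionic.toForm_projOneZero`). So the twistor bivector field is tangent to the fibres of
`Z → S²`, and it vanishes over `n = ± e`. Its conjugate is `∑ u_k(-n) P_k`.

To compute brackets, `Z` is replaced near a fibre by an open subset of `E × ℝ³`, where `E` is the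
space on which `M` is modelled: a chart of `M` and the inclusion of the sphere embed it, and there
is a smooth retraction (`IsLocalModel`). Both `[P, P]` and the Lie derivatives of `P` along
`(0,1)`-fields are tensors, given by the first derivatives of `P` and of the complex structure
(`jacobiator_eq`, `lieDeriv_eq`); second derivatives of functions cancel.

* Since `R = ∑ t_k P_k` with real `t` is, up to the factor `|t|²`, inverse to `ω = ∑ t_k ω_k`, the
  bracket `[R, R]` is `dω` with its indices raised (`IsQuaternionicAt.schouten_ofReal`). By
  polarization, all brackets `[P_k, P_l]` vanish if the three forms are closed, and `ω_k` is closed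
  if `[P_k, P_k] = 0`.
* Holomorphy in the directions of the sphere always holds, for algebraic reasons
  (`IsQuaternionic.comb_sphere_derivative`).
* In the directions of `M`, the derivative `∂̄P` contracted with the conjugate bivector `P̄` is the
  mixed bracket `[P, P̄]` (`IsQuaternionicAt.schouten_mixed`). Away from `n = ± e` every
  `(0,1)`-vector is such a contraction, and at `n = ± e` the coefficients vanish, so `P` is
  holomorphic as soon as all brackets of the `P_k` vanish.

Conversely, let `P` be a holomorphic Poisson structure. Then `[P, P] = [P̄, P̄] = [P, P̄] = 0` on each
fibre, hence also `[P + P̄, P + P̄] = 0` and `[P - P̄, P - P̄] = 0`. At `n = (0, 1, 0)` the bivectors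
`P + P̄` and `P - P̄` are multiples of `P_I` and `P_K`, and at `n = (0, 0, 1)` the second one is a
multiple of `P_J`, so the three forms are closed (`IsQuaternionicAt.extDeriv_eq_zero`).

The real Hamiltonian fields are tangent to the fibres of `Z → S²`, and they vanish over `± e`, which
bounds the leaves from above. Away from `± e` the real part of `P` is nondegenerate on the fibre, and
the straight segment from `x₀` to a nearby point of the chart `φ`, with direction `v`, is a
trajectory: there is a covector field `τ` which `P` turns into a vector with real part `v`, and the
Hamiltonian is `x ↦ τ_x (φ x - φ x₀)`, whose differential along the segment is `τ` because
`τ(v) = 0` (`apply_eq_re_twistorBivector_line`). So the leaves are open in the fibres.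
-/

open scoped Manifold ContDiff Bundle

noncomputable section

namespace HypercomplexTwistor

/-! ### Brackets of bivector fields on a vector space -/

section Calculus

variable {W : Type*} [NormedAddCommGroup W] [NormedSpace ℝ W]

/-- Complex covectors on a real normed space. -/
abbrev Cov (W : Type*) [NormedAddCommGroup W] [NormedSpace ℝ W] : Type _ := W →L[ℝ] ℂ

/-- Complex valued functions of two complex covectors. -/
abbrev Form (W : Type*) [NormedAddCommGroup W] [NormedSpace ℝ W] : Type _ := Cov W → Cov W → ℂ

/-- `B` is a complex bivector: it is skew, and each contraction `B(α, ·)` is evaluation at a complex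
vector `a₁ + i a₂`. -/
structure IsBivector (B : Form W) : Prop where
  skew : ∀ α β, B α β = -B β α
  vec : ∀ α, ∃ a₁ a₂ : W, ∀ θ : Cov W, B α θ = θ a₁ + Complex.I * θ a₂

namespace IsBivector

variable {B : Form W} (hB : IsBivector B)
include hB

theorem smul_right (c : ℂ) (α β : Cov W) : B α (c • β) = c * B α β := by
  obtain ⟨a₁, a₂, h⟩ := hB.vec α
  simp only [h, smul_apply, smul_eq_mul]
  ring

theorem smul_left (c : ℂ) (α β : Cov W) : B (c • α) β = c * B α β := by
  rw [hB.skew, hB.smul_right, hB.skew β α]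
  ring

theorem add_right (α β β' : Cov W) : B α (β + β') = B α β + B α β' := by
  obtain ⟨a₁, a₂, h⟩ := hB.vec α
  simp only [h, add_apply]
  ring

theorem add_left (α α' β : Cov W) : B (α + α') β = B α β + B α' β := by
  rw [hB.skew, hB.add_right, hB.skew β α, hB.skew β α']
  ring

theorem neg_right (α β : Cov W) : B α (-β) = -B α β := by
  obtain ⟨a₁, a₂, h⟩ := hB.vec α
  simp only [h, neg_apply]
  ring

theorem zero_right (α : Cov W) : B α 0 = 0 := by
  obtain ⟨a₁, a₂, h⟩ := hB.vec α
  simp [h]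

theorem sub_right (α β β' : Cov W) : B α (β - β') = B α β - B α β' := by
  rw [sub_eq_add_neg, hB.add_right, hB.neg_right, sub_eq_add_neg]

end IsBivector

/-- The derivative at `p` of a field of forms, evaluated at two constant covectors. -/
def dForm (B : W → Form W) (p : W) (β γ : Cov W) : Cov W := fderiv ℝ (fun ξ => B ξ β γ) p

/-- The field of forms `B` can be differentiated at `p` by the product rule. -/
def FormDifferentiableAt (B : W → Form W) (p : W) : Prop :=
  ∀ a b : W → Cov W, DifferentiableAt ℝ a p → DifferentiableAt ℝ b p →
    DifferentiableAt ℝ (fun ξ => B ξ (a ξ) (b ξ)) p ∧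
    ∀ v, fderiv ℝ (fun ξ => B ξ (a ξ) (b ξ)) p v =
      dForm B p (a p) (b p) v + B p (fderiv ℝ a p v) (b p) + B p (a p) (fderiv ℝ b p v)

/-- The bracket `{f, h} = B(df, dh)` defined by a field of bilinear forms on a vector space. -/
def bracket (B : W → Form W) (f h : W → ℂ) (ξ : W) : ℂ :=
  B ξ (fderiv ℝ f ξ) (fderiv ℝ h ξ)

variable {B : W → Form W} {f g h : W → ℂ} {p : W}

theorem differentiableAt_fderiv (hf : ContDiffAt ℝ 2 f p) :
    DifferentiableAt ℝ (fderiv ℝ f) p :=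
  (hf.fderiv_right (m := 1) le_rfl).differentiableAt one_ne_zero

theorem snd_fderiv_symm (hf : ContDiffAt ℝ 2 f p) (v w : W) :
    fderiv ℝ (fderiv ℝ f) p v w = fderiv ℝ (fderiv ℝ f) p w v :=
  hf.isSymmSndFDerivAt (by simp) v w

theorem differentiableAt_bracket (hB : FormDifferentiableAt B p) (hf : ContDiffAt ℝ 2 f p)
    (hh : ContDiffAt ℝ 2 h p) : DifferentiableAt ℝ (bracket B f h) p :=
  (hB _ _ (differentiableAt_fderiv hf) (differentiableAt_fderiv hh)).1

theorem fderiv_bracket_apply (hB : FormDifferentiableAt B p) (hf : ContDiffAt ℝ 2 f p)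
    (hh : ContDiffAt ℝ 2 h p) (v : W) :
    fderiv ℝ (bracket B f h) p v = dForm B p (fderiv ℝ f p) (fderiv ℝ h p) v +
      B p (fderiv ℝ (fderiv ℝ f) p v) (fderiv ℝ h p) +
      B p (fderiv ℝ f p) (fderiv ℝ (fderiv ℝ h) p v) :=
  (hB _ _ (differentiableAt_fderiv hf) (differentiableAt_fderiv hh)).2 v

/-- The differential of a bracket, where the two covectors are contracted with the bivector into
complex vectors. -/
theorem fderiv_bracket (hB : FormDifferentiableAt B p) (hp : IsBivector (B p))
    (hf : ContDiffAt ℝ 2 f p) (hh : ContDiffAt ℝ 2 h p) {a₁ a₂ c₁ c₂ : W}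
    (ha : ∀ θ : Cov W, B p (fderiv ℝ f p) θ = θ a₁ + Complex.I * θ a₂)
    (hc : ∀ θ : Cov W, B p (fderiv ℝ h p) θ = θ c₁ + Complex.I * θ c₂) :
    fderiv ℝ (bracket B f h) p = dForm B p (fderiv ℝ f p) (fderiv ℝ h p) +
      (fderiv ℝ (fderiv ℝ h) p a₁ + Complex.I • fderiv ℝ (fderiv ℝ h) p a₂) -
      (fderiv ℝ (fderiv ℝ f) p c₁ + Complex.I • fderiv ℝ (fderiv ℝ f) p c₂) := by
  ext v
  rw [fderiv_bracket_apply hB hf hh, hp.skew _ (fderiv ℝ h p), ha, hc, snd_fderiv_symm hf v,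
    snd_fderiv_symm hf v, snd_fderiv_symm hh v, snd_fderiv_symm hh v]
  simp only [add_apply, sub_apply, smul_apply, smul_eq_mul]
  ring

/-- The Jacobiator of the bracket of a bivector field is a tensor: the second derivatives of the
functions cancel because they are symmetric and the bivector is skew. -/
theorem jacobiator_eq (hB : FormDifferentiableAt B p) (hp : IsBivector (B p))
    (hf : ContDiffAt ℝ 2 f p) (hg : ContDiffAt ℝ 2 g p) (hh : ContDiffAt ℝ 2 h p) :
    bracket B f (bracket B g h) p + bracket B g (bracket B h f) p +
        bracket B h (bracket B f g) p =
      B p (fderiv ℝ f p) (dForm B p (fderiv ℝ g p) (fderiv ℝ h p)) +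
      B p (fderiv ℝ g p) (dForm B p (fderiv ℝ h p) (fderiv ℝ f p)) +
      B p (fderiv ℝ h p) (dForm B p (fderiv ℝ f p) (fderiv ℝ g p)) := by
  obtain ⟨a₁, a₂, ha⟩ := hp.vec (fderiv ℝ f p)
  obtain ⟨b₁, b₂, hb⟩ := hp.vec (fderiv ℝ g p)
  obtain ⟨c₁, c₂, hc⟩ := hp.vec (fderiv ℝ h p)
  simp only [bracket]
  rw [fderiv_bracket hB hp hg hh hb hc, fderiv_bracket hB hp hh hf hc ha,
    fderiv_bracket hB hp hf hg ha hb]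
  simp only [hp.add_right, hp.sub_right, hp.smul_right]
  simp only [ha, hb, hc]
  rw [snd_fderiv_symm hf b₁ c₁, snd_fderiv_symm hf b₁ c₂, snd_fderiv_symm hf b₂ c₁,
    snd_fderiv_symm hf b₂ c₂, snd_fderiv_symm hg a₁ c₁, snd_fderiv_symm hg a₁ c₂,
    snd_fderiv_symm hg a₂ c₁, snd_fderiv_symm hg a₂ c₂, snd_fderiv_symm hh b₁ a₁,
    snd_fderiv_symm hh b₁ a₂, snd_fderiv_symm hh b₂ a₁, snd_fderiv_symm hh b₂ a₂]
  ring

/-- The derivative of `f` along the complex vector field `½ (V + i U)`. -/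
def derivAlong (V U : W → W) (f : W → ℂ) (ξ : W) : ℂ :=
  (1 / 2 : ℂ) * (fderiv ℝ f ξ (V ξ) + Complex.I * fderiv ℝ f ξ (U ξ))

theorem hasFDerivAt_derivAlong {V U : W → W} (hf : ContDiffAt ℝ 2 f p)
    (hV : DifferentiableAt ℝ V p) (hU : DifferentiableAt ℝ U p) :
    HasFDerivAt (derivAlong V U f)
      ((1 / 2 : ℂ) • (fderiv ℝ (fderiv ℝ f) p (V p) + (fderiv ℝ f p).comp (fderiv ℝ V p) +
        Complex.I • (fderiv ℝ (fderiv ℝ f) p (U p) + (fderiv ℝ f p).comp (fderiv ℝ U p)))) p := by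
  have h1 := (differentiableAt_fderiv hf).hasFDerivAt.clm_apply hV.hasFDerivAt
  have h2 := (differentiableAt_fderiv hf).hasFDerivAt.clm_apply hU.hasFDerivAt
  refine ((h1.add (h2.const_mul Complex.I)).const_mul (1 / 2 : ℂ)).congr_fderiv ?_
  ext v
  simp [snd_fderiv_symm hf v]
  ring

/-- The Lie derivative of a bivector field along the `(0,1)`-part of `V`, evaluated on two covectors
of type `(1,0)`: it involves only the values of `V` and the derivatives of the bivector field and of
the almost complex structure `J`. -/
theorem lieDeriv_eq {J : W → W →L[ℝ] W} {V : W → W} (hB : FormDifferentiableAt B p)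
    (hp : IsBivector (B p)) (hJ : DifferentiableAt ℝ J p) (hV : DifferentiableAt ℝ V p)
    (hf : ContDiffAt ℝ 2 f p) (hh : ContDiffAt ℝ 2 h p)
    (hfJ : ∀ w, fderiv ℝ f p (J p w) = Complex.I * fderiv ℝ f p w)
    (hhJ : ∀ w, fderiv ℝ h p (J p w) = Complex.I * fderiv ℝ h p w) :
    derivAlong V (fun ξ => J ξ (V ξ)) (bracket B f h) p
        - bracket B (derivAlong V (fun ξ => J ξ (V ξ)) f) h p
        - bracket B f (derivAlong V (fun ξ => J ξ (V ξ)) h) p =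
      (1 / 2 : ℂ) * (dForm B p (fderiv ℝ f p) (fderiv ℝ h p) (V p) +
        Complex.I * dForm B p (fderiv ℝ f p) (fderiv ℝ h p) (J p (V p))
        - Complex.I * B p ((fderiv ℝ f p).comp ((fderiv ℝ J p).flip (V p))) (fderiv ℝ h p)
        - Complex.I * B p (fderiv ℝ f p) ((fderiv ℝ h p).comp ((fderiv ℝ J p).flip (V p)))) := by
  have hUd : HasFDerivAt (fun ξ => J ξ (V ξ))
      ((J p).comp (fderiv ℝ V p) + (fderiv ℝ J p).flip (V p)) p :=
    hJ.hasFDerivAt.clm_apply hV.hasFDerivAt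
  have key : ∀ {k : W → ℂ}, ContDiffAt ℝ 2 k p →
      (∀ w, fderiv ℝ k p (J p w) = Complex.I * fderiv ℝ k p w) →
      fderiv ℝ (derivAlong V (fun ξ => J ξ (V ξ)) k) p =
        (1 / 2 : ℂ) • (fderiv ℝ (fderiv ℝ k) p (V p) +
          Complex.I • fderiv ℝ (fderiv ℝ k) p (J p (V p)) +
          Complex.I • (fderiv ℝ k p).comp ((fderiv ℝ J p).flip (V p))) := by
    intro k hk hkJ
    rw [(hasFDerivAt_derivAlong hk hV hUd.differentiableAt).fderiv, hUd.fderiv]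
    ext v
    simp only [smul_apply, add_apply, ContinuousLinearMap.comp_apply, smul_eq_mul, map_add, hkJ]
    linear_combination (1 / 2 : ℂ) * fderiv ℝ k p (fderiv ℝ V p v) * Complex.I_sq
  change (1 / 2 : ℂ) * (fderiv ℝ (bracket B f h) p _ + Complex.I * fderiv ℝ (bracket B f h) p _) -
    B p (fderiv ℝ (derivAlong _ _ f) p) _ - B p _ (fderiv ℝ (derivAlong _ _ h) p) = _
  rw [key hf hfJ, key hh hhJ, fderiv_bracket_apply hB hf hh, fderiv_bracket_apply hB hf hh]
  simp only [hp.smul_left, hp.smul_right, hp.add_left, hp.add_right]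
  ring

end Calculus

/-! ### Real and complex covectors -/

section Complexification

variable {E : Type*} [NormedAddCommGroup E] [NormedSpace ℝ E]

/-- The real part of a complex covector. -/
def reCov : Cov E →L[ℝ] (E →L[ℝ] ℝ) := ContinuousLinearMap.compL ℝ E ℂ ℝ Complex.reCLM

/-- The imaginary part of a complex covector. -/
def imCov : Cov E →L[ℝ] (E →L[ℝ] ℝ) := ContinuousLinearMap.compL ℝ E ℂ ℝ Complex.imCLM

/-- A real covector as a complex covector. -/
def ofRealCov (τ : E →L[ℝ] ℝ) : Cov E := Complex.ofRealCLM.comp τ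

@[simp] theorem reCov_apply (α : Cov E) (v : E) : reCov α v = (α v).re := rfl
@[simp] theorem imCov_apply (α : Cov E) (v : E) : imCov α v = (α v).im := rfl
@[simp] theorem ofRealCov_apply (τ : E →L[ℝ] ℝ) (v : E) : ofRealCov τ v = (τ v : ℂ) := rfl

@[simp] theorem reCov_ofRealCov (τ : E →L[ℝ] ℝ) : reCov (ofRealCov τ) = τ := by
  ext v; simp

@[simp] theorem imCov_ofRealCov (τ : E →L[ℝ] ℝ) : imCov (ofRealCov τ) = 0 := by
  ext v; simp

theorem cov_eq_re_add_im (α : Cov E) :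
    α = ofRealCov (reCov α) + Complex.I • ofRealCov (imCov α) := by
  ext v
  simp [mul_comm Complex.I, Complex.re_add_im]

theorem reCov_smul (c : ℂ) (α : Cov E) : reCov (c • α) = c.re • reCov α - c.im • imCov α := by
  ext v; simp

theorem imCov_smul (c : ℂ) (α : Cov E) : imCov (c • α) = c.re • imCov α + c.im • reCov α := by
  ext v; simp

/-- The complex bilinear extension of the real bivector `(α, β) ↦ β (R α)`. -/
def toForm (R : (E →L[ℝ] ℝ) →L[ℝ] E) : Form E := fun α β =>
  β (R (reCov α)) + Complex.I * β (R (imCov α))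

theorem toForm_apply (R : (E →L[ℝ] ℝ) →L[ℝ] E) (α β : Cov E) :
    toForm R α β = β (R (reCov α)) + Complex.I * β (R (imCov α)) := rfl

theorem toForm_ofRealCov (R : (E →L[ℝ] ℝ) →L[ℝ] E) (τ : E →L[ℝ] ℝ) (β : Cov E) :
    toForm R (ofRealCov τ) β = β (R τ) := by
  simp [toForm_apply]

theorem toForm_add_left (R : (E →L[ℝ] ℝ) →L[ℝ] E) (α α' β : Cov E) :
    toForm R (α + α') β = toForm R α β + toForm R α' β := by
  simp only [toForm_apply, map_add]
  ring

theorem toForm_smul_left (R : (E →L[ℝ] ℝ) →L[ℝ] E) (c : ℂ) (α β : Cov E) :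
    toForm R (c • α) β = c * toForm R α β := by
  simp only [toForm_apply, reCov_smul, imCov_smul, map_add, map_sub, map_smul, Complex.real_smul]
  conv_rhs => rw [← Complex.re_add_im c]
  linear_combination (-(c.im : ℂ) * β (R (imCov α))) * Complex.I_sq

theorem toForm_add_right (R : (E →L[ℝ] ℝ) →L[ℝ] E) (α β β' : Cov E) :
    toForm R α (β + β') = toForm R α β + toForm R α β' := by
  simp only [toForm_apply, add_apply]
  ring

theorem toForm_smul_right (R : (E →L[ℝ] ℝ) →L[ℝ] E) (c : ℂ) (α β : Cov E) :
    toForm R α (c • β) = c * toForm R α β := by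
  simp only [toForm_apply, smul_apply, smul_eq_mul]
  ring

/-- A real operator `R : E* → E` which is skew gives a bivector. -/
theorem isBivector_toForm {R : (E →L[ℝ] ℝ) →L[ℝ] E} (hR : ∀ τ σ : E →L[ℝ] ℝ, σ (R τ) = -τ (R σ)) :
    IsBivector (toForm R) where
  skew α β := by
    have hre : ∀ (γ : Cov E) v, γ v = (reCov γ v : ℂ) + Complex.I * (imCov γ v : ℂ) := fun γ v => by
      simp [mul_comm Complex.I, Complex.re_add_im]
    rw [toForm_apply, toForm_apply, hre β, hre β, hre α, hre α, hR (reCov α) (reCov β),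
      hR (imCov α) (imCov β), hR (imCov α) (reCov β), hR (reCov α) (imCov β)]
    push_cast
    ring
  vec α := ⟨R (reCov α), R (imCov α), fun _ => rfl⟩

end Complexification

/-! ### Combinations of three real bivectors with complex coefficients -/

section Combination

variable {W : Type*} [NormedAddCommGroup W] [NormedSpace ℝ W]
  {E : Type*} [NormedAddCommGroup E] [NormedSpace ℝ E]

/-- The form `∑ₖ cₖ Rₖ`, where the real bivectors `Rₖ` are extended complex bilinearly. -/
def comb (c : Fin 3 → ℂ) (R : Fin 3 → (E →L[ℝ] ℝ) →L[ℝ] E) : Form E := fun α β =>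
  ∑ k, c k * toForm (R k) α β

theorem comb_apply (c : Fin 3 → ℂ) (R : Fin 3 → (E →L[ℝ] ℝ) →L[ℝ] E) (α β : Cov E) :
    comb c R α β = c 0 * toForm (R 0) α β + c 1 * toForm (R 1) α β + c 2 * toForm (R 2) α β := by
  simp [comb, Fin.sum_univ_three]

theorem toForm_sub_left (R : (E →L[ℝ] ℝ) →L[ℝ] E) (α α' β : Cov E) :
    toForm R (α - α') β = toForm R α β - toForm R α' β := by
  simp only [toForm_apply, map_sub]
  ring

theorem isBivector_comb (c : Fin 3 → ℂ) {R : Fin 3 → (E →L[ℝ] ℝ) →L[ℝ] E}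
    (hR : ∀ k, ∀ τ σ : E →L[ℝ] ℝ, σ (R k τ) = -τ (R k σ)) : IsBivector (comb c R) where
  skew α β := by
    simp only [comb, ← Finset.sum_neg_distrib]
    refine Finset.sum_congr rfl fun k _ => ?_
    rw [(isBivector_toForm (hR k)).skew α β]
    ring
  vec α := by
    refine ⟨∑ k, ((c k).re • R k (reCov α) - (c k).im • R k (imCov α)),
      ∑ k, ((c k).re • R k (imCov α) + (c k).im • R k (reCov α)), fun θ => ?_⟩
    simp only [comb, map_sum, Finset.mul_sum, ← Finset.sum_add_distrib]
    refine Finset.sum_congr rfl fun k _ => ?_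
    simp only [toForm_apply, map_add, map_sub, map_smul, Complex.real_smul]
    conv_lhs => rw [← Complex.re_add_im (c k)]
    linear_combination (((c k).im : ℂ) * θ (R k (imCov α))) * Complex.I_sq

theorem comb_add_left (c : Fin 3 → ℂ) (R : Fin 3 → (E →L[ℝ] ℝ) →L[ℝ] E) (α α' β : Cov E) :
    comb c R (α + α') β = comb c R α β + comb c R α' β := by
  simp only [comb_apply, toForm_add_left]; ring

theorem comb_add_right (c : Fin 3 → ℂ) (R : Fin 3 → (E →L[ℝ] ℝ) →L[ℝ] E) (α β β' : Cov E) :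
    comb c R α (β + β') = comb c R α β + comb c R α β' := by
  simp only [comb_apply, toForm_add_right]; ring

theorem comb_smul_left (c : Fin 3 → ℂ) (R : Fin 3 → (E →L[ℝ] ℝ) →L[ℝ] E) (z : ℂ) (α β : Cov E) :
    comb c R (z • α) β = z * comb c R α β := by
  simp only [comb_apply, toForm_smul_left]; ring

theorem comb_smul_right (c : Fin 3 → ℂ) (R : Fin 3 → (E →L[ℝ] ℝ) →L[ℝ] E) (z : ℂ) (α β : Cov E) :
    comb c R α (z • β) = z * comb c R α β := by
  simp only [comb_apply, toForm_smul_right]; ring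

theorem exists_hasFDerivAt_toForm {R : W → (E →L[ℝ] ℝ) →L[ℝ] E} {a b : W → Cov E} {p : W}
    (hR : DifferentiableAt ℝ R p) (ha : DifferentiableAt ℝ a p) (hb : DifferentiableAt ℝ b p) :
    ∃ L : W →L[ℝ] ℂ, HasFDerivAt (fun w => toForm (R w) (a w) (b w)) L p ∧
      ∀ v, L v = toForm (fderiv ℝ R p v) (a p) (b p) + toForm (R p) (fderiv ℝ a p v) (b p) +
        toForm (R p) (a p) (fderiv ℝ b p v) := by
  have h1 := hb.hasFDerivAt.clm_apply
    (hR.hasFDerivAt.clm_apply (reCov.hasFDerivAt.comp p ha.hasFDerivAt))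
  have h2 := hb.hasFDerivAt.clm_apply
    (hR.hasFDerivAt.clm_apply (imCov.hasFDerivAt.comp p ha.hasFDerivAt))
  refine ⟨_, h1.add (h2.const_mul Complex.I), fun v => ?_⟩
  simp [toForm_apply]
  ring

/-- Product rule for a combination `∑ₖ cₖ Rₖ` with variable coefficients and variable real
bivectors, the covectors being transported by a fixed map. -/
theorem formDifferentiableAt_comb {c : Fin 3 → W → ℂ} {R : Fin 3 → W → (E →L[ℝ] ℝ) →L[ℝ] E}
    (P : Cov W →L[ℝ] Cov E) {p : W} (hc : ∀ k, DifferentiableAt ℝ (c k) p)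
    (hR : ∀ k, DifferentiableAt ℝ (R k) p) :
    FormDifferentiableAt (fun w α β => comb (fun k => c k w) (fun k => R k w) (P α) (P β)) p ∧
    ∀ α β v, dForm (fun w α β => comb (fun k => c k w) (fun k => R k w) (P α) (P β)) p α β v =
      comb (fun k => fderiv ℝ (c k) p v) (fun k => R k p) (P α) (P β) +
      comb (fun k => c k p) (fun k => fderiv ℝ (R k) p v) (P α) (P β) := by
  have main : ∀ a b : W → Cov W, DifferentiableAt ℝ a p → DifferentiableAt ℝ b p →
      ∃ L : W →L[ℝ] ℂ, HasFDerivAt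
        (fun w => comb (fun k => c k w) (fun k => R k w) (P (a w)) (P (b w))) L p ∧
      ∀ v, L v = comb (fun k => fderiv ℝ (c k) p v) (fun k => R k p) (P (a p)) (P (b p)) +
        comb (fun k => c k p) (fun k => fderiv ℝ (R k) p v) (P (a p)) (P (b p)) +
        comb (fun k => c k p) (fun k => R k p) (P (fderiv ℝ a p v)) (P (b p)) +
        comb (fun k => c k p) (fun k => R k p) (P (a p)) (P (fderiv ℝ b p v)) := by
    intro a b ha hb
    have ha' : HasFDerivAt (fun w => P (a w)) (P.comp (fderiv ℝ a p)) p :=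
      P.hasFDerivAt.comp p ha.hasFDerivAt
    have hb' : HasFDerivAt (fun w => P (b w)) (P.comp (fderiv ℝ b p)) p :=
      P.hasFDerivAt.comp p hb.hasFDerivAt
    choose L hL hLv using fun k =>
      exists_hasFDerivAt_toForm (hR k) ha'.differentiableAt hb'.differentiableAt
    refine ⟨_, HasFDerivAt.fun_sum fun k _ => (hc k).hasFDerivAt.mul (hL k), fun v => ?_⟩
    simp only [sum_apply, comb, ← Finset.sum_add_distrib]
    refine Finset.sum_congr rfl fun k _ => ?_
    simp only [add_apply, smul_apply, smul_eq_mul, hLv, ha'.fderiv, hb'.fderiv,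
      ContinuousLinearMap.comp_apply]
    ring
  have hd : ∀ α β v, dForm (fun w α β => comb (fun k => c k w) (fun k => R k w) (P α) (P β)) p α β v =
      comb (fun k => fderiv ℝ (c k) p v) (fun k => R k p) (P α) (P β) +
      comb (fun k => c k p) (fun k => fderiv ℝ (R k) p v) (P α) (P β) := by
    intro α β v
    obtain ⟨L, hL, hLv⟩ := main (fun _ => α) (fun _ => β) (differentiableAt_const _)
      (differentiableAt_const _)
    rw [dForm, hL.fderiv, hLv]
    simp [comb, toForm_apply]
  refine ⟨fun a b ha hb => ?_, hd⟩
  obtain ⟨L, hL, hLv⟩ := main a b ha hb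
  exact ⟨hL.differentiableAt, fun v => by rw [hL.fderiv, hLv, hd]⟩

end Combination

/-! ### Quaternionic Hermitian linear algebra -/

section Algebra

variable {E : Type*} [NormedAddCommGroup E] [NormedSpace ℝ E]

/-- `g` is an inner product, and the operators `S₀, S₁, S₂` are orthogonal complex structures with
`S₀ S₁ = S₂ = -S₁ S₀`. -/
structure IsQuaternionic (g : E →L[ℝ] E →L[ℝ] ℝ) (S : Fin 3 → E →L[ℝ] E) : Prop where
  symm : ∀ v w, g v w = g w v
  pos : ∀ v, v ≠ 0 → 0 < g v v
  herm : ∀ k v w, g (S k v) (S k w) = g v w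
  sq : ∀ k v, S k (S k v) = -v
  s01 : ∀ v, S 0 (S 1 v) = S 2 v
  s10 : ∀ v, S 1 (S 0 v) = -S 2 v

/-- The operator `t₀ S₀ + t₁ S₁ + t₂ S₂`. -/
def quat (t : Fin 3 → ℝ) (S : Fin 3 → E →L[ℝ] E) : E →L[ℝ] E :=
  t 0 • S 0 + t 1 • S 1 + t 2 • S 2

theorem quat_apply (t : Fin 3 → ℝ) (S : Fin 3 → E →L[ℝ] E) (v : E) :
    quat t S v = t 0 • S 0 v + t 1 • S 1 v + t 2 • S 2 v := rfl

/-- The bivectors `Rₖ = -Sₖ g⁻¹`, inverse to the forms `g(Sₖ ·, ·)`. -/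
def invForm (g : E →L[ℝ] E →L[ℝ] ℝ) (S : Fin 3 → E →L[ℝ] E) (k : Fin 3) :
    (E →L[ℝ] ℝ) →L[ℝ] E := -(S k).comp g.inverse

theorem invForm_apply (g : E →L[ℝ] E →L[ℝ] ℝ) (S : Fin 3 → E →L[ℝ] E) (k : Fin 3)
    (τ : E →L[ℝ] ℝ) : invForm g S k τ = -S k (g.inverse τ) := rfl

theorem isInvertible_of_pos [FiniteDimensional ℝ E] {g : E →L[ℝ] E →L[ℝ] ℝ}
    (hg : ∀ v, v ≠ 0 → 0 < g v v) : g.IsInvertible := by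
  have hinj : Function.Injective g := by
    refine (injective_iff_map_eq_zero g).2 fun v hv => ?_
    by_contra h
    have := hg v h
    simp [hv] at this
  have hfin : Module.finrank ℝ E = Module.finrank ℝ (E →L[ℝ] ℝ) := by
    rw [← (LinearMap.toContinuousLinearMap (𝕜 := ℝ) (E := E) (F' := ℝ)).finrank_eq]
    exact (Subspace.dual_finrank_eq (K := ℝ) (V := E)).symm
  have : FiniteDimensional ℝ (E →L[ℝ] ℝ) :=
    (LinearMap.toContinuousLinearMap (𝕜 := ℝ) (E := E) (F' := ℝ)).finiteDimensional
  let e : E ≃ₗ[ℝ] (E →L[ℝ] ℝ) :=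
    LinearEquiv.ofInjectiveOfFinrankEq (g : E →ₗ[ℝ] (E →L[ℝ] ℝ)) hinj hfin
  exact ⟨e.toContinuousLinearEquiv, by ext; rfl⟩

namespace IsQuaternionic

variable {g : E →L[ℝ] E →L[ℝ] ℝ} {S : Fin 3 → E →L[ℝ] E} (h : IsQuaternionic g S)
include h

theorem s12 (v : E) : S 1 (S 2 v) = S 0 v := by
  have := h.s10 (S 0 (S 2 v))
  rw [h.sq 0, map_neg] at this
  rw [← neg_inj, this, ← h.s01 v, h.sq 0, map_neg, neg_inj, ← h.s01 (S 1 v), h.sq 1, map_neg,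
    neg_neg]

theorem s20 (v : E) : S 2 (S 0 v) = S 1 v := by
  rw [← neg_inj, ← h.s10, h.sq, map_neg]

theorem s02 (v : E) : S 0 (S 2 v) = -S 1 v := by
  rw [← h.s01, h.sq]

theorem s21 (v : E) : S 2 (S 1 v) = -S 0 v := by
  rw [← h.s01, h.sq, map_neg]

theorem skew (k : Fin 3) (v w : E) : g (S k v) w = -g v (S k w) := by
  have := h.herm k v (S k w)
  rw [h.sq, map_neg] at this
  linarith

theorem quat_skew (t : Fin 3 → ℝ) (v w : E) : g (quat t S v) w = -g v (quat t S w) := by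
  simp only [quat_apply, map_add, map_smul, add_apply, smul_apply, smul_eq_mul, h.skew _ v w]
  ring

theorem quat_sq (t : Fin 3 → ℝ) (v : E) :
    quat t S (quat t S v) = -(t 0 ^ 2 + t 1 ^ 2 + t 2 ^ 2) • v := by
  simp only [quat_apply, map_add, map_smul, h.sq, h.s01, h.s10, h.s12, h.s21, h.s20, h.s02]
  module

variable [FiniteDimensional ℝ E]

theorem isInvertible : g.IsInvertible := isInvertible_of_pos h.pos

theorem inverse_apply (v : E) : g.inverse (g v) = v := h.isInvertible.inverse_apply_self v

theorem apply_inverse (τ : E →L[ℝ] ℝ) : g (g.inverse τ) = τ := h.isInvertible.self_apply_inverse τ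

end IsQuaternionic

end Algebra

/-! ### The `(2,0)`-part of a bivector -/

section Algebra

variable {E : Type*} [NormedAddCommGroup E] [NormedSpace ℝ E]

/-- The coefficients, in terms of the bivectors dual to `ω_I, ω_J, ω_K`, of the `(2,0)`-part for
`I_n` of the bivector dual to `ω_I`: the vector `½ (e - ⟨e, n⟩ n - i n × e)` with `e = (1, 0, 0)`. -/
def holCoef (n : Fin 3 → ℝ) : Fin 3 → ℂ :=
  ![(1 / 2 : ℂ) * (1 - n 0 ^ 2), (1 / 2 : ℂ) * (-(n 0 * n 1) - Complex.I * n 2),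
    (1 / 2 : ℂ) * (-(n 0 * n 2) + Complex.I * n 1)]

/-- The derivative of `holCoef` at `n` in the direction `V`. -/
def holCoefDeriv (n V : Fin 3 → ℝ) : Fin 3 → ℂ :=
  ![-(n 0 * V 0 : ℂ), (1 / 2 : ℂ) * (-(V 0 * n 1) - n 0 * V 1 - Complex.I * V 2),
    (1 / 2 : ℂ) * (-(V 0 * n 2) - n 0 * V 2 + Complex.I * V 1)]

/-- The projection `½ (α - i α ∘ A)` of covectors. -/
def projOneZero (A : E →L[ℝ] E) (α : Cov E) : Cov E := (1 / 2 : ℂ) • (α - Complex.I • α.comp A)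

theorem quat_neg (t : Fin 3 → ℝ) (S : Fin 3 → E →L[ℝ] E) : quat (-t) S = -quat t S := by
  ext v
  simp only [quat_apply, neg_apply, Pi.neg_apply]
  module

/-- The projection `(1 - a², -ab, -ac)` of `(1, 0, 0)` to the plane orthogonal to `n = (a, b, c)`. -/
def perp (n : Fin 3 → ℝ) : Fin 3 → ℝ := ![1 - n 0 ^ 2, -(n 0 * n 1), -(n 0 * n 2)]

theorem perp_sq {n : Fin 3 → ℝ} (hn : n 0 ^ 2 + n 1 ^ 2 + n 2 ^ 2 = 1) :
    perp n 0 ^ 2 + perp n 1 ^ 2 + perp n 2 ^ 2 = 1 - n 0 ^ 2 := by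
  simp only [perp, Matrix.cons_val]
  linear_combination n 0 ^ 2 * hn

namespace IsQuaternionic

variable {g : E →L[ℝ] E →L[ℝ] ℝ} {S : Fin 3 → E →L[ℝ] E} (h : IsQuaternionic g S)
  [FiniteDimensional ℝ E]
include h

theorem inverse_comp_quat (t : Fin 3 → ℝ) (τ : E →L[ℝ] ℝ) :
    g.inverse (τ.comp (quat t S)) = -quat t S (g.inverse τ) := by
  apply h.isInvertible.injective
  ext w
  rw [h.apply_inverse, map_neg, neg_apply, h.quat_skew, neg_neg, h.apply_inverse]
  rfl

theorem invForm_skew (k : Fin 3) (τ σ : E →L[ℝ] ℝ) :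
    σ (invForm g S k τ) = -τ (invForm g S k σ) := by
  conv_lhs => rw [← h.apply_inverse σ]
  conv_rhs => rw [← h.apply_inverse τ]
  rw [invForm_apply, invForm_apply, map_neg, map_neg, ← h.skew, h.symm, neg_neg]

theorem isBivector_comb (c : Fin 3 → ℂ) : IsBivector (comb c (invForm g S)) :=
  HypercomplexTwistor.isBivector_comb c h.invForm_skew

/-- The `(2,0)`-part of the bivector dual to the first fundamental form. -/
theorem toForm_projOneZero {n : Fin 3 → ℝ} (hn : n 0 ^ 2 + n 1 ^ 2 + n 2 ^ 2 = 1) (α β : Cov E) :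
    toForm (invForm g S 0) (projOneZero (quat n S) α) (projOneZero (quat n S) β) =
      comb (holCoef n) (invForm g S) α β := by
  have hR : ∀ γ : Cov E, toForm (invForm g S 0) (projOneZero (quat n S) α) γ =
      (1 / 2 : ℂ) * (toForm (invForm g S 0) α γ
        - Complex.I * toForm (invForm g S 0) (α.comp (quat n S)) γ) := fun γ => by
    rw [projOneZero, toForm_smul_left, toForm_sub_left, toForm_smul_left]
  have hre : reCov (α.comp (quat n S)) = (reCov α).comp (quat n S) := rfl
  have him : imCov (α.comp (quat n S)) = (imCov α).comp (quat n S) := rfl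
  have hn' : (n 0 : ℂ) ^ 2 + (n 1 : ℂ) ^ 2 + (n 2 : ℂ) ^ 2 = 1 := by exact_mod_cast hn
  rw [hR, comb_apply]
  simp only [toForm_apply, hre, him, invForm_apply, h.inverse_comp_quat]
  generalize g.inverse (reCov α) = x
  generalize g.inverse (imCov α) = y
  simp only [projOneZero, smul_apply, sub_apply, ContinuousLinearMap.comp_apply, smul_eq_mul,
    map_neg, neg_neg, quat_apply, map_add, map_smul, h.sq, h.s01, h.s10, h.s12, h.s21, h.s20,
    h.s02, smul_neg, Complex.real_smul, holCoef, Matrix.cons_val]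
  generalize β x = x', β (S 0 x) = x0, β (S 1 x) = x1, β (S 2 x) = x2, β y = y', β (S 0 y) = y0,
    β (S 1 y) = y1, β (S 2 y) = y2
  have hI := Complex.I_sq
  generalize Complex.I = i at *
  generalize (n 0 : ℂ) = a, (n 1 : ℂ) = b, (n 2 : ℂ) = c at *
  grind

theorem comb_holCoef_comp {n : Fin 3 → ℝ} (hn : n 0 ^ 2 + n 1 ^ 2 + n 2 ^ 2 = 1) (α β : Cov E) :
    comb (holCoef n) (invForm g S) (α.comp (quat n S)) β =
      Complex.I * comb (holCoef n) (invForm g S) α β := by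
  have hp : projOneZero (quat n S) (α.comp (quat n S)) =
      Complex.I • projOneZero (quat n S) α := by
    ext v
    simp only [projOneZero, smul_apply, sub_apply, ContinuousLinearMap.comp_apply, h.quat_sq, hn,
      smul_eq_mul, neg_smul, one_smul, map_neg]
    linear_combination (1 / 2 : ℂ) * α (quat n S v) * Complex.I_sq
  rw [← h.toForm_projOneZero hn, ← h.toForm_projOneZero hn, hp, toForm_smul_left]

theorem comb_holCoef_neg_comp {n : Fin 3 → ℝ} (hn : n 0 ^ 2 + n 1 ^ 2 + n 2 ^ 2 = 1)
    (α β : Cov E) :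
    comb (holCoef (-n)) (invForm g S) (α.comp (quat n S)) β =
      -(Complex.I * comb (holCoef (-n)) (invForm g S) α β) := by
  have := h.comb_holCoef_comp (n := -n) (by simpa using hn) α β
  have e : α.comp (quat (-n) S) = (-1 : ℂ) • α.comp (quat n S) := by
    rw [quat_neg]
    ext v
    simp
  rw [e, comb_smul_left] at this
  linear_combination -this

omit [FiniteDimensional ℝ E] in
/-- Contraction of the `(0,2)`-bivector with a real covector `τ`: the `(0,1)`-part of the real vector
`-⟨e^⊥, (I, J, K)⟩ g⁻¹ τ`. -/
theorem comb_holCoef_neg_ofReal {n : Fin 3 → ℝ} (hn : n 0 ^ 2 + n 1 ^ 2 + n 2 ^ 2 = 1)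
    (τ : E →L[ℝ] ℝ) (δ : Cov E) :
    comb (holCoef (-n)) (invForm g S) (ofRealCov τ) δ =
      (1 / 2 : ℂ) * (δ (-quat (perp n) S (g.inverse τ)) +
        Complex.I * δ (quat n S (-quat (perp n) S (g.inverse τ)))) := by
  have hn' : (n 0 : ℂ) ^ 2 + (n 1 : ℂ) ^ 2 + (n 2 : ℂ) ^ 2 = 1 := by exact_mod_cast hn
  simp only [comb_apply, toForm_ofRealCov, invForm_apply]
  generalize g.inverse τ = x
  simp only [quat_apply, map_add, map_smul, map_neg, h.sq, h.s01, h.s10, h.s12, h.s21, h.s20,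
    h.s02, smul_neg, Complex.real_smul, holCoef, perp, Matrix.cons_val, Pi.neg_apply]
  push_cast
  generalize δ x = x', δ (S 0 x) = x0, δ (S 1 x) = x1, δ (S 2 x) = x2
  have hI := Complex.I_sq
  generalize Complex.I = i at *
  generalize (n 0 : ℂ) = a, (n 1 : ℂ) = b, (n 2 : ℂ) = c at *
  grind

/-- Away from the poles, every tangent vector arises in this way. -/
theorem exists_covector {n : Fin 3 → ℝ} (hn : n 0 ^ 2 + n 1 ^ 2 + n 2 ^ 2 = 1)
    (h0 : 1 - n 0 ^ 2 ≠ 0) (V : E) :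
    ∃ τ : E →L[ℝ] ℝ, -quat (perp n) S (g.inverse τ) = V := by
  refine ⟨g ((1 - n 0 ^ 2)⁻¹ • quat (perp n) S V), ?_⟩
  rw [h.inverse_apply, map_smul, h.quat_sq, perp_sq hn, smul_smul, ← neg_smul]
  rw [mul_neg, inv_mul_cancel₀ h0, neg_neg, one_smul]

/-- The dependence of the `(2,0)`-bivector on the point of the sphere is holomorphic: the derivative
of the coefficients in a `(0,1)`-direction of the sphere gives a bivector without
`(2,0)`-part. -/
theorem comb_sphere_derivative {n : Fin 3 → ℝ} {V : Fin 3 → ℝ}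
    (hV : n 0 * V 0 + n 1 * V 1 + n 2 * V 2 = 0) {α β : Cov E}
    (hn : n 0 ^ 2 + n 1 ^ 2 + n 2 ^ 2 = 1)
    (hα : ∀ v, α (quat n S v) = Complex.I * α v) (hβ : ∀ v, β (quat n S v) = Complex.I * β v) :
    comb (holCoefDeriv n V) (invForm g S) α β +
      Complex.I * comb (holCoefDeriv n (crossProduct n V)) (invForm g S) α β = 0 := by
  have hI := Complex.I_sq
  -- `q k` is minus the value at `(α, β)` of the `k`-th bivector; as a vector it satisfies
  -- `⟨n, q⟩ = 0` and `q × n = i q`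
  set q : Fin 3 → ℂ := fun k => -toForm (invForm g S k) α β with hqd
  have hx : quat n S (g.inverse (reCov α)) = g.inverse (imCov α) := by
    have : (reCov α).comp (quat n S) = -imCov α := by
      ext v; simp [hα]
    have h2 := h.inverse_comp_quat n (reCov α)
    rw [this, map_neg, neg_inj] at h2
    exact h2.symm
  have hx' : quat n S (g.inverse (imCov α)) = -g.inverse (reCov α) := by
    rw [← hx, h.quat_sq, hn, neg_one_smul]
  have hq : ∀ k, q k = β (S k (g.inverse (reCov α))) +
      Complex.I * β (S k (quat n S (g.inverse (reCov α)))) := by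
    intro k
    simp only [hqd, toForm_apply, invForm_apply, hx, map_neg]
    ring
  simp only [hx] at hq
  generalize g.inverse (reCov α) = x at hx hx' hq
  generalize g.inverse (imCov α) = y at hx hx' hq
  have hβx : β y = Complex.I * β x := by rw [← hx, hβ]
  have q0 : (n 0 : ℂ) * q 0 + (n 1 : ℂ) * q 1 + (n 2 : ℂ) * q 2 = 0 := by
    have e1 := congrArg β hx
    have e2 := congrArg β hx'
    simp only [quat_apply, map_add, map_smul, Complex.real_smul, map_neg] at e1 e2
    rw [hq, hq, hq]
    linear_combination e1 + Complex.I * e2 + hβx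
  have qc : ∀ k, β (quat n S (S k x)) + Complex.I * β (quat n S (S k y)) =
      Complex.I * q k := by
    intro k
    rw [hβ, hβ, hq]
    ring
  have hV' : (n 0 : ℂ) * V 0 + (n 1 : ℂ) * V 1 + (n 2 : ℂ) * V 2 = 0 := by exact_mod_cast hV
  have c0 := qc 0
  have c1 := qc 1
  have c2 := qc 2
  simp only [quat_apply, map_add, map_smul, Complex.real_smul, map_neg, smul_neg, h.sq, h.s01,
    h.s10, h.s12, h.s21, h.s20, h.s02] at c0 c1 c2
  have r0 := hq 0
  have r1 := hq 1
  have r2 := hq 2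
  have ht : ∀ k, toForm (invForm g S k) α β = -q k := fun k => (neg_neg _).symm
  rw [comb_apply, comb_apply, ht, ht, ht]
  simp only [holCoefDeriv, cross_apply, Matrix.cons_val]
  push_cast
  generalize q 0 = z0, q 1 = z1, q 2 = z2 at *
  have E0 : z1 * n 2 - z2 * n 1 = Complex.I * z0 := by
    rw [r1, r2]
    linear_combination c0 + n 0 * hβx * Complex.I + n 0 * β x * hI
  have E1 : z2 * n 0 - z0 * n 2 = Complex.I * z1 := by
    rw [r0, r2]
    linear_combination c1 + n 1 * hβx * Complex.I + n 1 * β x * hI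
  have E2 : z0 * n 1 - z1 * n 0 = Complex.I * z2 := by
    rw [r0, r1]
    linear_combination c2 + n 2 * hβx * Complex.I + n 2 * β x * hI
  clear c0 c1 c2 r0 r1 r2 hq ht qc
  generalize Complex.I = i at *
  generalize (n 0 : ℂ) = a, (n 1 : ℂ) = b, (n 2 : ℂ) = c, (V 0 : ℂ) = v0, (V 1 : ℂ) = v1,
    (V 2 : ℂ) = v2 at *
  clear hβx hβ hα
  linear_combination (norm := skip) (1 / 2 : ℂ) * ((2 * v0 + i * (b * v2 - c * v1)) * q0 - hV' * z0
    - (v2 * E1 - v1 * E2) + i * a * (v0 * E0 + v1 * E1 + v2 * E2))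
  ring_nf
  simp only [hI]
  ring

end IsQuaternionic

end Algebra

/-! ### The Schouten tensor of the three bivectors -/

section Schouten

open Filter Topology

set_option synthInstance.maxHeartbeats 200000

variable {E : Type*} [NormedAddCommGroup E] [NormedSpace ℝ E]

/-- The value `dω(a, b, c)` of the exterior derivative of a 2-form on a vector space. -/
def extDeriv₂ (σ : E → E →L[ℝ] E →L[ℝ] ℝ) (p a b c : E) : ℝ :=
  fderiv ℝ σ p a b c + fderiv ℝ σ p b c a + fderiv ℝ σ p c a b

theorem differentiableAt_clm_inverse {X Y : Type*} [NormedAddCommGroup X] [NormedSpace ℝ X]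
    [NormedAddCommGroup Y] [NormedSpace ℝ Y] [CompleteSpace X] {L : E → X →L[ℝ] Y} {p : E}
    (hL : DifferentiableAt ℝ L p) (hi : (L p).IsInvertible) :
    DifferentiableAt ℝ (fun ξ => (L ξ).inverse) p := by
  obtain ⟨e, he⟩ := hi
  have h1 : DifferentiableAt ℝ ContinuousLinearMap.inverse (L p) := by
    rw [← he]
    exact (contDiffAt_map_inverse (n := 1) e).differentiableAt one_ne_zero
  exact h1.comp p hL

theorem hasFDerivAt_sum_smul {Y : Type*} [NormedAddCommGroup Y] [NormedSpace ℝ Y]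
    {f : Fin 3 → E → Y} {p : E} (hf : ∀ k, DifferentiableAt ℝ (f k) p) (t : Fin 3 → ℝ) :
    HasFDerivAt (fun ξ => ∑ k, t k • f k ξ) (∑ k, t k • fderiv ℝ (f k) p) p :=
  HasFDerivAt.fun_sum fun k _ => (hf k).hasFDerivAt.fun_const_smul (t k)

theorem dForm_toForm {R : E → (E →L[ℝ] ℝ) →L[ℝ] E} {p : E} (hR : DifferentiableAt ℝ R p)
    (β γ : Cov E) (v : E) :
    dForm (fun ξ => toForm (R ξ)) p β γ v = toForm (fderiv ℝ R p v) β γ := by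
  obtain ⟨L, hL, hLv⟩ := exists_hasFDerivAt_toForm hR (differentiableAt_const β)
    (differentiableAt_const γ)
  rw [dForm, hL.fderiv, hLv]
  simp [toForm_apply]

/-- If the bivector `R` is inverse to the 2-form `ω`, up to a constant, then the derivative of `R`
is the derivative of `ω` with its indices raised. -/
theorem toForm_dForm_of_inverse {R : E → (E →L[ℝ] ℝ) →L[ℝ] E} {σ : E → E →L[ℝ] E →L[ℝ] ℝ} {p : E}
    {N : ℝ} (hR : DifferentiableAt ℝ R p) (hσ : DifferentiableAt ℝ σ p)
    (h₁ : ∀ᶠ ξ in 𝓝 p, ∀ v, R ξ (σ ξ v) = N • v) (h₂ : ∀ τ, σ p (R p τ) = N • τ)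
    (hs : ∀ v w, σ p v w = -σ p w v) (a b c : E) :
    toForm (R p) (ofRealCov (σ p a))
      (dForm (fun ξ => toForm (R ξ)) p (ofRealCov (σ p b)) (ofRealCov (σ p c))) =
      ((N ^ 2 * fderiv ℝ σ p a b c : ℝ) : ℂ) := by
  have hd : ∀ v, fderiv ℝ R p v (σ p b) = -R p (fderiv ℝ σ p v b) := by
    intro v
    have e1 : HasFDerivAt (fun ξ => R ξ (σ ξ b)) _ p :=
      hR.hasFDerivAt.clm_apply (hσ.hasFDerivAt.clm_apply (hasFDerivAt_const b p))
    have e2 : (fun ξ => R ξ (σ ξ b)) =ᶠ[𝓝 p] fun _ => N • b := by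
      filter_upwards [h₁] with ξ hξ using hξ b
    have e3 := congrArg (fun L : E →L[ℝ] E => L v)
      (e1.unique ((hasFDerivAt_const (N • b) p).congr_of_eventuallyEq e2))
    simp only [add_apply, ContinuousLinearMap.comp_apply, ContinuousLinearMap.flip_apply,
      zero_apply, map_zero, zero_add] at e3
    exact eq_neg_of_add_eq_zero_right e3
  rw [toForm_ofRealCov, h₁.self_of_nhds a, dForm_toForm hR, toForm_ofRealCov, ofRealCov_apply, hd,
    map_neg, hs, neg_neg, h₂]
  simp only [map_smul, smul_apply, smul_eq_mul]
  congr 1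
  ring

variable (g : E → E →L[ℝ] E →L[ℝ] ℝ) (S : Fin 3 → E → E →L[ℝ] E) (p : E)

/-- `g` and `S` are differentiable at `p`, and quaternionic Hermitian near `p`. -/
structure IsQuaternionicAt : Prop where
  isQuat : ∀ᶠ ξ in 𝓝 p, IsQuaternionic (g ξ) (fun k => S k ξ)
  diff_g : DifferentiableAt ℝ g p
  diff_S : ∀ k, DifferentiableAt ℝ (S k) p

/-- The bivector field `∑ₖ cₖ ωₖ⁻¹` with constant coefficients. -/
def field (c : Fin 3 → ℂ) (ξ : E) : Form E := comb c (invForm (g ξ) (fun k => S k ξ))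

/-- The fundamental form `ωₖ = g(Sₖ ·, ·)`. -/
def fundForm (k : Fin 3) (ξ : E) : E →L[ℝ] E →L[ℝ] ℝ := (g ξ).comp (S k ξ)

/-- One half of the terms of the Schouten bracket of the bivector fields with coefficients `c` and
`d`: the bracket is the sum of this expression and the one with `c` and `d` exchanged. -/
def schouten (c d : Fin 3 → ℂ) (α β γ : Cov E) : ℂ :=
  field g S c p α (dForm (field g S d) p β γ) + field g S c p β (dForm (field g S d) p γ α) +
    field g S c p γ (dForm (field g S d) p α β)

variable {g S p}

namespace IsQuaternionicAt

variable [FiniteDimensional ℝ E] (h : IsQuaternionicAt g S p)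
include h

theorem differentiableAt_inverse : DifferentiableAt ℝ (fun ξ => (g ξ).inverse) p := by
  have : CompleteSpace E := FiniteDimensional.complete ℝ E
  exact differentiableAt_clm_inverse (Y := E →L[ℝ] ℝ) h.diff_g h.isQuat.self_of_nhds.isInvertible

theorem differentiableAt_invForm (k : Fin 3) :
    DifferentiableAt ℝ (fun ξ => invForm (g ξ) (fun j => S j ξ) k) p :=
  ((h.diff_S k).clm_comp h.differentiableAt_inverse).neg

theorem formDifferentiableAt_field (c : Fin 3 → ℂ) : FormDifferentiableAt (field g S c) p :=
  (formDifferentiableAt_comb (c := fun k _ => c k) (ContinuousLinearMap.id ℝ (Cov E))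
    (fun _ => differentiableAt_const _) h.differentiableAt_invForm).1

theorem dForm_field (c : Fin 3 → ℂ) (α β : Cov E) (v : E) :
    dForm (field g S c) p α β v =
      comb c (fun k => fderiv ℝ (fun ξ => invForm (g ξ) (fun j => S j ξ) k) p v) α β := by
  have := (formDifferentiableAt_comb (c := fun k _ => c k) (ContinuousLinearMap.id ℝ (Cov E))
    (fun _ => differentiableAt_const _) h.differentiableAt_invForm).2 α β v
  refine this.trans ?_
  simp [comb]

theorem isBivector_field (c : Fin 3 → ℂ) : IsBivector (field g S c p) :=
  h.isQuat.self_of_nhds.isBivector_comb c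

theorem dForm_add_left (c : Fin 3 → ℂ) (α α' β : Cov E) :
    dForm (field g S c) p (α + α') β = dForm (field g S c) p α β + dForm (field g S c) p α' β := by
  ext v
  simp [h.dForm_field, comb_add_left]

theorem dForm_smul_left (c : Fin 3 → ℂ) (z : ℂ) (α β : Cov E) :
    dForm (field g S c) p (z • α) β = z • dForm (field g S c) p α β := by
  ext v
  simp [h.dForm_field, comb_smul_left]

theorem dForm_skew (c : Fin 3 → ℂ) (α β : Cov E) :
    dForm (field g S c) p α β = -dForm (field g S c) p β α := by
  have : (fun ξ => field g S c ξ α β) =ᶠ[𝓝 p] fun ξ => -field g S c ξ β α := by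
    filter_upwards [h.isQuat] with ξ hξ using (hξ.isBivector_comb c).skew α β
  rw [dForm, this.fderiv_eq, dForm]
  exact fderiv_fun_neg

theorem dForm_add_right (c : Fin 3 → ℂ) (α β β' : Cov E) :
    dForm (field g S c) p α (β + β') = dForm (field g S c) p α β + dForm (field g S c) p α β' := by
  ext v
  simp [h.dForm_field, comb_add_right]

theorem dForm_smul_right (c : Fin 3 → ℂ) (z : ℂ) (α β : Cov E) :
    dForm (field g S c) p α (z • β) = z • dForm (field g S c) p α β := by
  ext v
  simp [h.dForm_field, comb_smul_right]

omit [FiniteDimensional ℝ E] h in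
theorem schouten_rotate (c d : Fin 3 → ℂ) (α β γ : Cov E) :
    schouten g S p c d α β γ = schouten g S p c d β γ α := by
  simp only [schouten]
  ring

theorem schouten_add_left (c d : Fin 3 → ℂ) (α α' β γ : Cov E) :
    schouten g S p c d (α + α') β γ = schouten g S p c d α β γ + schouten g S p c d α' β γ := by
  have hb := h.isBivector_field c
  simp only [schouten, hb.add_left, h.dForm_add_left, h.dForm_add_right, hb.add_right]
  ring

theorem schouten_smul_left (c d : Fin 3 → ℂ) (z : ℂ) (α β γ : Cov E) :
    schouten g S p c d (z • α) β γ = z * schouten g S p c d α β γ := by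
  have hb := h.isBivector_field c
  simp only [schouten, hb.smul_left, h.dForm_smul_left, h.dForm_smul_right, hb.smul_right]
  ring

theorem schouten_eq_sum (c d : Fin 3 → ℂ) (α β γ : Cov E) :
    schouten g S p c d α β γ =
      ∑ k, ∑ l, c k * d l * schouten g S p (Pi.single k 1) (Pi.single l 1) α β γ := by
  have h1 : ∀ (c : Fin 3 → ℂ) (α θ : Cov E), field g S c p α θ =
      ∑ k, c k * field g S (Pi.single k 1) p α θ := by
    intro c α θ
    simp [field, comb, Pi.single_apply]
  have h2 : ∀ β γ : Cov E, dForm (field g S d) p β γ =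
      ∑ l, d l • dForm (field g S (Pi.single l 1)) p β γ := by
    intro β γ
    ext v
    simp [sum_apply, h.dForm_field, comb, Pi.single_apply]
  have h3 : ∀ (k : Fin 3) (α β γ : Cov E),
      field g S (Pi.single k 1) p α (dForm (field g S d) p β γ) =
      ∑ l, d l * field g S (Pi.single k 1) p α (dForm (field g S (Pi.single l 1)) p β γ) := by
    intro k α β γ
    have hb := h.isBivector_field (Pi.single k 1)
    simp only [h2, Fin.sum_univ_three, hb.add_right, hb.smul_right]
  simp only [schouten]
  rw [h1 c, h1 c, h1 c]
  simp only [h3, ← Finset.sum_add_distrib, Finset.mul_sum]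
  refine Finset.sum_congr rfl fun k _ => Finset.sum_congr rfl fun l _ => ?_
  ring

omit [FiniteDimensional ℝ E] in
theorem differentiableAt_fundForm (k : Fin 3) : DifferentiableAt ℝ (fundForm g S k) p :=
  h.diff_g.clm_comp (h.diff_S k)

/-- For a real coefficient vector `t` the Schouten bracket of `∑ tₖ ωₖ⁻¹` is the exterior derivative
of `∑ tₖ ωₖ`, with its indices raised. -/
theorem schouten_ofReal (t : Fin 3 → ℝ) (a b c : E) :
    schouten g S p (fun k => (t k : ℂ)) (fun k => (t k : ℂ))
      (ofRealCov (g p (quat t (fun k => S k p) a))) (ofRealCov (g p (quat t (fun k => S k p) b)))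
      (ofRealCov (g p (quat t (fun k => S k p) c))) =
    (((t 0 ^ 2 + t 1 ^ 2 + t 2 ^ 2) ^ 2 *
      ∑ k, t k * extDeriv₂ (fundForm g S k) p a b c : ℝ) : ℂ) := by
  set N := t 0 ^ 2 + t 1 ^ 2 + t 2 ^ 2
  let R : E → (E →L[ℝ] ℝ) →L[ℝ] E := fun ξ => ∑ k, t k • invForm (g ξ) (fun j => S j ξ) k
  let σ : E → E →L[ℝ] E →L[ℝ] ℝ := fun ξ => ∑ k, t k • fundForm g S k ξ
  have hfield : field g S (fun k => (t k : ℂ)) = fun ξ => toForm (R ξ) := by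
    ext ξ α β
    simp only [field, comb, toForm_apply, R, sum_apply, smul_apply, map_sum, map_smul,
      Finset.mul_sum, ← Finset.sum_add_distrib, Complex.real_smul]
    refine Finset.sum_congr rfl fun k _ => ?_
    ring
  have hRq : ∀ ξ τ, R ξ τ = -quat t (fun k => S k ξ) ((g ξ).inverse τ) := by
    intro ξ τ
    simp only [R, add_apply, smul_apply, Fin.sum_univ_three, invForm_apply, quat_apply]
    module
  have hσq : ∀ ξ v, σ ξ v = g ξ (quat t (fun k => S k ξ) v) := by
    intro ξ v
    simp only [σ, add_apply, smul_apply, Fin.sum_univ_three, fundForm, quat_apply,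
      ContinuousLinearMap.comp_apply, map_add, map_smul]
  have hR : DifferentiableAt ℝ R p :=
    (hasFDerivAt_sum_smul (Y := (E →L[ℝ] ℝ) →L[ℝ] E) h.differentiableAt_invForm t).differentiableAt
  have hσ' : HasFDerivAt σ (∑ k, t k • fderiv ℝ (fundForm g S k) p) p :=
    hasFDerivAt_sum_smul (Y := E →L[ℝ] E →L[ℝ] ℝ) h.differentiableAt_fundForm t
  have hσ : DifferentiableAt ℝ σ p := hσ'.differentiableAt
  have hdσ : ∀ a b c, fderiv ℝ σ p a b c = ∑ k, t k * fderiv ℝ (fundForm g S k) p a b c := by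
    intro a b c
    rw [hσ'.fderiv]
    simp [sum_apply]
  have h₁ : ∀ᶠ ξ in 𝓝 p, ∀ v, R ξ (σ ξ v) = N • v := by
    filter_upwards [h.isQuat] with ξ hξ v
    rw [hRq, hσq, hξ.inverse_apply, hξ.quat_sq, neg_smul, neg_neg]
  have hp := h.isQuat.self_of_nhds
  have h₂ : ∀ τ, σ p (R p τ) = N • τ := by
    intro τ
    rw [hRq, hσq, map_neg, hp.quat_sq, neg_smul, neg_neg, map_smul, hp.apply_inverse]
  have hs : ∀ v w, σ p v w = -σ p w v := by
    intro v w
    rw [hσq, hσq, hp.quat_skew, hp.symm]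
  have key := toForm_dForm_of_inverse hR hσ h₁ h₂ hs
  simp only [schouten, hfield, ← hσq, key, hdσ, extDeriv₂]
  push_cast
  simp only [Fin.sum_univ_three]
  ring

end IsQuaternionicAt

end Schouten

/-! ### Holomorphy in the directions of the manifold -/

section Schouten

open Filter Topology

set_option synthInstance.maxHeartbeats 200000

variable {E : Type*} [NormedAddCommGroup E] [NormedSpace ℝ E]
  {g : E → E →L[ℝ] E →L[ℝ] ℝ} {S : Fin 3 → E → E →L[ℝ] E} {p : E}

variable (g S p) in
/-- The obstruction to holomorphy of the `(2,0)`-bivector field in the directions of `M`: twice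
the Lie derivative along the `(0,1)`-part of `V`, for `I_n`, of the bivector field with coefficients
`c`, evaluated on two covectors of type `(1,0)`. -/
def dbarTensor (n : Fin 3 → ℝ) (c : Fin 3 → ℂ) (V : E) (α β : Cov E) : ℂ :=
  dForm (field g S c) p α β V +
    Complex.I * dForm (field g S c) p α β (quat n (fun k => S k p) V)
    - Complex.I * field g S c p
      (α.comp ((fderiv ℝ (fun ξ => quat n (fun k => S k ξ)) p).flip V)) β
    - Complex.I * field g S c p α
      (β.comp ((fderiv ℝ (fun ξ => quat n (fun k => S k ξ)) p).flip V))

namespace IsQuaternionicAt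

theorem differentiableAt_quat (h : IsQuaternionicAt g S p) (n : Fin 3 → ℝ) :
    DifferentiableAt ℝ (fun ξ => quat n (fun k => S k ξ)) p :=
  (((h.diff_S 0).fun_const_smul (n 0)).fun_add ((h.diff_S 1).fun_const_smul (n 1))).fun_add
    ((h.diff_S 2).fun_const_smul (n 2))

variable [FiniteDimensional ℝ E] (h : IsQuaternionicAt g S p)
include h

theorem schouten_add_add (c d : Fin 3 → ℂ) (α β γ : Cov E) :
    schouten g S p (c + d) (c + d) α β γ = schouten g S p c c α β γ +
      (schouten g S p c d α β γ + schouten g S p d c α β γ) + schouten g S p d d α β γ := by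
  rw [h.schouten_eq_sum (c + d), h.schouten_eq_sum c c, h.schouten_eq_sum c d,
    h.schouten_eq_sum d c, h.schouten_eq_sum d d]
  simp only [Fin.sum_univ_three, Pi.add_apply]
  ring

theorem schouten_smul_smul (z : ℂ) (c : Fin 3 → ℂ) (α β γ : Cov E) :
    schouten g S p (z • c) (z • c) α β γ = z ^ 2 * schouten g S p c c α β γ := by
  rw [h.schouten_eq_sum (z • c), h.schouten_eq_sum c c]
  simp only [Fin.sum_univ_three, Pi.smul_apply, smul_eq_mul]
  ring

theorem schouten_eq_zero_of_first {c d : Fin 3 → ℂ} {β γ : Cov E}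
    (h0 : ∀ τ, schouten g S p c d (ofRealCov τ) β γ + schouten g S p d c (ofRealCov τ) β γ = 0)
    (α : Cov E) : schouten g S p c d α β γ + schouten g S p d c α β γ = 0 := by
  rw [cov_eq_re_add_im α]
  simp only [h.schouten_add_left, h.schouten_smul_left]
  linear_combination h0 (reCov α) + Complex.I * h0 (imCov α)

theorem schouten_eq_zero_of_ofReal {c d : Fin 3 → ℂ}
    (h0 : ∀ τ σ ρ, schouten g S p c d (ofRealCov τ) (ofRealCov σ) (ofRealCov ρ) +
      schouten g S p d c (ofRealCov τ) (ofRealCov σ) (ofRealCov ρ) = 0) (α β γ : Cov E) :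
    schouten g S p c d α β γ + schouten g S p d c α β γ = 0 := by
  refine h.schouten_eq_zero_of_first (fun τ => ?_) α
  rw [schouten_rotate, schouten_rotate d c]
  refine h.schouten_eq_zero_of_first (fun σ => ?_) β
  rw [schouten_rotate, schouten_rotate d c]
  refine h.schouten_eq_zero_of_first (fun ρ => ?_) γ
  rw [schouten_rotate, schouten_rotate d c]
  exact h0 τ σ ρ

theorem schouten_self_eq_zero_of_extDeriv
    (hc : ∀ k a b c, extDeriv₂ (fundForm g S k) p a b c = 0) (t : Fin 3 → ℝ)
    (ht : t 0 ^ 2 + t 1 ^ 2 + t 2 ^ 2 ≠ 0) (α β γ : Cov E) :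
    schouten g S p (fun k => (t k : ℂ)) (fun k => (t k : ℂ)) α β γ = 0 := by
  have hp := h.isQuat.self_of_nhds
  have hτ : ∀ τ : E →L[ℝ] ℝ, ∃ a, g p (quat t (fun k => S k p) a) = τ := by
    intro τ
    refine ⟨(t 0 ^ 2 + t 1 ^ 2 + t 2 ^ 2)⁻¹ • -quat t (fun k => S k p) ((g p).inverse τ), ?_⟩
    rw [map_smul, map_neg, hp.quat_sq, neg_smul, neg_neg, inv_smul_smul₀ ht, hp.apply_inverse]
  have := h.schouten_eq_zero_of_ofReal (c := fun k => (t k : ℂ)) (d := fun k => (t k : ℂ))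
    (fun τ σ ρ => by
      obtain ⟨a, rfl⟩ := hτ τ
      obtain ⟨b, rfl⟩ := hτ σ
      obtain ⟨c, rfl⟩ := hτ ρ
      rw [h.schouten_ofReal]
      simp [hc]) α β γ
  exact add_self_eq_zero.1 this

theorem schouten_symm_eq_zero_of_extDeriv
    (hc : ∀ k a b c, extDeriv₂ (fundForm g S k) p a b c = 0) (c d : Fin 3 → ℂ) (α β γ : Cov E) :
    schouten g S p c d α β γ + schouten g S p d c α β γ = 0 := by
  have hz := h.schouten_self_eq_zero_of_extDeriv hc
  have e : ∀ t : Fin 3 → ℝ, t 0 ^ 2 + t 1 ^ 2 + t 2 ^ 2 ≠ 0 →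
      ∑ k, ∑ l, (t k : ℂ) * t l * schouten g S p (Pi.single k 1) (Pi.single l 1) α β γ = 0 :=
    fun t ht => by rw [← h.schouten_eq_sum, hz t ht]
  have e0 := e ![1, 0, 0] (by simp)
  have e1 := e ![0, 1, 0] (by simp)
  have e2 := e ![0, 0, 1] (by simp)
  have e01 := e ![1, 1, 0] (by simp)
  have e12 := e ![0, 1, 1] (by simp)
  have e02 := e ![1, 0, 1] (by simp)
  rw [h.schouten_eq_sum c d, h.schouten_eq_sum d c]
  simp [Fin.sum_univ_three] at e0 e1 e2 e01 e12 e02 ⊢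
  grind

/-- If the Schouten bracket of `ωₖ⁻¹` vanishes, then `ωₖ` is closed. -/
theorem extDeriv_eq_zero_of_schouten {k : Fin 3}
    (hk : ∀ α β γ, schouten g S p (Pi.single k 1) (Pi.single k 1) α β γ = 0) (a b c : E) :
    extDeriv₂ (fundForm g S k) p a b c = 0 := by
  have e : (fun j => (((Pi.single k 1 : Fin 3 → ℝ) j : ℝ) : ℂ)) = Pi.single k 1 := by
    ext j
    by_cases hj : j = k
    · subst hj; simp
    · simp [hj]
  have := h.schouten_ofReal (Pi.single k 1) a b c
  rw [e, hk] at this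
  have h2 := Complex.ofReal_eq_zero.1 this.symm
  fin_cases k <;> simpa [Fin.sum_univ_three] using h2

theorem field_holCoef_neg_eq_zero {n : Fin 3 → ℝ} (hn : n 0 ^ 2 + n 1 ^ 2 + n 2 ^ 2 = 1)
    {α : Cov E} (hα : ∀ v, α (quat n (fun k => S k p) v) = Complex.I * α v) (β : Cov E) :
    field g S (holCoef (-n)) p α β = 0 := by
  have h1 := h.isQuat.self_of_nhds.comb_holCoef_neg_comp hn α β
  have e : α.comp (quat n (fun k => S k p)) = Complex.I • α := by ext v; simp [hα]
  rw [e, comb_smul_left] at h1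
  have h2 : (2 * Complex.I) * field g S (holCoef (-n)) p α β = 0 := by
    rw [field]
    linear_combination h1
  simpa using h2

/-- Differentiation of `P̄(α ∘ I_n, ·) = -i P̄(α, ·)` for the `(0,2)`-bivector field `P̄`. -/
theorem dForm_holCoef_neg {n : Fin 3 → ℝ} (hn : n 0 ^ 2 + n 1 ^ 2 + n 2 ^ 2 = 1)
    {α : Cov E} (hα : ∀ v, α (quat n (fun k => S k p) v) = Complex.I * α v) (β : Cov E) (v : E) :
    dForm (field g S (holCoef (-n))) p α β v = Complex.I / 2 * field g S (holCoef (-n)) p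
      (α.comp (fderiv ℝ (fun ξ => quat n (fun k => S k ξ)) p v)) β := by
  have hA := h.differentiableAt_quat n
  have hL : HasFDerivAt (fun ξ => α.comp (quat n (fun k => S k ξ))) _ p :=
    (hasFDerivAt_const α p).clm_comp hA.hasFDerivAt
  obtain ⟨hd, he⟩ := h.formDifferentiableAt_field (holCoef (-n)) _ (fun _ => β) hL.differentiableAt
    (differentiableAt_const _)
  have hev : (fun ξ => field g S (holCoef (-n)) ξ (α.comp (quat n (fun k => S k ξ))) β) =ᶠ[𝓝 p]
      fun ξ => -Complex.I * field g S (holCoef (-n)) ξ α β := by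
    filter_upwards [h.isQuat] with ξ hξ
    exact (hξ.comb_holCoef_neg_comp hn α β).trans (neg_mul _ _).symm
  have h0 : DifferentiableAt ℝ (fun ξ => field g S (holCoef (-n)) ξ α β) p :=
    (h.formDifferentiableAt_field (holCoef (-n)) (fun _ => α) (fun _ => β)
      (differentiableAt_const _) (differentiableAt_const _)).1
  have h1 := congrArg (fun L : E →L[ℝ] ℂ => L v) hev.fderiv_eq
  simp only [he, hL.fderiv, (h0.hasFDerivAt.const_mul (-Complex.I)).fderiv] at h1
  have e : α.comp (quat n (fun k => S k p)) = Complex.I • α := by ext v; simp [hα]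
  have hb := h.isBivector_field (holCoef (-n))
  rw [e, h.dForm_smul_left] at h1
  have e3 : ((ContinuousLinearMap.compL ℝ E E ℂ α).comp
      (fderiv ℝ (fun ξ => quat n (fun k => S k ξ)) p)) v =
      α.comp (fderiv ℝ (fun ξ => quat n (fun k => S k ξ)) p v) := rfl
  have e4 : field g S (holCoef (-n)) p (Complex.I • α) ((fderiv ℝ (fun _ => β) p) v) = 0 := by
    simp [hb.zero_right]
  have e5 : ((ContinuousLinearMap.compL ℝ E E ℂ).flip (quat n fun k => S k p) ∘SL
      (0 : E →L[ℝ] Cov E)) v = 0 := by simp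
  simp only [e3, e5, e4, add_zero, smul_apply, smul_eq_mul, add_apply] at h1
  change _ = -Complex.I * dForm (field g S (holCoef (-n))) p α β v at h1
  have h2 : (2 * Complex.I) * dForm (field g S (holCoef (-n))) p α β v =
      -field g S (holCoef (-n)) p
        (α.comp (fderiv ℝ (fun ξ => quat n (fun k => S k ξ)) p v)) β := by
    linear_combination h1
  linear_combination (-(Complex.I / 2)) * h2 + dForm (field g S (holCoef (-n))) p α β v * Complex.I_sq

omit [FiniteDimensional ℝ E] in
theorem fderiv_quat_anticomm {n : Fin 3 → ℝ} (v w : E) :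
    fderiv ℝ (fun ξ => quat n (fun k => S k ξ)) p v (quat n (fun k => S k p) w) =
      -quat n (fun k => S k p) (fderiv ℝ (fun ξ => quat n (fun k => S k ξ)) p v w) := by
  have hA := h.differentiableAt_quat n
  have h1 : HasFDerivAt (fun ξ => quat n (fun k => S k ξ) (quat n (fun k => S k ξ) w)) _ p :=
    hA.hasFDerivAt.clm_apply (hA.hasFDerivAt.clm_apply (hasFDerivAt_const w p))
  have h2 : (fun ξ => quat n (fun k => S k ξ) (quat n (fun k => S k ξ) w)) =ᶠ[𝓝 p]
      fun _ => -(n 0 ^ 2 + n 1 ^ 2 + n 2 ^ 2) • w := by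
    filter_upwards [h.isQuat] with ξ hξ using hξ.quat_sq n w
  have h3 := congrArg (fun L : E →L[ℝ] E => L v)
    (h1.unique ((hasFDerivAt_const _ p).congr_of_eventuallyEq h2))
  simp only [add_apply, ContinuousLinearMap.comp_apply, ContinuousLinearMap.flip_apply,
    zero_apply, map_zero, zero_add] at h3
  exact eq_neg_of_add_eq_zero_right h3

/-- The mixed Schouten bracket of the `(2,0)`- and the `(0,2)`-bivector is the `∂̄`-derivative of the
`(2,0)`-bivector, contracted with the `(0,2)`-bivector. -/
theorem schouten_mixed {n : Fin 3 → ℝ} (hn : n 0 ^ 2 + n 1 ^ 2 + n 2 ^ 2 = 1) {α β γ : Cov E} {V : E}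
    (hα : ∀ v, α (quat n (fun k => S k p) v) = Complex.I * α v)
    (hβ : ∀ v, β (quat n (fun k => S k p) v) = Complex.I * β v)
    (hγ : ∀ δ : Cov E, field g S (holCoef (-n)) p γ δ =
      (1 / 2 : ℂ) * (δ V + Complex.I * δ (quat n (fun k => S k p) V))) :
    schouten g S p (holCoef n) (holCoef (-n)) γ α β +
      schouten g S p (holCoef (-n)) (holCoef n) γ α β =
      (1 / 2 : ℂ) * dbarTensor g S p n (holCoef n) V α β := by
  have hb := h.isBivector_field (holCoef n)
  have hb' := h.isBivector_field (holCoef (-n))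
  have key : ∀ {δ : Cov E}, (∀ v, δ (quat n (fun k => S k p) v) = Complex.I * δ v) →
      dForm (field g S (holCoef (-n))) p δ γ =
        (-(Complex.I / 2)) • δ.comp ((fderiv ℝ (fun ξ => quat n (fun k => S k ξ)) p).flip V) := by
    intro δ hδ
    ext v
    rw [h.dForm_holCoef_neg hn hδ, hb'.skew, hγ]
    simp only [smul_apply, ContinuousLinearMap.comp_apply, ContinuousLinearMap.flip_apply,
      h.fderiv_quat_anticomm, map_neg, hδ, smul_eq_mul]
    linear_combination (Complex.I / 4) *
      δ (fderiv ℝ (fun ξ => quat n (fun k => S k ξ)) p v V) * Complex.I_sq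
  have h0 : dForm (field g S (holCoef (-n))) p α β = 0 := by
    ext v
    rw [h.dForm_holCoef_neg hn hα, hb'.skew, h.field_holCoef_neg_eq_zero hn hβ]
    simp
  rw [schouten, schouten, h0, key hβ, h.dForm_skew _ γ α, key hα,
    h.field_holCoef_neg_eq_zero hn hα, h.field_holCoef_neg_eq_zero hn hβ, hγ, hb.zero_right, hb.neg_right,
    hb.smul_right, hb.smul_right, hb.skew β, dbarTensor]
  ring

/-- For closed forms, the `(2,0)`-bivector field is holomorphic in the directions of `M`. -/
theorem dbarTensor_eq_zero (hc : ∀ k a b c, extDeriv₂ (fundForm g S k) p a b c = 0)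
    {n : Fin 3 → ℝ} (hn : n 0 ^ 2 + n 1 ^ 2 + n 2 ^ 2 = 1) {α β : Cov E}
    (hα : ∀ v, α (quat n (fun k => S k p) v) = Complex.I * α v)
    (hβ : ∀ v, β (quat n (fun k => S k p) v) = Complex.I * β v) (V : E) :
    dbarTensor g S p n (holCoef n) V α β = 0 := by
  have hp := h.isQuat.self_of_nhds
  by_cases h0 : 1 - n 0 ^ 2 = 0
  · -- at the poles the coefficients vanish
    have h1 : n 1 = 0 := by nlinarith [sq_nonneg (n 1), sq_nonneg (n 2)]
    have h2 : n 2 = 0 := by nlinarith [sq_nonneg (n 1), sq_nonneg (n 2)]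
    have hu : holCoef n = 0 := by
      have h0' : (1 : ℂ) - (n 0 : ℂ) ^ 2 = 0 := by exact_mod_cast h0
      ext k
      fin_cases k <;> simp [holCoef, h1, h2, h0']
    have hf : field g S (holCoef n) = fun _ _ _ => 0 := by
      ext ξ α β
      simp [field, comb, hu]
    simp [dbarTensor, hf, dForm]
  · obtain ⟨τ, hτ⟩ := hp.exists_covector hn h0 V
    have := h.schouten_mixed hn (γ := ofRealCov τ) (V := V) hα hβ
      (fun δ => by rw [← hτ]; exact hp.comb_holCoef_neg_ofReal hn τ δ)
    rw [h.schouten_symm_eq_zero_of_extDeriv hc] at this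
    simpa using this.symm

theorem schouten_mixed_eq_zero
    (hT : ∀ n : Fin 3 → ℝ, n 0 ^ 2 + n 1 ^ 2 + n 2 ^ 2 = 1 → ∀ α β : Cov E,
      (∀ v, α (quat n (fun k => S k p) v) = Complex.I * α v) →
      (∀ v, β (quat n (fun k => S k p) v) = Complex.I * β v) → ∀ V,
      dbarTensor g S p n (holCoef n) V α β = 0)
    {n : Fin 3 → ℝ} (hn : n 0 ^ 2 + n 1 ^ 2 + n 2 ^ 2 = 1) (α β γ : Cov E) :
    schouten g S p (holCoef n) (holCoef (-n)) α β γ +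
      schouten g S p (holCoef (-n)) (holCoef n) α β γ = 0 := by
  have hp := h.isQuat.self_of_nhds
  -- `[P, P̄]` vanishes if two of its three arguments have the same type, and among any three
  -- arguments of pure type there are two such
  have hs : ∀ n : Fin 3 → ℝ, n 0 ^ 2 + n 1 ^ 2 + n 2 ^ 2 = 1 → ∀ α β γ : Cov E,
      (∀ v, β (quat n (fun k => S k p) v) = Complex.I * β v) →
      (∀ v, γ (quat n (fun k => S k p) v) = Complex.I * γ v) →
      schouten g S p (holCoef n) (holCoef (-n)) α β γ +
        schouten g S p (holCoef (-n)) (holCoef n) α β γ = 0 := by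
    intro n hn α β γ hβ hγ
    refine h.schouten_eq_zero_of_first (fun τ => ?_) α
    rw [h.schouten_mixed hn hβ hγ (fun δ => hp.comb_holCoef_neg_ofReal hn τ δ), hT n hn β γ hβ hγ,
      mul_zero]
  have hs' : ∀ α β γ : Cov E,
      (∀ v, β (quat (-n) (fun k => S k p) v) = Complex.I * β v) →
      (∀ v, γ (quat (-n) (fun k => S k p) v) = Complex.I * γ v) →
      schouten g S p (holCoef n) (holCoef (-n)) α β γ +
        schouten g S p (holCoef (-n)) (holCoef n) α β γ = 0 := by
    intro α β γ hβ hγ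
    have := hs (-n) (by simpa using hn) α β γ hβ hγ
    rw [neg_neg] at this
    rw [add_comm, this]
  have hdec : ∀ α : Cov E, ∃ α' α'' : Cov E, α = α' + α'' ∧
      (∀ v, α' (quat n (fun k => S k p) v) = Complex.I * α' v) ∧
      (∀ v, α'' (quat (-n) (fun k => S k p) v) = Complex.I * α'' v) := by
    intro α
    refine ⟨projOneZero (quat n (fun k => S k p)) α, projOneZero (quat (-n) (fun k => S k p)) α,
      ?_, fun v => ?_, fun v => ?_⟩
    · ext v
      simp only [projOneZero, quat_neg, add_apply, smul_apply, sub_apply, smul_eq_mul,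
        ContinuousLinearMap.comp_apply, neg_apply, map_neg]
      ring
    · simp only [projOneZero, smul_apply, sub_apply, ContinuousLinearMap.comp_apply, hp.quat_sq, hn,
        smul_eq_mul, neg_smul, one_smul, map_neg]
      linear_combination (1 / 2 : ℂ) * α (quat n (fun k => S k p) v) * Complex.I_sq
    · simp only [projOneZero, quat_neg, smul_apply, sub_apply, neg_apply,
        ContinuousLinearMap.comp_apply, hp.quat_sq, hn,
        smul_eq_mul, neg_smul, one_smul, map_neg]
      linear_combination (-1 / 2 : ℂ) * α (quat n (fun k => S k p) v) * Complex.I_sq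
  obtain ⟨F, hF⟩ : ∃ F : Cov E → Cov E → Cov E → ℂ, ∀ α β γ, F α β γ =
      schouten g S p (holCoef n) (holCoef (-n)) α β γ +
        schouten g S p (holCoef (-n)) (holCoef n) α β γ := ⟨_, fun _ _ _ => rfl⟩
  simp only [← hF] at hs' ⊢
  have hs := hs n hn
  simp only [← hF] at hs
  have hr : ∀ α β γ, F α β γ = F β γ α := fun α β γ => by
    rw [hF, hF, schouten_rotate, schouten_rotate (holCoef (-n))]
  have ha : ∀ α α' β γ, F (α + α') β γ = F α β γ + F α' β γ := fun α α' β γ => by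
    rw [hF, hF, hF, h.schouten_add_left, h.schouten_add_left]
    ring
  have ha₂ : ∀ α β β' γ, F α (β + β') γ = F α β γ + F α β' γ := fun α β β' γ => by
    rw [hr, ha, ← hr α β γ, ← hr α β' γ]
  have ha₃ : ∀ α β γ γ', F α β (γ + γ') = F α β γ + F α β γ' := fun α β γ γ' => by
    rw [hr, ha₂, ← hr α β γ, ← hr α β γ']
  obtain ⟨α₁, α₂, rfl, hα₁, hα₂⟩ := hdec α
  obtain ⟨β₁, β₂, rfl, hβ₁, hβ₂⟩ := hdec β
  obtain ⟨γ₁, γ₂, rfl, hγ₁, hγ₂⟩ := hdec γ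
  simp only [ha, ha₂, ha₃]
  rw [hs α₁ β₁ γ₁ hβ₁ hγ₁, hs α₂ β₁ γ₁ hβ₁ hγ₁, hs' α₁ β₂ γ₂ hβ₂ hγ₂, hs' α₂ β₂ γ₂ hβ₂ hγ₂,
    hr α₁ β₂ γ₁, hr α₂ β₁ γ₂, hs β₂ γ₁ α₁ hγ₁ hα₁, hs' β₁ γ₂ α₂ hγ₂ hα₂, ← hr γ₁ α₂ β₂,
    ← hr γ₂ α₁ β₁, hs γ₂ α₁ β₁ hα₁ hβ₁, hs' γ₁ α₂ β₂ hα₂ hβ₂]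
  simp

/-- If the `(2,0)`-bivector is holomorphic and Poisson for every `n`, then the three forms are
closed: with its conjugate it spans `ω_I⁻¹, ω_J⁻¹, ω_K⁻¹` as `n` varies. -/
theorem extDeriv_eq_zero
    (hT : ∀ n : Fin 3 → ℝ, n 0 ^ 2 + n 1 ^ 2 + n 2 ^ 2 = 1 → ∀ α β : Cov E,
      (∀ v, α (quat n (fun k => S k p) v) = Complex.I * α v) →
      (∀ v, β (quat n (fun k => S k p) v) = Complex.I * β v) → ∀ V,
      dbarTensor g S p n (holCoef n) V α β = 0)
    (hs : ∀ n : Fin 3 → ℝ, n 0 ^ 2 + n 1 ^ 2 + n 2 ^ 2 = 1 → ∀ α β γ : Cov E,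
      schouten g S p (holCoef n) (holCoef n) α β γ = 0) (k : Fin 3) (a b c : E) :
    extDeriv₂ (fundForm g S k) p a b c = 0 := by
  have main : ∀ n : Fin 3 → ℝ, n 0 ^ 2 + n 1 ^ 2 + n 2 ^ 2 = 1 → ∀ z : ℂ, ∀ α β γ : Cov E,
      z ^ 2 = 1 →
      schouten g S p (holCoef n + z • holCoef (-n)) (holCoef n + z • holCoef (-n)) α β γ = 0 := by
    intro n hn z α β γ hz
    have e1 := h.schouten_mixed_eq_zero hT hn α β γ
    have e2 : schouten g S p (holCoef n) (z • holCoef (-n)) α β γ +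
        schouten g S p (z • holCoef (-n)) (holCoef n) α β γ = 0 := by
      rw [h.schouten_eq_sum (holCoef n) (holCoef (-n)),
        h.schouten_eq_sum (holCoef (-n)) (holCoef n)] at e1
      rw [h.schouten_eq_sum, h.schouten_eq_sum (z • holCoef (-n))]
      simp only [Fin.sum_univ_three, Pi.smul_apply, smul_eq_mul] at e1 ⊢
      linear_combination z * e1
    rw [h.schouten_add_add, e2, h.schouten_smul_smul, hs n hn, hs (-n) (by simpa using hn)]
    simp
  have fin : ∀ {w : ℂ} {d : Fin 3 → ℂ}, w ≠ 0 → d = w • (Pi.single k 1 : Fin 3 → ℂ) →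
      (∀ α β γ, schouten g S p d d α β γ = 0) → extDeriv₂ (fundForm g S k) p a b c = 0 := by
    intro w d hw hd h0
    refine h.extDeriv_eq_zero_of_schouten (fun α β γ => ?_) a b c
    have := h0 α β γ
    rw [hd, h.schouten_smul_smul] at this
    simpa [hw] using this
  -- the coefficients of `P + P̄` are the projection of `e` to the plane orthogonal to `n`, those of
  -- `P - P̄` are `-i n × e`
  fin_cases k
  · refine fin one_ne_zero ?_ (main ![0, 1, 0] (by simp) 1 · · · (by simp))
    ext j
    fin_cases j <;> simp [holCoef]; norm_num
  · refine fin (w := -Complex.I) (by simp) ?_ (main ![0, 0, 1] (by simp) (-1) · · · (by simp))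
    ext j
    fin_cases j <;> simp [holCoef]; ring
  · refine fin (w := Complex.I) (by simp) ?_ (main ![0, 1, 0] (by simp) (-1) · · · (by simp))
    ext j
    fin_cases j <;> simp [holCoef]; ring

end IsQuaternionicAt

end Schouten

/-! ### Passing to a vector space -/

section LocalModel

open Filter Topology

variable {F : Type*} [NormedAddCommGroup F] [NormedSpace ℝ F]
  {H : Type*} [TopologicalSpace H] {𝓜 : ModelWithCorners ℝ F H}
  {N : Type*} [TopologicalSpace N] [ChartedSpace H N]
  {W : Type*} [NormedAddCommGroup W] [NormedSpace ℝ W]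
  {Y : Type*} [NormedAddCommGroup Y] [NormedSpace ℝ Y]

variable (𝓜) in
/-- Near `p`, the manifold `N` is embedded by `ι` in the vector space `W`, with the local smooth
retraction `ρ`. -/
structure IsLocalModel (ι : N → W) (ρ : W → N) (p : N) : Prop where
  smooth : ContMDiffAt 𝓜 𝓘(ℝ, W) ∞ ι p
  smooth_retract : ContMDiffAt 𝓘(ℝ, W) 𝓜 ∞ ρ (ι p)
  retract : ∀ᶠ q in 𝓝 p, ρ (ι q) = q

theorem mvfderiv_eq_of_comp {ι : N → W} {q : N} {f : N → Y} {G : W → Y}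
    (hι : MDifferentiableAt 𝓜 𝓘(ℝ, W) ι q) (hG : DifferentiableAt ℝ G (ι q))
    (hf : f =ᶠ[𝓝 q] G ∘ ι) : mvfderiv 𝓜 f q = (fderiv ℝ G (ι q)).comp (mvfderiv 𝓜 ι q) := by
  ext v
  have h1 : mfderiv 𝓜 𝓘(ℝ, Y) f q = mfderiv 𝓜 𝓘(ℝ, Y) (G ∘ ι) q := hf.mfderiv_eq
  have h2 := mfderiv_comp q hG.mdifferentiableAt hι
  rw [mfderiv_eq_fderiv] at h2
  change mfderiv 𝓜 𝓘(ℝ, Y) f q v = _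
  rw [h1, h2]
  rfl

namespace IsLocalModel

variable {ι : N → W} {ρ : W → N} {p : N} (h : IsLocalModel 𝓜 ι ρ p)
include h

theorem retract_self : ρ (ι p) = p := h.retract.self_of_nhds

theorem contDiffAt {f : N → Y} {n : WithTop ℕ∞} (hn : n ≤ ∞) (hf : ContMDiffAt 𝓜 𝓘(ℝ, Y) n f p) :
    ContDiffAt ℝ n (f ∘ ρ) (ι p) :=
  ContMDiffAt.contDiffAt (ContMDiffAt.comp_of_eq hf (h.smooth_retract.of_le hn) h.retract_self)

omit [NormedAddCommGroup Y] [NormedSpace ℝ Y] in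
theorem eventuallyEq (f : N → Y) : f =ᶠ[𝓝 p] (f ∘ ρ) ∘ ι := by
  filter_upwards [h.retract] with q hq
  simp [hq]

theorem tendsto : Tendsto ι (𝓝 p) (𝓝 (ι p)) := h.smooth.continuousAt

theorem eventually_mdifferentiableAt [IsManifold 𝓜 1 N] : ∀ᶠ q in 𝓝 p, MDifferentiableAt 𝓜 𝓘(ℝ, W) ι q := by
  filter_upwards [(contMDiffAt_iff_contMDiffAt_nhds (n := 1) (by simp)).1
    (h.smooth.of_le (by simp))] with q hq
  exact hq.mdifferentiableAt one_ne_zero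

theorem eventually_mvfderiv [IsManifold 𝓜 1 N] {f : N → Y} {G : W → Y} (hG : ContDiffAt ℝ 1 G (ι p))
    (hf : f =ᶠ[𝓝 p] G ∘ ι) :
    ∀ᶠ q in 𝓝 p, mvfderiv 𝓜 f q = (fderiv ℝ G (ι q)).comp (mvfderiv 𝓜 ι q) := by
  filter_upwards [h.eventually_mdifferentiableAt, h.tendsto.eventually (hG.eventually (by simp)),
    hf.eventually_nhds] with q h1 h2 h3
  exact mvfderiv_eq_of_comp h1 (h2.differentiableAt one_ne_zero) h3

end IsLocalModel

theorem contMDiffAt_mvfderiv_apply [IsManifold 𝓜 ∞ N] {ι : N → W} {p : N}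
    (hι : ContMDiffAt 𝓜 𝓘(ℝ, W) ∞ ι p) {V : ∀ q : N, TangentSpace 𝓜 q}
    (hV : SmoothVectorAt 𝓜 V p) : ContMDiffAt 𝓜 𝓘(ℝ, W) 1 (fun q => mvfderiv 𝓜 ι q (V q)) p := by
  have : IsManifold 𝓜 1 N := IsManifold.of_le (n := ∞) (by simp)
  have h1 : ContMDiffAt 𝓜 𝓘(ℝ, F →L[ℝ] W) 1
      (inTangentCoordinates 𝓜 𝓘(ℝ, W) id ι (mfderiv 𝓜 𝓘(ℝ, W) ι) p) p :=
    ContMDiffAt.mfderiv_const hι (show (1 : WithTop ℕ∞) + 1 ≤ ∞ by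
      rw [one_add_one_eq_two]; exact WithTop.coe_le_coe.2 le_top)
  have h2 := ContMDiffAt.clm_apply_of_inCoordinates h1 (hV.of_le (by simp)) (hι.of_le (by simp))
  exact (contMDiff_snd_tangentBundle_modelSpace W 𝓘(ℝ, W)).contMDiffAt.comp p h2

/-- A vector field, pushed forward by the embedding and extended by means of the retraction. -/
def modelVector (𝓜 : ModelWithCorners ℝ F H) (ι : N → W) (ρ : W → N)
    (V : ∀ q : N, TangentSpace 𝓜 q) (ξ : W) : W := mvfderiv 𝓜 ι (ρ ξ) (V (ρ ξ))

namespace IsLocalModel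

variable {ι : N → W} {ρ : W → N} {p : N} (h : IsLocalModel 𝓜 ι ρ p)
include h

theorem differentiableAt_modelVector [IsManifold 𝓜 ∞ N] {V : ∀ q : N, TangentSpace 𝓜 q}
    (hV : SmoothVectorAt 𝓜 V p) : DifferentiableAt ℝ (modelVector 𝓜 ι ρ V) (ι p) :=
  (h.contDiffAt (by simp) (contMDiffAt_mvfderiv_apply h.smooth hV)).differentiableAt one_ne_zero

theorem eventually_modelVector (V : ∀ q : N, TangentSpace 𝓜 q) :
    ∀ᶠ q in 𝓝 p, modelVector 𝓜 ι ρ V (ι q) = mvfderiv 𝓜 ι q (V q) := by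
  filter_upwards [h.retract] with q hq
  change (fun z => mvfderiv 𝓜 ι z (V z)) (ρ (ι q)) = _
  rw [hq]

end IsLocalModel

variable (𝓜) in
/-- The form `B` on `W` induces the bivector field `P`. -/
def Represents (ι : N → W) (p : N) (P : BivectorField 𝓜 N) (B : W → Form W) : Prop :=
  ∀ᶠ q in 𝓝 p, ∀ α β : Cov W,
    P q (α.comp (mvfderiv 𝓜 ι q)) (β.comp (mvfderiv 𝓜 ι q)) = B (ι q) α β

namespace IsLocalModel

variable [IsManifold 𝓜 ∞ N] {ι : N → W} {ρ : W → N} {p : N} (h : IsLocalModel 𝓜 ι ρ p)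
  {P : BivectorField 𝓜 N} {B : W → Form W} (hP : Represents 𝓜 ι p P B)
include h hP

theorem poissonBracket_self {f g : N → ℂ} {f' g' : W → ℂ} (hf' : DifferentiableAt ℝ f' (ι p))
    (hg' : DifferentiableAt ℝ g' (ι p)) (hf : f =ᶠ[𝓝 p] f' ∘ ι) (hg : g =ᶠ[𝓝 p] g' ∘ ι) :
    poissonBracket 𝓜 P f g p = bracket B f' g' (ι p) := by
  have : IsManifold 𝓜 1 N := IsManifold.of_le (n := ∞) (by simp)
  have h1 := h.eventually_mdifferentiableAt.self_of_nhds
  rw [poissonBracket, mvfderiv_eq_of_comp h1 hf' hf, mvfderiv_eq_of_comp h1 hg' hg,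
    hP.self_of_nhds]
  rfl

theorem poissonBracket_eventuallyEq {f g : N → ℂ} {f' g' : W → ℂ} (hf' : ContDiffAt ℝ 1 f' (ι p))
    (hg' : ContDiffAt ℝ 1 g' (ι p)) (hf : f =ᶠ[𝓝 p] f' ∘ ι) (hg : g =ᶠ[𝓝 p] g' ∘ ι) :
    poissonBracket 𝓜 P f g =ᶠ[𝓝 p] bracket B f' g' ∘ ι := by
  have : IsManifold 𝓜 1 N := IsManifold.of_le (n := ∞) (by simp)
  filter_upwards [h.eventually_mvfderiv hf' hf, h.eventually_mvfderiv hg' hg, hP] with q h1 h2 h3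
  rw [poissonBracket, h1, h2, h3]
  rfl

omit hP in
theorem derivZeroOne_eventuallyEq {J : EndField 𝓜 N} {J' : W → W →L[ℝ] W}
    (hJ : ∀ᶠ q in 𝓝 p, ∀ v, mvfderiv 𝓜 ι q (J q v) = J' (ι q) (mvfderiv 𝓜 ι q v))
    (V : ∀ q : N, TangentSpace 𝓜 q) {f : N → ℂ} {f' : W → ℂ} (hf' : ContDiffAt ℝ 1 f' (ι p))
    (hf : f =ᶠ[𝓝 p] f' ∘ ι) :
    derivZeroOne 𝓜 J V f =ᶠ[𝓝 p] derivAlong (modelVector 𝓜 ι ρ V)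
      (fun ξ => J' ξ (modelVector 𝓜 ι ρ V ξ)) f' ∘ ι := by
  have : IsManifold 𝓜 1 N := IsManifold.of_le (n := ∞) (by simp)
  filter_upwards [h.eventually_mvfderiv hf' hf, hJ, h.eventually_modelVector V] with q h1 h2 h3
  simp only [derivZeroOne, derivAlong, Function.comp_apply, h1, h3, ← h2,
    ContinuousLinearMap.comp_apply]

theorem schoutenSelf_eq (hB : FormDifferentiableAt B (ι p)) (hp : IsBivector (B (ι p)))
    {f g k : N → ℂ} {f' g' k' : W → ℂ} (hf' : ContDiffAt ℝ 2 f' (ι p))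
    (hg' : ContDiffAt ℝ 2 g' (ι p)) (hk' : ContDiffAt ℝ 2 k' (ι p)) (hf : f =ᶠ[𝓝 p] f' ∘ ι)
    (hg : g =ᶠ[𝓝 p] g' ∘ ι) (hk : k =ᶠ[𝓝 p] k' ∘ ι) :
    schoutenSelf 𝓜 P f g k p = 2 *
      (B (ι p) (fderiv ℝ f' (ι p)) (dForm B (ι p) (fderiv ℝ g' (ι p)) (fderiv ℝ k' (ι p))) +
      B (ι p) (fderiv ℝ g' (ι p)) (dForm B (ι p) (fderiv ℝ k' (ι p)) (fderiv ℝ f' (ι p))) +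
      B (ι p) (fderiv ℝ k' (ι p)) (dForm B (ι p) (fderiv ℝ f' (ι p)) (fderiv ℝ g' (ι p)))) := by
  have one : ∀ {u : W → ℂ}, ContDiffAt ℝ 2 u (ι p) → ContDiffAt ℝ 1 u (ι p) :=
    fun hu => hu.of_le one_le_two
  have hd : ∀ {u : W → ℂ}, ContDiffAt ℝ 2 u (ι p) → DifferentiableAt ℝ u (ι p) :=
    fun hu => hu.differentiableAt two_ne_zero
  rw [← jacobiator_eq hB hp hf' hg' hk', schoutenSelf,
    h.poissonBracket_self hP (hd hf') (differentiableAt_bracket hB hg' hk') hf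
      (h.poissonBracket_eventuallyEq hP (one hg') (one hk') hg hk),
    h.poissonBracket_self hP (hd hg') (differentiableAt_bracket hB hk' hf') hg
      (h.poissonBracket_eventuallyEq hP (one hk') (one hf') hk hf),
    h.poissonBracket_self hP (hd hk') (differentiableAt_bracket hB hf' hg') hk
      (h.poissonBracket_eventuallyEq hP (one hf') (one hg') hf hg)]

theorem lieDerivZeroOne_eq (hB : FormDifferentiableAt B (ι p)) (hp : IsBivector (B (ι p)))
    {J : EndField 𝓜 N} {J' : W → W →L[ℝ] W} (hJ' : DifferentiableAt ℝ J' (ι p))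
    (hJ : ∀ᶠ q in 𝓝 p, ∀ v, mvfderiv 𝓜 ι q (J q v) = J' (ι q) (mvfderiv 𝓜 ι q v))
    {V : ∀ q : N, TangentSpace 𝓜 q} (hV : SmoothVectorAt 𝓜 V p)
    {f k : N → ℂ} {f' k' : W → ℂ} (hf' : ContDiffAt ℝ 2 f' (ι p))
    (hk' : ContDiffAt ℝ 2 k' (ι p)) (hf : f =ᶠ[𝓝 p] f' ∘ ι) (hk : k =ᶠ[𝓝 p] k' ∘ ι)
    (hfJ : ∀ w, fderiv ℝ f' (ι p) (J' (ι p) w) = Complex.I * fderiv ℝ f' (ι p) w)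
    (hkJ : ∀ w, fderiv ℝ k' (ι p) (J' (ι p) w) = Complex.I * fderiv ℝ k' (ι p) w) :
    lieDerivZeroOne 𝓜 J P V f k p =
      (1 / 2 : ℂ) * (dForm B (ι p) (fderiv ℝ f' (ι p)) (fderiv ℝ k' (ι p)) (mvfderiv 𝓜 ι p (V p)) +
        Complex.I * dForm B (ι p) (fderiv ℝ f' (ι p)) (fderiv ℝ k' (ι p))
          (J' (ι p) (mvfderiv 𝓜 ι p (V p)))
        - Complex.I * B (ι p) ((fderiv ℝ f' (ι p)).comp
          ((fderiv ℝ J' (ι p)).flip (mvfderiv 𝓜 ι p (V p)))) (fderiv ℝ k' (ι p))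
        - Complex.I * B (ι p) (fderiv ℝ f' (ι p)) ((fderiv ℝ k' (ι p)).comp
          ((fderiv ℝ J' (ι p)).flip (mvfderiv 𝓜 ι p (V p))))) := by
  have one : ∀ {u : W → ℂ}, ContDiffAt ℝ 2 u (ι p) → ContDiffAt ℝ 1 u (ι p) :=
    fun hu => hu.of_le one_le_two
  have hd : ∀ {u : W → ℂ}, ContDiffAt ℝ 2 u (ι p) → DifferentiableAt ℝ u (ι p) :=
    fun hu => hu.differentiableAt two_ne_zero
  have hV' := h.differentiableAt_modelVector hV
  have hU' := hJ'.clm_apply hV'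
  have e := lieDeriv_eq hB hp hJ' hV' hf' hk' hfJ hkJ
  rw [(h.eventually_modelVector V).self_of_nhds] at e
  rw [← e, lieDerivZeroOne, h.poissonBracket_self hP
      (hasFDerivAt_derivAlong hf' hV' hU').differentiableAt (hd hk')
      (h.derivZeroOne_eventuallyEq hJ V (one hf') hf) hk,
    h.poissonBracket_self hP (hd hf')
      (hasFDerivAt_derivAlong hk' hV' hU').differentiableAt hf
      (h.derivZeroOne_eventuallyEq hJ V (one hk') hk)]
  congr 2
  have : IsManifold 𝓜 1 N := IsManifold.of_le (n := ∞) (by simp)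
  have hb := mvfderiv_eq_of_comp h.eventually_mdifferentiableAt.self_of_nhds
    (differentiableAt_bracket hB hf' hk') (h.poissonBracket_eventuallyEq hP (one hf') (one hk') hf hk)
  simp only [derivZeroOne, derivAlong, hb, ContinuousLinearMap.comp_apply, hJ.self_of_nhds,
    (h.eventually_modelVector V).self_of_nhds]

end IsLocalModel

end LocalModel

/-! ### Tensor fields in a chart -/

section Chart

open Filter Topology

set_option synthInstance.maxHeartbeats 200000

variable {E : Type*} [NormedAddCommGroup E] [NormedSpace ℝ E]
  {M : Type*} [TopologicalSpace M] [ChartedSpace E M] [IsManifold 𝓘(ℝ, E) ∞ M]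

theorem isLocalModel_extChartAt {x₀ y : M} (hy : y ∈ (extChartAt 𝓘(ℝ, E) x₀).source) :
    IsLocalModel 𝓘(ℝ, E) (extChartAt 𝓘(ℝ, E) x₀) (extChartAt 𝓘(ℝ, E) x₀).symm y where
  smooth := contMDiffAt_extChartAt' (by rwa [← extChartAt_source 𝓘(ℝ, E)])
  smooth_retract := by
    have := contMDiffOn_extChartAt_symm (I := 𝓘(ℝ, E)) (n := ∞) x₀
    exact this.contMDiffAt ((isOpen_extChartAt_target x₀).mem_nhds
      ((extChartAt 𝓘(ℝ, E) x₀).map_source hy))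
  retract := by
    filter_upwards [extChartAt_source_mem_nhds' (I := 𝓘(ℝ, E)) hy] with q hq
    exact (extChartAt 𝓘(ℝ, E) x₀).left_inv hq

/-- The chart at `x₀` trivializes the tangent spaces at nearby points. -/
theorem exists_chart_equiv {x₀ y : M} (hy : y ∈ (extChartAt 𝓘(ℝ, E) x₀).source) :
    ∃ e : TangentSpace 𝓘(ℝ, E) y ≃L[ℝ] E,
      (∀ v, e v = mvfderiv 𝓘(ℝ, E) (extChartAt 𝓘(ℝ, E) x₀) y v) ∧
      (∀ w, e.symm w = (trivializationAt E (TangentSpace 𝓘(ℝ, E)) x₀).symm y w) ∧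
      ∀ v, e v = (trivializationAt E (TangentSpace 𝓘(ℝ, E)) x₀).continuousLinearMapAt ℝ y v := by
  have : IsManifold 𝓘(ℝ, E) 1 M := IsManifold.of_le (n := ∞) (by simp)
  have hy' : y ∈ (chartAt E x₀).source := by rwa [← extChartAt_source 𝓘(ℝ, E)]
  have hb : y ∈ (trivializationAt E (TangentSpace 𝓘(ℝ, E)) x₀).baseSet := by simpa using hy'
  have h3 : ∀ v, (trivializationAt E (TangentSpace 𝓘(ℝ, E)) x₀).continuousLinearEquivAt ℝ y hb v =
      (trivializationAt E (TangentSpace 𝓘(ℝ, E)) x₀).continuousLinearMapAt ℝ y v := fun v => by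
    rw [Bundle.Trivialization.coe_continuousLinearEquivAt_eq]
  refine ⟨_, fun v => ?_, fun w => rfl, h3⟩
  rw [h3, TangentBundle.continuousLinearMapAt_trivializationAt hy']
  rfl

/-- An endomorphism field in the chart at `x₀`. -/
def chartEnd (x₀ : M) (J : EndField 𝓘(ℝ, E) M) (ξ : E) : E →L[ℝ] E :=
  ContinuousLinearMap.inCoordinates E (TangentSpace 𝓘(ℝ, E)) E (TangentSpace 𝓘(ℝ, E)) x₀
    ((extChartAt 𝓘(ℝ, E) x₀).symm ξ) x₀ ((extChartAt 𝓘(ℝ, E) x₀).symm ξ)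
    (J ((extChartAt 𝓘(ℝ, E) x₀).symm ξ))

/-- A Riemannian metric in the chart at `x₀`. -/
def chartMetric (x₀ : M) (g : RiemannianMetricOn E M) (ξ : E) : E →L[ℝ] E →L[ℝ] ℝ :=
  ContinuousLinearMap.inCoordinates E (TangentSpace 𝓘(ℝ, E)) (E →L[ℝ] ℝ)
    (fun x : M => TangentSpace 𝓘(ℝ, E) x →L[ℝ] ℝ) x₀
    ((extChartAt 𝓘(ℝ, E) x₀).symm ξ) x₀ ((extChartAt 𝓘(ℝ, E) x₀).symm ξ)
    (g.inner ((extChartAt 𝓘(ℝ, E) x₀).symm ξ))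

theorem contDiffAt_chartEnd {x₀ y : M} (hy : y ∈ (extChartAt 𝓘(ℝ, E) x₀).source)
    {J : EndField 𝓘(ℝ, E) M} (hJ : SmoothEndField E M J) :
    ContDiffAt ℝ ∞ (chartEnd x₀ J) (extChartAt 𝓘(ℝ, E) x₀ y) := by
  have hb : y ∈ (trivializationAt (E →L[ℝ] E)
      (fun x : M => TangentSpace 𝓘(ℝ, E) x →L[ℝ] TangentSpace 𝓘(ℝ, E) x) x₀).baseSet := by
    simpa [hom_trivializationAt_baseSet] using hy
  exact (isLocalModel_extChartAt hy).contDiffAt le_rfl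
    ((Bundle.Trivialization.contMDiffAt_section_iff _ hb).1 (hJ y))

theorem contDiffAt_chartMetric {x₀ y : M} (hy : y ∈ (extChartAt 𝓘(ℝ, E) x₀).source)
    (g : RiemannianMetricOn E M) :
    ContDiffAt ℝ ∞ (chartMetric x₀ g) (extChartAt 𝓘(ℝ, E) x₀ y) := by
  have hb : y ∈ (trivializationAt (E →L[ℝ] E →L[ℝ] ℝ)
      (fun x : M => TangentSpace 𝓘(ℝ, E) x →L[ℝ] TangentSpace 𝓘(ℝ, E) x →L[ℝ] ℝ) x₀).baseSet := by
    simpa [hom_trivializationAt_baseSet] using hy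
  exact (isLocalModel_extChartAt hy).contDiffAt le_rfl
    ((Bundle.Trivialization.contMDiffAt_section_iff (trivializationAt (E →L[ℝ] E →L[ℝ] ℝ)
      (fun x : M => TangentSpace 𝓘(ℝ, E) x →L[ℝ] TangentSpace 𝓘(ℝ, E) x →L[ℝ] ℝ) x₀) hb).1
      (g.contMDiff y))

theorem chartEnd_apply (x₀ : M) (J : EndField 𝓘(ℝ, E) M) {y : M}
    (hy : y ∈ (extChartAt 𝓘(ℝ, E) x₀).source) (v : TangentSpace 𝓘(ℝ, E) y) :
    chartEnd x₀ J (extChartAt 𝓘(ℝ, E) x₀ y)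
      (mvfderiv 𝓘(ℝ, E) (extChartAt 𝓘(ℝ, E) x₀) y v) =
      mvfderiv 𝓘(ℝ, E) (extChartAt 𝓘(ℝ, E) x₀) y (J y v) := by
  obtain ⟨e, h1, h2, h3⟩ := exists_chart_equiv hy
  have hx : (extChartAt 𝓘(ℝ, E) x₀).symm (extChartAt 𝓘(ℝ, E) x₀ y) = y :=
    (extChartAt 𝓘(ℝ, E) x₀).left_inv hy
  have hy' : y ∈ (chartAt E x₀).source := by rwa [← extChartAt_source 𝓘(ℝ, E)]
  have hb : y ∈ (trivializationAt E (TangentSpace 𝓘(ℝ, E)) x₀).baseSet := by simpa using hy'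
  rw [chartEnd, hx, ← h1, ← h1, ContinuousLinearMap.inCoordinates]
  rw [ContinuousLinearMap.comp_apply, ContinuousLinearMap.comp_apply,
    Bundle.Trivialization.symmL_apply _ hb, ← h2, e.symm_apply_apply, h3]

theorem chartMetric_apply (x₀ : M) (g : RiemannianMetricOn E M) {y : M}
    (hy : y ∈ (extChartAt 𝓘(ℝ, E) x₀).source) (v w : TangentSpace 𝓘(ℝ, E) y) :
    chartMetric x₀ g (extChartAt 𝓘(ℝ, E) x₀ y)
      (mvfderiv 𝓘(ℝ, E) (extChartAt 𝓘(ℝ, E) x₀) y v)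
      (mvfderiv 𝓘(ℝ, E) (extChartAt 𝓘(ℝ, E) x₀) y w) = g.inner y v w := by
  obtain ⟨e, h1, h2, h3⟩ := exists_chart_equiv hy
  have hx : (extChartAt 𝓘(ℝ, E) x₀).symm (extChartAt 𝓘(ℝ, E) x₀ y) = y :=
    (extChartAt 𝓘(ℝ, E) x₀).left_inv hy
  have hy' : y ∈ (chartAt E x₀).source := by rwa [← extChartAt_source 𝓘(ℝ, E)]
  have hb : y ∈ (trivializationAt E (TangentSpace 𝓘(ℝ, E)) x₀).baseSet := by simpa using hy'
  rw [chartMetric, hx, ← h1, ← h1]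
  refine (inCoordinates_apply_eq₂ (E₃ := Bundle.Trivial M ℝ) hb hb (Set.mem_univ _)).trans ?_
  rw [← h2, ← h2, e.symm_apply_apply, e.symm_apply_apply]
  simp

omit [IsManifold 𝓘(ℝ, E) ∞ M] in
/-- Properties of the points near `x₀` are properties near the image of `x₀` in the chart. -/
theorem eventually_chart {x₀ : M} {q : E → Prop}
    (hq : ∀ᶠ y in 𝓝 x₀, y ∈ (extChartAt 𝓘(ℝ, E) x₀).source → q (extChartAt 𝓘(ℝ, E) x₀ y)) :
    ∀ᶠ ξ in 𝓝 (extChartAt 𝓘(ℝ, E) x₀ x₀), q ξ := by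
  have h1 : Tendsto (extChartAt 𝓘(ℝ, E) x₀).symm (𝓝 (extChartAt 𝓘(ℝ, E) x₀ x₀)) (𝓝 x₀) := by
    have := continuousAt_extChartAt_symm (I := 𝓘(ℝ, E)) x₀
    rwa [ContinuousAt, extChartAt_to_inv] at this
  filter_upwards [h1.eventually hq, extChartAt_target_mem_nhds (I := 𝓘(ℝ, E)) x₀] with ξ h2 h3
  have := h2 ((extChartAt 𝓘(ℝ, E) x₀).map_target h3)
  rwa [(extChartAt 𝓘(ℝ, E) x₀).right_inv h3] at this

theorem mvfderiv_extChartAt_mlieBracket (x₀ : M) (X Y : ∀ y : M, TangentSpace 𝓘(ℝ, E) y) :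
    mvfderiv 𝓘(ℝ, E) (extChartAt 𝓘(ℝ, E) x₀) x₀ (VectorField.mlieBracket 𝓘(ℝ, E) X Y x₀) =
      VectorField.lieBracket ℝ
        (modelVector 𝓘(ℝ, E) (extChartAt 𝓘(ℝ, E) x₀) (extChartAt 𝓘(ℝ, E) x₀).symm X)
        (modelVector 𝓘(ℝ, E) (extChartAt 𝓘(ℝ, E) x₀) (extChartAt 𝓘(ℝ, E) x₀).symm Y)
        (extChartAt 𝓘(ℝ, E) x₀ x₀) := by
  have : IsManifold 𝓘(ℝ, E) 1 M := IsManifold.of_le (n := ∞) (by simp)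
  have hev : ∀ X : ∀ y : M, TangentSpace 𝓘(ℝ, E) y,
      VectorField.mpullbackWithin 𝓘(ℝ, E) 𝓘(ℝ, E) (extChartAt 𝓘(ℝ, E) x₀).symm X
        (Set.range 𝓘(ℝ, E)) =ᶠ[𝓝 (extChartAt 𝓘(ℝ, E) x₀ x₀)]
      modelVector 𝓘(ℝ, E) (extChartAt 𝓘(ℝ, E) x₀) (extChartAt 𝓘(ℝ, E) x₀).symm X := by
    intro X
    filter_upwards [extChartAt_target_mem_nhds (I := 𝓘(ℝ, E)) x₀] with ξ hξ
    refine (isInvertible_mfderivWithin_extChartAt_symm hξ).inverse_apply_eq.2 ?_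
    have := congrArg (fun L => L (X ((extChartAt 𝓘(ℝ, E) x₀).symm ξ)))
      (mfderivWithin_extChartAt_symm_comp_mfderiv_extChartAt hξ)
    exact this.symm
  rw [← VectorField.mlieBracketWithin_univ, VectorField.mlieBracketWithin_apply]
  have hi := isInvertible_mfderiv_extChartAt (I := 𝓘(ℝ, E)) (mem_extChartAt_source (I := 𝓘(ℝ, E)) x₀)
  refine (hi.self_apply_inverse _).trans ?_
  have hs : (extChartAt 𝓘(ℝ, E) x₀).symm ⁻¹' Set.univ ∩ Set.range 𝓘(ℝ, E) = Set.univ := by simp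
  rw [hs]
  have hW : ∀ A B A' B' : E → E, A =ᶠ[𝓝 (extChartAt 𝓘(ℝ, E) x₀ x₀)] A' →
      B =ᶠ[𝓝 (extChartAt 𝓘(ℝ, E) x₀ x₀)] B' →
      VectorField.lieBracketWithin ℝ A B Set.univ (extChartAt 𝓘(ℝ, E) x₀ x₀) =
        VectorField.lieBracket ℝ A' B' (extChartAt 𝓘(ℝ, E) x₀ x₀) := by
    intro A B A' B' hA hB
    rw [VectorField.lieBracketWithin_univ]
    exact hA.lieBracket_vectorField_eq hB
  exact hW _ _ _ _ (hev X) (hev Y)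

/-- The invariant formula computes the exterior derivative in the chart. -/
theorem closed_formula_eq_extDeriv (x₀ : M)
    {σ : ∀ x : M, TangentSpace 𝓘(ℝ, E) x →L[ℝ] TangentSpace 𝓘(ℝ, E) x →L[ℝ] ℝ}
    {σ' : E → E →L[ℝ] E →L[ℝ] ℝ} (hd : DifferentiableAt ℝ σ' (extChartAt 𝓘(ℝ, E) x₀ x₀))
    (hs : ∀ᶠ ξ in 𝓝 (extChartAt 𝓘(ℝ, E) x₀ x₀), ∀ v w, σ' ξ v w = -σ' ξ w v)
    (hσ : ∀ᶠ y in 𝓝 x₀, ∀ v w, σ y v w = σ' (extChartAt 𝓘(ℝ, E) x₀ y)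
      (mvfderiv 𝓘(ℝ, E) (extChartAt 𝓘(ℝ, E) x₀) y v)
      (mvfderiv 𝓘(ℝ, E) (extChartAt 𝓘(ℝ, E) x₀) y w))
    {X Y Z : ∀ y : M, TangentSpace 𝓘(ℝ, E) y} (hX : SmoothVectorAt 𝓘(ℝ, E) X x₀)
    (hY : SmoothVectorAt 𝓘(ℝ, E) Y x₀) (hZ : SmoothVectorAt 𝓘(ℝ, E) Z x₀) :
    mvfderiv 𝓘(ℝ, E) (fun y => σ y (Y y) (Z y)) x₀ (X x₀)
      - mvfderiv 𝓘(ℝ, E) (fun y => σ y (X y) (Z y)) x₀ (Y x₀)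
      + mvfderiv 𝓘(ℝ, E) (fun y => σ y (X y) (Y y)) x₀ (Z x₀)
      - σ x₀ (VectorField.mlieBracket 𝓘(ℝ, E) X Y x₀) (Z x₀)
      + σ x₀ (VectorField.mlieBracket 𝓘(ℝ, E) X Z x₀) (Y x₀)
      - σ x₀ (VectorField.mlieBracket 𝓘(ℝ, E) Y Z x₀) (X x₀) =
    extDeriv₂ σ' (extChartAt 𝓘(ℝ, E) x₀ x₀)
      (mvfderiv 𝓘(ℝ, E) (extChartAt 𝓘(ℝ, E) x₀) x₀ (X x₀))
      (mvfderiv 𝓘(ℝ, E) (extChartAt 𝓘(ℝ, E) x₀) x₀ (Y x₀))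
      (mvfderiv 𝓘(ℝ, E) (extChartAt 𝓘(ℝ, E) x₀) x₀ (Z x₀)) := by
  have : IsManifold 𝓘(ℝ, E) 1 M := IsManifold.of_le (n := ∞) (by simp)
  have hm := isLocalModel_extChartAt (E := E) (mem_extChartAt_source x₀)
  set φ := extChartAt 𝓘(ℝ, E) x₀
  have key : ∀ {X Y Z : ∀ y : M, TangentSpace 𝓘(ℝ, E) y}, SmoothVectorAt 𝓘(ℝ, E) Y x₀ →
      SmoothVectorAt 𝓘(ℝ, E) Z x₀ →
      mvfderiv 𝓘(ℝ, E) (fun y => σ y (Y y) (Z y)) x₀ (X x₀) =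
      fderiv ℝ σ' (φ x₀) (mvfderiv 𝓘(ℝ, E) φ x₀ (X x₀)) (mvfderiv 𝓘(ℝ, E) φ x₀ (Y x₀))
        (mvfderiv 𝓘(ℝ, E) φ x₀ (Z x₀)) +
      σ' (φ x₀) (fderiv ℝ (modelVector 𝓘(ℝ, E) φ φ.symm Y) (φ x₀)
        (mvfderiv 𝓘(ℝ, E) φ x₀ (X x₀))) (mvfderiv 𝓘(ℝ, E) φ x₀ (Z x₀)) +
      σ' (φ x₀) (mvfderiv 𝓘(ℝ, E) φ x₀ (Y x₀)) (fderiv ℝ (modelVector 𝓘(ℝ, E) φ φ.symm Z) (φ x₀)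
        (mvfderiv 𝓘(ℝ, E) φ x₀ (X x₀))) := by
    intro X Y Z hY hZ
    have hY' := hm.differentiableAt_modelVector hY
    have hZ' := hm.differentiableAt_modelVector hZ
    have h1 := (hd.hasFDerivAt.clm_apply hY'.hasFDerivAt).clm_apply hZ'.hasFDerivAt
    have h2 := mvfderiv_eq_of_comp (f := fun y => σ y (Y y) (Z y))
      hm.eventually_mdifferentiableAt.self_of_nhds h1.differentiableAt (by
        filter_upwards [hσ, hm.eventually_modelVector Y, hm.eventually_modelVector Z] with y e1 e2 e3
        simp only [Function.comp_apply, e1, e2, e3])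
    rw [h2, h1.fderiv]
    simp only [ContinuousLinearMap.comp_apply, add_apply, ContinuousLinearMap.flip_apply,
      (hm.eventually_modelVector Y).self_of_nhds, (hm.eventually_modelVector Z).self_of_nhds]
    ring
  have hs' := hs.self_of_nhds
  have hds : ∀ u v w, fderiv ℝ σ' (φ x₀) u v w = -fderiv ℝ σ' (φ x₀) u w v := by
    intro u v w
    have e1 := (hd.hasFDerivAt.clm_apply (hasFDerivAt_const v _)).clm_apply
      (hasFDerivAt_const w _)
    have e2 := ((hd.hasFDerivAt.clm_apply (hasFDerivAt_const w _)).clm_apply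
      (hasFDerivAt_const v _)).neg
    have e3 := e1.unique (e2.congr_of_eventuallyEq (by
      filter_upwards [hs] with ξ hξ
      exact hξ v w))
    simpa using congrArg (fun L : E →L[ℝ] ℝ => L u) e3
  have hv := fun X : ∀ y : M, TangentSpace 𝓘(ℝ, E) y => (hm.eventually_modelVector X).self_of_nhds
  have hbr : ∀ X Y : ∀ y : M, TangentSpace 𝓘(ℝ, E) y, mvfderiv 𝓘(ℝ, E) φ x₀
      (VectorField.mlieBracket 𝓘(ℝ, E) X Y x₀) = VectorField.lieBracket ℝ
        (modelVector 𝓘(ℝ, E) φ φ.symm X) (modelVector 𝓘(ℝ, E) φ φ.symm Y) (φ x₀) :=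
    mvfderiv_extChartAt_mlieBracket x₀
  rw [key hY hZ, key hX hZ, key hX hY, hσ.self_of_nhds, hσ.self_of_nhds, hσ.self_of_nhds,
    hbr, hbr, hbr]
  simp only [VectorField.lieBracket, map_sub, sub_apply, hv, extDeriv₂]
  rw [hds (mvfderiv 𝓘(ℝ, E) φ x₀ (Y x₀)),
    hs' (mvfderiv 𝓘(ℝ, E) φ x₀ (X x₀)), hs' (mvfderiv 𝓘(ℝ, E) φ x₀ (X x₀)),
    hs' (mvfderiv 𝓘(ℝ, E) φ x₀ (Y x₀)) ]
  ring

end Chart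

/-! ### The hypercomplex structure in a chart -/

section HypercomplexChart

open Filter Topology

set_option synthInstance.maxHeartbeats 200000

variable {E : Type*} [NormedAddCommGroup E] [NormedSpace ℝ E]
  {M : Type*} [TopologicalSpace M] [ChartedSpace E M] [IsManifold 𝓘(ℝ, E) ∞ M]
  (Q : HypercomplexStructure E M) (g : RiemannianMetricOn E M)

/-- The three complex structures. -/
def structures : Fin 3 → EndField 𝓘(ℝ, E) M := ![Q.I, Q.J, Q.K]

/-- The three complex structures in the chart at `x₀`. -/
def chartStructures (x₀ : M) (k : Fin 3) : E → E →L[ℝ] E := chartEnd x₀ (structures Q k)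

theorem smooth_structures (k : Fin 3) : SmoothEndField E M (structures Q k) := by
  fin_cases k
  exacts [Q.complex_I.smooth, Q.complex_J.smooth, Q.complex_K.smooth]

theorem structures_sq (k : Fin 3) (y : M) (v : TangentSpace 𝓘(ℝ, E) y) :
    structures Q k y (structures Q k y v) = -v := by
  fin_cases k
  exacts [Q.complex_I.sq y v, Q.complex_J.sq y v, Q.complex_K.sq y v]

variable {Q g}

theorem structures_herm (h : Q.IsHyperhermitian g) (k : Fin 3) (y : M)
    (v w : TangentSpace 𝓘(ℝ, E) y) :
    g.inner y (structures Q k y v) (structures Q k y w) = g.inner y v w := by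
  fin_cases k
  exacts [h.1 y v w, h.2.1 y v w, h.2.2 y v w]

theorem isQuaternionic_chart (h : Q.IsHyperhermitian g) {x₀ y : M}
    (hy : y ∈ (extChartAt 𝓘(ℝ, E) x₀).source) :
    IsQuaternionic (chartMetric x₀ g (extChartAt 𝓘(ℝ, E) x₀ y))
      (fun k => chartStructures Q x₀ k (extChartAt 𝓘(ℝ, E) x₀ y)) := by
  obtain ⟨e, he, -⟩ := exists_chart_equiv hy
  have hg : ∀ v w, chartMetric x₀ g (extChartAt 𝓘(ℝ, E) x₀ y) (e v) (e w) = g.inner y v w :=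
    fun v w => by rw [he, he, chartMetric_apply x₀ g hy]
  have hS : ∀ k v, chartStructures Q x₀ k (extChartAt 𝓘(ℝ, E) x₀ y) (e v) =
      e (structures Q k y v) := fun k v => by
    rw [he, he, chartStructures, chartEnd_apply x₀ _ hy]
  have hsurj : ∀ v : E, ∃ v', e v' = v := e.surjective
  refine ⟨fun v w => ?_, fun v hv => ?_, fun k v w => ?_, fun k v => ?_, fun v => ?_, fun v => ?_⟩
  · obtain ⟨v, rfl⟩ := hsurj v
    obtain ⟨w, rfl⟩ := hsurj w
    rw [hg, hg, g.symm]
  · obtain ⟨v, rfl⟩ := hsurj v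
    rw [hg]
    exact g.pos y v fun h0 => hv (by rw [h0, map_zero])
  · obtain ⟨v, rfl⟩ := hsurj v
    obtain ⟨w, rfl⟩ := hsurj w
    rw [hS, hS, hg, hg, structures_herm h]
  · obtain ⟨v, rfl⟩ := hsurj v
    rw [hS, hS, structures_sq, map_neg]
  · obtain ⟨v, rfl⟩ := hsurj v
    rw [hS, hS, hS]
    exact congrArg e (Q.I_J y v)
  · obtain ⟨v, rfl⟩ := hsurj v
    rw [hS, hS, hS, ← map_neg]
    exact congrArg e (Q.J_I y v)

theorem isQuaternionicAt_chart (h : Q.IsHyperhermitian g) (x₀ : M) :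
    IsQuaternionicAt (chartMetric x₀ g) (chartStructures Q x₀) (extChartAt 𝓘(ℝ, E) x₀ x₀) where
  isQuat := eventually_chart (Eventually.of_forall fun _ hy => isQuaternionic_chart h hy)
  diff_g := (contDiffAt_chartMetric (mem_extChartAt_source x₀) g).differentiableAt (by simp)
  diff_S k := (contDiffAt_chartEnd (mem_extChartAt_source x₀)
    (smooth_structures Q k)).differentiableAt (by simp)

theorem isClosedTwoForm_iff (h : Q.IsHyperhermitian g) (k : Fin 3) :
    IsClosedTwoForm (fundamentalForm g (structures Q k)) ↔
      ∀ x₀ a b c, extDeriv₂ (fundForm (chartMetric x₀ g) (chartStructures Q x₀) k)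
        (extChartAt 𝓘(ℝ, E) x₀ x₀) a b c = 0 := by
  have key : ∀ (x₀ : M) (X Y Z : ∀ y : M, TangentSpace 𝓘(ℝ, E) y),
    SmoothVectorAt 𝓘(ℝ, E) X x₀ → SmoothVectorAt 𝓘(ℝ, E) Y x₀ → SmoothVectorAt 𝓘(ℝ, E) Z x₀ → _ :=
    fun x₀ X Y Z hX hY hZ =>
    closed_formula_eq_extDeriv x₀ (σ := fundamentalForm g (structures Q k))
      ((isQuaternionicAt_chart h x₀).differentiableAt_fundForm k)
      (by
        filter_upwards [(isQuaternionicAt_chart h x₀).isQuat] with ξ hξ v w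
        exact (hξ.skew k v w).trans (by rw [hξ.symm]; rfl))
      (by
        filter_upwards [extChartAt_source_mem_nhds (I := 𝓘(ℝ, E)) x₀] with y hy v w
        change g.inner y (structures Q k y v) w = chartMetric x₀ g _ (chartEnd x₀ _ _ _) _
        rw [chartEnd_apply x₀ _ hy, chartMetric_apply x₀ g hy]) hX hY hZ
  constructor
  · intro hc x₀ a b c
    obtain ⟨e, he, -⟩ := exists_chart_equiv (mem_extChartAt_source (I := 𝓘(ℝ, E)) x₀)
    have hsurj : ∀ v : E, ∃ V : ∀ y : M, TangentSpace 𝓘(ℝ, E) y, SmoothVectorAt 𝓘(ℝ, E) V x₀ ∧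
        mvfderiv 𝓘(ℝ, E) (extChartAt 𝓘(ℝ, E) x₀) x₀ (V x₀) = v := by
      intro v
      refine ⟨FiberBundle.extend E (e.symm v), FiberBundle.contMDiffAt_extend .., ?_⟩
      rw [FiberBundle.extend_apply_self, ← he, e.apply_symm_apply]
    obtain ⟨X, hX, rfl⟩ := hsurj a
    obtain ⟨Y, hY, rfl⟩ := hsurj b
    obtain ⟨Z, hZ, rfl⟩ := hsurj c
    rw [← key x₀ X Y Z hX hY hZ]
    exact hc x₀ X Y Z hX hY hZ
  · intro hc x₀ X Y Z hX hY hZ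
    exact (key x₀ X Y Z hX hY hZ).trans (hc _ _ _ _)

theorem isHyperkahler_iff (h : Q.IsHyperhermitian g) : Q.IsHyperkahler g ↔
    ∀ k x₀ a b c, extDeriv₂ (fundForm (chartMetric x₀ g) (chartStructures Q x₀) k)
        (extChartAt 𝓘(ℝ, E) x₀ x₀) a b c = 0 := by
  rw [HypercomplexStructure.IsHyperkahler, and_iff_right h]
  refine ⟨fun ⟨h0, h1, h2⟩ k => ?_, fun hk => ⟨?_, ?_, ?_⟩⟩
  · fin_cases k
    exacts [(isClosedTwoForm_iff h 0).1 h0, (isClosedTwoForm_iff h 1).1 h1,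
      (isClosedTwoForm_iff h 2).1 h2]
  exacts [(isClosedTwoForm_iff h 0).2 (hk 0), (isClosedTwoForm_iff h 1).2 (hk 1),
    (isClosedTwoForm_iff h 2).2 (hk 2)]

end HypercomplexChart

/-! ### The sphere and the twistor space in a vector space -/

section Sphere

open Filter Topology

/-- The space `ℝ³` containing the sphere of complex structures. -/
abbrev R3 : Type := EuclideanSpace ℝ (Fin 3)

theorem S2.sq_sum (a : S2) : (a : R3) 0 ^ 2 + (a : R3) 1 ^ 2 + (a : R3) 2 ^ 2 = 1 := by
  have h : ‖(a : R3)‖ = 1 := by simp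
  have h2 := EuclideanSpace.real_norm_sq_eq (a : R3)
  rw [h, Fin.sum_univ_three] at h2
  linarith

/-- The radial projection `ℝ³ → S²` (with an irrelevant value at the origin). -/
def radial (m : R3) : S2 :=
  if h : m = 0 then S2.poleI else ⟨‖m‖⁻¹ • m, by simp [norm_smul, h]⟩

theorem radial_of_ne {m : R3} (h : m ≠ 0) : (radial m : R3) = ‖m‖⁻¹ • m := by
  rw [radial, dif_neg h]

theorem S2.ne_zero (a : S2) : (a : R3) ≠ 0 := by
  intro h
  have : ‖(a : R3)‖ = 1 := by simp
  rw [h] at this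
  simp at this

theorem radial_smul (a : S2) {t : ℝ} (ht : 0 < t) : radial (t • (a : R3)) = a := by
  have h : ‖(a : R3)‖ = 1 := by simp
  ext1
  rw [radial_of_ne (smul_ne_zero ht.ne' (S2.ne_zero a)), norm_smul, h, Real.norm_eq_abs,
    abs_of_pos ht, mul_one, smul_smul, inv_mul_cancel₀ ht.ne', one_smul]

theorem radial_coe (a : S2) : radial (a : R3) = a := by
  have := radial_smul a one_pos
  rwa [one_smul] at this

theorem contMDiffAt_radial (a : S2) : ContMDiffAt 𝓘(ℝ, R3) (𝓡 2) ∞ radial (a : R3) := by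
  have hne : ∀ᶠ m in 𝓝 (a : R3), m ≠ 0 := (continuousAt_id.eventually_ne (S2.ne_zero a))
  have hd : ContDiffAt ℝ ∞ (fun m : R3 => ‖m‖⁻¹ • m) (a : R3) :=
    ((contDiffAt_norm ℝ (S2.ne_zero a)).inv (by simp)).smul contDiffAt_id
  have heq : (fun m => (radial m : R3)) =ᶠ[𝓝 (a : R3)] fun m => ‖m‖⁻¹ • m := by
    filter_upwards [hne] with m hm using radial_of_ne hm
  rw [contMDiffAt_iff_target]
  constructor
  · exact Topology.IsInducing.subtypeVal.continuousAt_iff.2 (hd.continuousAt.congr heq.symm)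
  · have : Fact (Module.finrank ℝ R3 = 2 + 1) := ⟨by simp⟩
    rw [radial_coe]
    let U := (OrthonormalBasis.fromOrthogonalSpanSingleton (𝕜 := ℝ) 2
      (ne_zero_of_mem_unit_sphere (-a))).repr
    have h1 : ContDiffAt ℝ ∞ (fun m : R3 => U (stereoToFun (-a : R3) (‖m‖⁻¹ • m))) (a : R3) := by
      have h2 : ContDiffAt ℝ ∞ (stereoToFun (-a : R3)) (‖(a : R3)‖⁻¹ • (a : R3)) := by
        refine contDiffOn_stereoToFun.contDiffAt ((IsOpen.mem_nhds ?_ ?_))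
        · exact isOpen_ne_fun (innerSL ℝ (-a : R3)).continuous continuous_const
        · have : ‖(a : R3)‖ = 1 := by simp
          simp [this]
          norm_num
      exact U.contDiff.contDiffAt.comp _
        (ContDiffAt.comp (f := fun m : R3 => ‖m‖⁻¹ • m) (a : R3) h2 hd)
    refine (h1.contMDiffAt).congr_of_eventuallyEq ?_
    filter_upwards [heq] with m hm
    rw [← hm]
    rfl

/-- The cross product of `ℝ³` as a bounded bilinear map. -/
def crossL : R3 →L[ℝ] R3 →L[ℝ] R3 :=
  LinearMap.toContinuousLinearMap
    ((LinearMap.toContinuousLinearMap (𝕜 := ℝ) (E := R3) (F' := R3)).toLinearMap ∘ₗ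
      LinearMap.mk₂ ℝ (fun m v : R3 => WithLp.toLp 2 (crossProduct m.ofLp v.ofLp))
        (by intros; simp) (by intros; simp) (by intros; simp) (by intros; simp))

theorem crossL_apply (m v : R3) : (crossL m v).ofLp = crossProduct m.ofLp v.ofLp := rfl

theorem dIncl_orthogonal (a : S2) (v : TangentSpace (𝓡 2) a) :
    (a : R3) 0 * S2.dIncl a v 0 + (a : R3) 1 * S2.dIncl a v 1 + (a : R3) 2 * S2.dIncl a v 2 = 0 := by
  have : Fact (Module.finrank ℝ R3 = 2 + 1) := ⟨by simp⟩
  have h : S2.dIncl a v ∈ (S2.dIncl a).range := ⟨v, rfl⟩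
  rw [show (S2.dIncl a).range = (ℝ ∙ (a : R3))ᗮ from range_mvfderiv_subtypeVal (n := 2) a,
    Submodule.mem_orthogonal_singleton_iff_inner_right, EuclideanSpace.inner_eq_star_dotProduct,
    dotProduct_comm] at h
  simpa [dotProduct, Fin.sum_univ_three] using h

theorem exists_dIncl (a : S2) (w : R3) : ∃ (v : TangentSpace (𝓡 2) a) (t : ℝ),
    w = S2.dIncl a v + t • (a : R3) := by
  have : Fact (Module.finrank ℝ R3 = 2 + 1) := ⟨by simp⟩
  have hmem : w - (inner ℝ (a : R3) w) • (a : R3) ∈ (S2.dIncl a).range := by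
    rw [show (S2.dIncl a).range = (ℝ ∙ (a : R3))ᗮ from range_mvfderiv_subtypeVal (n := 2) a,
      Submodule.mem_orthogonal_singleton_iff_inner_right]
    simp [inner_sub_right, inner_smul_right]
  obtain ⟨v, hv⟩ := hmem
  exact ⟨v, inner ℝ (a : R3) w, by
    rw [show S2.dIncl a v = _ from hv]
    abel⟩

end Sphere

section TwistorModel

open Filter Topology

set_option synthInstance.maxHeartbeats 200000

variable {E : Type*} [NormedAddCommGroup E] [NormedSpace ℝ E]
  {M : Type*} [TopologicalSpace M] [ChartedSpace E M] [IsManifold 𝓘(ℝ, E) ∞ M]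

/-- The embedding of `Z = M × S²` near the fibre over `x₀` into `E × ℝ³`. -/
def twistorEmb (x₀ : M) (z : M × S2) : E × R3 := (extChartAt 𝓘(ℝ, E) x₀ z.1, (z.2 : R3))

/-- The retraction of `E × ℝ³` to `Z = M × S²` near the fibre over `x₀`. -/
def twistorRetract (x₀ : M) (w : E × R3) : M × S2 :=
  ((extChartAt 𝓘(ℝ, E) x₀).symm w.1, radial w.2)

theorem contMDiffAt_twistorEmb (x₀ : M) {z : M × S2}
    (hz : z.1 ∈ (extChartAt 𝓘(ℝ, E) x₀).source) :
    ContMDiffAt (twistorModel E) 𝓘(ℝ, E × R3) ∞ (twistorEmb (E := E) x₀) z := by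
  have h1 : ContMDiffAt (twistorModel E) 𝓘(ℝ, E) ∞
      (fun z : M × S2 => extChartAt 𝓘(ℝ, E) x₀ z.1) z :=
    (contMDiffAt_extChartAt' (by rwa [← extChartAt_source 𝓘(ℝ, E)])).comp z contMDiffAt_fst
  have h2 : ContMDiffAt (twistorModel E) 𝓘(ℝ, R3) ∞ (fun z : M × S2 => (z.2 : R3)) z := by
    have : Fact (Module.finrank ℝ R3 = 2 + 1) := ⟨by simp⟩
    exact (contMDiff_coe_sphere.contMDiffAt).comp z contMDiffAt_snd
  exact h1.prodMk_space h2

theorem isLocalModel_twistor (x₀ : M) (a₀ : S2) :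
    IsLocalModel (twistorModel E) (twistorEmb (E := E) x₀) (twistorRetract (E := E) x₀) (x₀, a₀) where
  smooth := contMDiffAt_twistorEmb x₀ (mem_extChartAt_source x₀)
  smooth_retract := by
    have h1 : ContMDiffAt 𝓘(ℝ, E × R3) 𝓘(ℝ, E) ∞
        (fun w : E × R3 => (extChartAt 𝓘(ℝ, E) x₀).symm w.1) (twistorEmb (E := E) x₀ (x₀, a₀)) :=
      ContMDiffAt.comp (twistorEmb (E := E) x₀ (x₀, a₀))
        (isLocalModel_extChartAt (E := E) (mem_extChartAt_source x₀)).smooth_retract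
        contDiff_fst.contMDiff.contMDiffAt
    have h2 : ContMDiffAt 𝓘(ℝ, E × R3) (𝓡 2) ∞
        (fun w : E × R3 => radial w.2) (twistorEmb (E := E) x₀ (x₀, a₀)) :=
      ContMDiffAt.comp (twistorEmb (E := E) x₀ (x₀, a₀)) (contMDiffAt_radial a₀)
        contDiff_snd.contMDiff.contMDiffAt
    exact h1.prodMk h2
  retract := by
    have : ∀ᶠ z : M × S2 in 𝓝 (x₀, a₀), z.1 ∈ (extChartAt 𝓘(ℝ, E) x₀).source :=
      continuousAt_fst.eventually (extChartAt_source_mem_nhds (I := 𝓘(ℝ, E)) x₀)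
    filter_upwards [this] with z hz
    simp only [twistorRetract, twistorEmb, radial_coe, (extChartAt 𝓘(ℝ, E) x₀).left_inv hz]

theorem mvfderiv_twistorEmb (x₀ : M) {z : M × S2} (hz : z.1 ∈ (extChartAt 𝓘(ℝ, E) x₀).source)
    (v : TangentSpace (twistorModel E) z) :
    mvfderiv (twistorModel E) (twistorEmb (E := E) x₀) z v =
      (mvfderiv 𝓘(ℝ, E) (extChartAt 𝓘(ℝ, E) x₀) z.1 v.1, S2.dIncl z.2 v.2) := by
  have : Fact (Module.finrank ℝ R3 = 2 + 1) := ⟨by simp⟩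
  have : IsManifold 𝓘(ℝ, E) 1 M := IsManifold.of_le (n := ∞) (by simp)
  have hι : MDifferentiableAt (twistorModel E) 𝓘(ℝ, E × R3) (twistorEmb (E := E) x₀) z :=
    (contMDiffAt_twistorEmb x₀ hz).mdifferentiableAt (by simp)
  have hφ : MDifferentiableAt 𝓘(ℝ, E) 𝓘(ℝ, E) (extChartAt 𝓘(ℝ, E) x₀) z.1 :=
    (contMDiffAt_extChartAt' (n := 1) (by rwa [← extChartAt_source 𝓘(ℝ, E)])).mdifferentiableAt
      one_ne_zero
  have hi : MDifferentiableAt (𝓡 2) 𝓘(ℝ, R3) ((↑) : S2 → R3) z.2 :=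
    (contMDiff_coe_sphere (m := 1)).contMDiffAt.mdifferentiableAt one_ne_zero
  have h1 := mvfderiv_eq_of_comp (f := fun z : M × S2 => extChartAt 𝓘(ℝ, E) x₀ z.1) hι
    (differentiableAt_fst (𝕜 := ℝ)) (Eventually.of_forall fun _ => rfl)
  have h2 := mvfderiv_eq_of_comp (f := fun z : M × S2 => (z.2 : R3)) hι
    (differentiableAt_snd (𝕜 := ℝ)) (Eventually.of_forall fun _ => rfl)
  have hf : MDifferentiableAt (twistorModel E) 𝓘(ℝ, E) (Prod.fst : M × S2 → M) z :=
    mdifferentiableAt_fst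
  have hs : MDifferentiableAt (twistorModel E) (𝓡 2) (Prod.snd : M × S2 → S2) z :=
    mdifferentiableAt_snd
  have h3 := mfderiv_comp z hφ hf
  have h4 := mfderiv_comp z hi hs
  rw [mfderiv_fst] at h3
  rw [mfderiv_snd] at h4
  rw [fderiv_fst] at h1
  rw [fderiv_snd] at h2
  refine Prod.ext ?_ ?_
  · have := congrArg (fun L => L v) h1
    refine this.symm.trans ?_
    exact congrArg (fun L => L v) h3
  · have := congrArg (fun L => L v) h2
    refine this.symm.trans ?_
    exact congrArg (fun L => L v) h4

/-- A covector on `E × ℝ³`, restricted to `E`. -/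
def covFst : Cov (E × R3) →L[ℝ] Cov E :=
  (ContinuousLinearMap.compL ℝ E (E × R3) ℂ).flip (ContinuousLinearMap.inl ℝ E R3)

theorem covFst_apply (α : Cov (E × R3)) (v : E) : covFst α v = α (v, 0) := rfl

variable (Q : HypercomplexStructure E M) (g : RiemannianMetricOn E M)

/-- The twistor bivector field in `E × ℝ³`. -/
def modelBivector (x₀ : M) (w : E × R3) : Form (E × R3) := fun α β =>
  comb (fun k => holCoef w.2 k) (fun k => invForm (chartMetric x₀ g w.1)
    (fun j => chartStructures Q x₀ j w.1) k) (covFst α) (covFst β)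

/-- The tautological almost complex structure in `E × ℝ³`, with `v ↦ m × v` on `ℝ³`. -/
def modelStructure (x₀ : M) (w : E × R3) : (E × R3) →L[ℝ] (E × R3) :=
  (quat w.2 (fun k => chartStructures Q x₀ k w.1)).prodMap (crossL w.2)

variable {Q g}

theorem chart_structureAt {x₀ y : M} (hy : y ∈ (extChartAt 𝓘(ℝ, E) x₀).source) (a : S2)
    (v : TangentSpace 𝓘(ℝ, E) y) :
    mvfderiv 𝓘(ℝ, E) (extChartAt 𝓘(ℝ, E) x₀) y (Q.structureAt a y v) =
      quat (a : R3) (fun k => chartStructures Q x₀ k (extChartAt 𝓘(ℝ, E) x₀ y))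
        (mvfderiv 𝓘(ℝ, E) (extChartAt 𝓘(ℝ, E) x₀) y v) := by
  have hS : ∀ k, chartStructures Q x₀ k (extChartAt 𝓘(ℝ, E) x₀ y)
      (mvfderiv 𝓘(ℝ, E) (extChartAt 𝓘(ℝ, E) x₀) y v) =
      mvfderiv 𝓘(ℝ, E) (extChartAt 𝓘(ℝ, E) x₀) y (structures Q k y v) := fun k => by
    rw [chartStructures, chartEnd_apply x₀ _ hy]
  rw [quat_apply, hS, hS, hS]
  have he : Q.structureAt a y v = (a : R3) 0 • structures Q 0 y v + (a : R3) 1 • structures Q 1 y v +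
      (a : R3) 2 • structures Q 2 y v := rfl
  rw [he]
  simp only [map_add, map_smul]

theorem mvfderiv_twistorStructure {x₀ : M} {z : M × S2}
    (hz : z.1 ∈ (extChartAt 𝓘(ℝ, E) x₀).source) (v : TangentSpace (twistorModel E) z) :
    mvfderiv (twistorModel E) (twistorEmb (E := E) x₀) z (Q.twistorStructure z v) =
      modelStructure Q x₀ (twistorEmb (E := E) x₀ z)
        (mvfderiv (twistorModel E) (twistorEmb (E := E) x₀) z v) := by
  rw [mvfderiv_twistorEmb x₀ hz, mvfderiv_twistorEmb x₀ hz]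
  refine Prod.ext (chart_structureAt hz z.2 v.1) ?_
  have := S2.complexStructure_spec z.2 v.2
  exact (WithLp.ofLp_injective 2) this

end TwistorModel

/-! ### The twistor bivector field in a chart -/

section TwistorBivector

open Filter Topology

set_option synthInstance.maxHeartbeats 200000

variable {E : Type*} [NormedAddCommGroup E] [NormedSpace ℝ E]

theorem inverse_comp_of_apply {σ : E →L[ℝ] E →L[ℝ] ℝ} (hσ : σ.IsInvertible) {e : E ≃L[ℝ] E}
    {R : (E →L[ℝ] ℝ) →L[ℝ] E} (h : ∀ τ, σ (e.symm (R τ)) = τ.comp (e : E →L[ℝ] E))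
    (τ : E →L[ℝ] ℝ) : σ.inverse (τ.comp (e : E →L[ℝ] E)) = e.symm (R τ) := by
  rw [← h, hσ.inverse_apply_self]

theorem isInvertible_comp_of_pos [FiniteDimensional ℝ E] {G : E →L[ℝ] E →L[ℝ] ℝ} {J : E →L[ℝ] E}
    (hG : ∀ v, v ≠ 0 → 0 < G v v) (hJ : ∀ v, J (J v) = -v) : (G.comp J).IsInvertible := by
  refine (isInvertible_of_pos hG).comp (ContinuousLinearMap.IsInvertible.of_inverse (g := -J) ?_ ?_)
  · ext v; simp [hJ]
  · ext v; simp [hJ]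

variable [FiniteDimensional ℝ E]
  {M : Type*} [TopologicalSpace M] [ChartedSpace E M] [IsManifold 𝓘(ℝ, E) ∞ M]
  {Q : HypercomplexStructure E M} {g : RiemannianMetricOn E M}

theorem bivectorI_apply (h : Q.IsHyperhermitian g) {x₀ y : M}
    (hy : y ∈ (extChartAt 𝓘(ℝ, E) x₀).source) (γ δ : Cov E) :
    Q.bivectorI g y (γ.comp (mvfderiv 𝓘(ℝ, E) (extChartAt 𝓘(ℝ, E) x₀) y))
      (δ.comp (mvfderiv 𝓘(ℝ, E) (extChartAt 𝓘(ℝ, E) x₀) y)) =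
    toForm (invForm (chartMetric x₀ g (extChartAt 𝓘(ℝ, E) x₀ y))
      (fun k => chartStructures Q x₀ k (extChartAt 𝓘(ℝ, E) x₀ y)) 0) γ δ := by
  obtain ⟨e, he, -⟩ := exists_chart_equiv hy
  have hq := isQuaternionic_chart h hy
  set R := invForm (chartMetric x₀ g (extChartAt 𝓘(ℝ, E) x₀ y))
      (fun k => chartStructures Q x₀ k (extChartAt 𝓘(ℝ, E) x₀ y)) 0
  have hee : mvfderiv 𝓘(ℝ, E) (extChartAt 𝓘(ℝ, E) x₀) y = (e : TangentSpace 𝓘(ℝ, E) y →L[ℝ] E) := by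
    ext v
    exact (he v).symm
  have hσ : (fundamentalForm g Q.I y).IsInvertible :=
    isInvertible_comp_of_pos (E := E) (G := g.inner y) (J := Q.I y) (g.pos y) (Q.complex_I.sq y)
  have hR : ∀ τ : E →L[ℝ] ℝ, fundamentalForm g Q.I y (e.symm (R τ)) =
      τ.comp (e : TangentSpace 𝓘(ℝ, E) y →L[ℝ] E) := by
    intro τ
    ext v
    have h1 : fundamentalForm g Q.I y (e.symm (R τ)) v =
        g.inner y (structures Q 0 y (e.symm (R τ))) v := rfl
    rw [h1, ← chartMetric_apply x₀ g hy, ← chartEnd_apply x₀ _ hy, ← he, ← he,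
      e.apply_symm_apply]
    have h2 : chartEnd x₀ (structures Q 0) (extChartAt 𝓘(ℝ, E) x₀ y) (R τ) =
        (chartMetric x₀ g (extChartAt 𝓘(ℝ, E) x₀ y)).inverse τ := by
      have := hq.sq 0 ((chartMetric x₀ g (extChartAt 𝓘(ℝ, E) x₀ y)).inverse τ)
      have hRt : R τ = -(chartStructures Q x₀ 0 (extChartAt 𝓘(ℝ, E) x₀ y)
        ((chartMetric x₀ g (extChartAt 𝓘(ℝ, E) x₀ y)).inverse τ)) := rfl
      rw [hRt]
      change chartStructures Q x₀ 0 (extChartAt 𝓘(ℝ, E) x₀ y) (-_) = _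
      rw [map_neg, this, neg_neg]
    rw [h2, hq.apply_inverse]
    rfl
  have hinv : ∀ τ : E →L[ℝ] ℝ, (fundamentalForm g Q.I y).inverse
      (τ.comp (e : TangentSpace 𝓘(ℝ, E) y →L[ℝ] E)) = e.symm (R τ) :=
    fun τ => inverse_comp_of_apply (E := E) (e := e) hσ hR τ
  rw [hee]
  change δ (e ((fundamentalForm g Q.I y).inverse ((reCov γ).comp
      (e : TangentSpace 𝓘(ℝ, E) y →L[ℝ] E)))) + Complex.I * δ (e ((fundamentalForm g Q.I y).inverse
      ((imCov γ).comp (e : TangentSpace 𝓘(ℝ, E) y →L[ℝ] E)))) = _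
  rw [hinv, hinv, e.apply_symm_apply, e.apply_symm_apply, toForm_apply]

theorem twistorBivector_apply (h : Q.IsHyperhermitian g) {x₀ : M} {z : M × S2}
    (hz : z.1 ∈ (extChartAt 𝓘(ℝ, E) x₀).source) (α β : Cov (E × R3)) :
    Q.twistorBivector g z (α.comp (mvfderiv (twistorModel E) (twistorEmb (E := E) x₀) z))
      (β.comp (mvfderiv (twistorModel E) (twistorEmb (E := E) x₀) z)) =
    modelBivector Q g x₀ (twistorEmb (E := E) x₀ z) α β := by
  have hpull : ∀ α : Cov (E × R3), (oneZeroPart (twistorModel E) (Q.twistorStructure z)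
      (α.comp (mvfderiv (twistorModel E) (twistorEmb (E := E) x₀) z))).comp
        (mfderiv 𝓘(ℝ, E) (twistorModel E) (fun y : M => (y, z.2)) z.1) =
      (projOneZero (quat (z.2 : R3) (fun k => chartStructures Q x₀ k (extChartAt 𝓘(ℝ, E) x₀ z.1)))
        (covFst α)).comp (mvfderiv 𝓘(ℝ, E) (extChartAt 𝓘(ℝ, E) x₀) z.1) := by
    intro α
    rw [mfderiv_prod_left]
    ext v
    have key : ∀ u : TangentSpace (twistorModel E) z,
        mvfderiv (twistorModel E) (twistorEmb (E := E) x₀) z u =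
          (mvfderiv 𝓘(ℝ, E) (extChartAt 𝓘(ℝ, E) x₀) z.1 v, 0) →
        (1 / 2 : ℂ) * (α (mvfderiv (twistorModel E) (twistorEmb (E := E) x₀) z u)
          - Complex.I * α (mvfderiv (twistorModel E) (twistorEmb (E := E) x₀) z
            (Q.twistorStructure z u))) =
        projOneZero (quat (z.2 : R3) (fun k => chartStructures Q x₀ k (extChartAt 𝓘(ℝ, E) x₀ z.1)))
          (covFst α) (mvfderiv 𝓘(ℝ, E) (extChartAt 𝓘(ℝ, E) x₀) z.1 v) := by
      intro u hu
      have h2 : modelStructure Q x₀ (twistorEmb (E := E) x₀ z)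
          (mvfderiv 𝓘(ℝ, E) (extChartAt 𝓘(ℝ, E) x₀) z.1 v, 0) =
          (quat (z.2 : R3) (fun k => chartStructures Q x₀ k (extChartAt 𝓘(ℝ, E) x₀ z.1))
            (mvfderiv 𝓘(ℝ, E) (extChartAt 𝓘(ℝ, E) x₀) z.1 v), 0) :=
        Prod.ext rfl (map_zero (crossL (z.2 : R3)))
      rw [mvfderiv_twistorStructure hz, hu, h2]
      rfl
    let u : TangentSpace (twistorModel E) z :=
      ContinuousLinearMap.inl ℝ (TangentSpace 𝓘(ℝ, E) z.1) (TangentSpace (𝓡 2) z.2) v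
    exact key u ((mvfderiv_twistorEmb x₀ hz u).trans (Prod.ext rfl (map_zero _)))
  change Q.bivectorI g z.1 ((oneZeroPart (twistorModel E) (Q.twistorStructure z)
      (α.comp (mvfderiv (twistorModel E) (twistorEmb (E := E) x₀) z))).comp
        (mfderiv 𝓘(ℝ, E) (twistorModel E) (fun y : M => (y, z.2)) z.1))
    ((oneZeroPart (twistorModel E) (Q.twistorStructure z)
      (β.comp (mvfderiv (twistorModel E) (twistorEmb (E := E) x₀) z))).comp
        (mfderiv 𝓘(ℝ, E) (twistorModel E) (fun y : M => (y, z.2)) z.1)) = _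
  rw [hpull, hpull, bivectorI_apply h hz,
    (isQuaternionic_chart h hz).toForm_projOneZero (S2.sq_sum z.2)]
  rfl

theorem represents_twistorBivector (h : Q.IsHyperhermitian g) (x₀ : M) (a₀ : S2) :
    Represents (twistorModel E) (twistorEmb (E := E) x₀) (x₀, a₀) (Q.twistorBivector g)
      (modelBivector Q g x₀) := by
  have : ∀ᶠ z : M × S2 in 𝓝 (x₀, a₀), z.1 ∈ (extChartAt 𝓘(ℝ, E) x₀).source :=
    continuousAt_fst.eventually (extChartAt_source_mem_nhds (I := 𝓘(ℝ, E)) x₀)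
  filter_upwards [this] with z hz α β using twistorBivector_apply h hz α β

/-- The covectors on `E × ℝ³` restrict to all covectors of `Z`. -/
theorem exists_cov_comp {x₀ : M} {z : M × S2} (hz : z.1 ∈ (extChartAt 𝓘(ℝ, E) x₀).source)
    (α : ComplexCotangent (twistorModel E) z) :
    ∃ α' : Cov (E × R3), α = α'.comp (mvfderiv (twistorModel E) (twistorEmb (E := E) x₀) z) := by
  have : Fact (Module.finrank ℝ R3 = 2 + 1) := ⟨by simp⟩
  obtain ⟨e, he, -⟩ := exists_chart_equiv hz
  have hinj : Function.Injective (S2.dIncl z.2) := injective_mvfderiv_subtypeVal_sphere (n := 2) z.2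
  obtain ⟨L, hL⟩ := LinearMap.exists_leftInverse_of_injective
    (S2.dIncl z.2 : TangentSpace (𝓡 2) z.2 →ₗ[ℝ] R3) (LinearMap.ker_eq_bot.2 hinj)
  let β : (E × R3) →ₗ[ℝ] ℂ := (α : TangentSpace (twistorModel E) z →ₗ[ℝ] ℂ) ∘ₗ
    LinearMap.prodMap (e.symm : E →ₗ[ℝ] TangentSpace 𝓘(ℝ, E) z.1) L
  refine ⟨LinearMap.toContinuousLinearMap β, ?_⟩
  ext v
  have h1 : α v = α (e.symm (e v.1), L (S2.dIncl z.2 v.2)) :=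
    congrArg α (Prod.ext (e.symm_apply_apply _).symm (congrArg (fun L => L v.2) hL).symm)
  have h2 : mvfderiv (twistorModel E) (twistorEmb (E := E) x₀) z v = (e v.1, S2.dIncl z.2 v.2) :=
    (mvfderiv_twistorEmb x₀ hz v).trans (congrArg (fun w => (w, S2.dIncl z.2 v.2)) (he v.1).symm)
  exact h1.trans (congrArg (LinearMap.toContinuousLinearMap β) h2.symm)

end TwistorBivector

/-! ### Derivatives of the twistor bivector field -/

section ModelCalculus

open Filter Topology

set_option synthInstance.maxHeartbeats 200000

theorem contDiff_holCoef (k : Fin 3) : ContDiff ℝ ∞ (fun m : R3 => holCoef m k) := by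
  have hc : ∀ j : Fin 3, ContDiff ℝ ∞ (fun m : R3 => ((m j : ℝ) : ℂ)) := fun j =>
    (Complex.ofRealCLM.comp (EuclideanSpace.proj (𝕜 := ℝ) j)).contDiff
  fin_cases k
  · exact contDiff_const.mul (contDiff_const.sub ((hc 0).pow 2))
  · exact contDiff_const.mul (((hc 0).mul (hc 1)).neg.sub (contDiff_const.mul (hc 2)))
  · exact contDiff_const.mul (((hc 0).mul (hc 2)).neg.add (contDiff_const.mul (hc 1)))

theorem fderiv_holCoef (k : Fin 3) (m V : R3) :
    fderiv ℝ (fun m : R3 => holCoef m k) m V = holCoefDeriv m V k := by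
  have hc : ∀ j : Fin 3, HasFDerivAt (fun m : R3 => ((m j : ℝ) : ℂ))
      (Complex.ofRealCLM.comp (EuclideanSpace.proj (𝕜 := ℝ) j)) m := fun j =>
    (Complex.ofRealCLM.comp (EuclideanSpace.proj (𝕜 := ℝ) j)).hasFDerivAt
  fin_cases k
  · have := (((hc 0).mul (hc 0)).const_sub 1).const_mul (1 / 2 : ℂ)
    refine (congrArg (fun L : R3 →L[ℝ] ℂ => L V)
      (this.congr_of_eventuallyEq (Eventually.of_forall fun m => ?_)).fderiv).trans ?_
    · simp [holCoef, pow_two]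
    · simp [holCoefDeriv]
      ring
  · have := (((hc 0).mul (hc 1)).neg.sub ((hc 2).const_mul Complex.I)).const_mul (1 / 2 : ℂ)
    refine (congrArg (fun L : R3 →L[ℝ] ℂ => L V) this.fderiv).trans ?_
    simp [holCoefDeriv]
    ring
  · have := (((hc 0).mul (hc 2)).neg.add ((hc 1).const_mul Complex.I)).const_mul (1 / 2 : ℂ)
    refine (congrArg (fun L : R3 →L[ℝ] ℂ => L V) this.fderiv).trans ?_
    simp [holCoefDeriv]
    ring

theorem contDiffAt_comp_fst {X X' Y : Type*} [NormedAddCommGroup X] [NormedSpace ℝ X]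
    [NormedAddCommGroup X'] [NormedSpace ℝ X'] [NormedAddCommGroup Y] [NormedSpace ℝ Y]
    {n : WithTop ℕ∞} {f : X → Y} {w : X × X'} (hf : ContDiffAt ℝ n f w.1) :
    ContDiffAt ℝ n (fun w : X × X' => f w.1) w := hf.comp w contDiffAt_fst

theorem hasFDerivAt_comp_fst {X X' Y : Type*} [NormedAddCommGroup X] [NormedSpace ℝ X]
    [NormedAddCommGroup X'] [NormedSpace ℝ X'] [NormedAddCommGroup Y] [NormedSpace ℝ Y]
    {f : X → Y} {f' : X →L[ℝ] Y} {w : X × X'} (hf : HasFDerivAt f f' w.1) :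
    HasFDerivAt (fun w : X × X' => f w.1) (f'.comp (ContinuousLinearMap.fst ℝ X X')) w :=
  hf.comp w hasFDerivAt_fst

variable {E : Type*} [NormedAddCommGroup E] [NormedSpace ℝ E] [FiniteDimensional ℝ E]
  {M : Type*} [TopologicalSpace M] [ChartedSpace E M] [IsManifold 𝓘(ℝ, E) ∞ M]
  {Q : HypercomplexStructure E M} {g : RiemannianMetricOn E M}

theorem isBivector_modelBivector (h : Q.IsHyperhermitian g) {x₀ : M} {z : M × S2}
    (hz : z.1 ∈ (extChartAt 𝓘(ℝ, E) x₀).source) :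
    IsBivector (modelBivector Q g x₀ (twistorEmb (E := E) x₀ z)) := by
  have hb := (isQuaternionic_chart h hz).isBivector_comb (holCoef (z.2 : R3))
  refine ⟨fun α β => hb.skew _ _, fun α => ?_⟩
  obtain ⟨a₁, a₂, ha⟩ := hb.vec (covFst α)
  exact ⟨(a₁, 0), (a₂, 0), fun θ => ha (covFst θ)⟩

theorem contDiffAt_clm_inverse {X Y W : Type*} [NormedAddCommGroup X] [NormedSpace ℝ X]
    [NormedAddCommGroup Y] [NormedSpace ℝ Y] [CompleteSpace X] [NormedAddCommGroup W]
    [NormedSpace ℝ W] {L : W → X →L[ℝ] Y} {p : W} {n : WithTop ℕ∞}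
    (hL : ContDiffAt ℝ n L p) (hi : (L p).IsInvertible) :
    ContDiffAt ℝ n (fun ξ => (L ξ).inverse) p := by
  obtain ⟨e, he⟩ := hi
  have h1 : ContDiffAt ℝ n ContinuousLinearMap.inverse (L p) := by
    rw [← he]
    exact contDiffAt_map_inverse e
  exact h1.comp p hL

theorem contDiffAt_chart_invForm (h : Q.IsHyperhermitian g) (x₀ : M) (k : Fin 3) :
    ContDiffAt ℝ ∞ (fun ξ => invForm (chartMetric x₀ g ξ) (fun j => chartStructures Q x₀ j ξ) k)
      (extChartAt 𝓘(ℝ, E) x₀ x₀) := by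
  have : CompleteSpace E := FiniteDimensional.complete ℝ E
  have h1 := contDiffAt_clm_inverse (Y := E →L[ℝ] ℝ) (contDiffAt_chartMetric (mem_extChartAt_source x₀) g)
    (isQuaternionic_chart h (mem_extChartAt_source x₀)).isInvertible
  exact ((contDiffAt_chartEnd (mem_extChartAt_source x₀) (smooth_structures Q k)).clm_comp h1).neg

omit [FiniteDimensional ℝ E] in
theorem contDiffAt_comb {W : Type*} [NormedAddCommGroup W] [NormedSpace ℝ W] {n : WithTop ℕ∞}
    {c : Fin 3 → W → ℂ} {R : Fin 3 → W → (E →L[ℝ] ℝ) →L[ℝ] E} {a b : W → Cov E} {p : W}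
    (hc : ∀ k, ContDiffAt ℝ n (c k) p) (hR : ∀ k, ContDiffAt ℝ n (R k) p)
    (ha : ContDiffAt ℝ n a p) (hb : ContDiffAt ℝ n b p) :
    ContDiffAt ℝ n (fun w => comb (fun k => c k w) (fun k => R k w) (a w) (b w)) p := by
  have h1 : ContDiffAt ℝ n (fun w => reCov (a w)) p := reCov.contDiff.contDiffAt.comp p ha
  have h2 : ContDiffAt ℝ n (fun w => imCov (a w)) p := imCov.contDiff.contDiffAt.comp p ha
  exact ContDiffAt.sum fun k _ => (hc k).mul ((hb.clm_apply ((hR k).clm_apply h1)).add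
    (contDiffAt_const.mul (hb.clm_apply ((hR k).clm_apply h2))))

variable (x₀ : M) (a₀ : S2)

theorem contDiffAt_bracket_modelBivector (h : Q.IsHyperhermitian g) {f k : E × R3 → ℂ}
    (hf : ContDiffAt ℝ ∞ f (twistorEmb (E := E) x₀ (x₀, a₀)))
    (hk : ContDiffAt ℝ ∞ k (twistorEmb (E := E) x₀ (x₀, a₀))) :
    ContDiffAt ℝ ∞ (bracket (modelBivector Q g x₀) f k) (twistorEmb (E := E) x₀ (x₀, a₀)) := by
  have hd : ∀ {f : E × R3 → ℂ}, ContDiffAt ℝ ∞ f (twistorEmb (E := E) x₀ (x₀, a₀)) →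
      ContDiffAt ℝ ∞ (fun w => covFst (fderiv ℝ f w)) (twistorEmb (E := E) x₀ (x₀, a₀)) :=
    fun hf => covFst.contDiff.contDiffAt.comp _ (hf.fderiv_right (m := ∞) (by simp))
  have hc : ∀ k, ContDiffAt ℝ ∞ (fun w : E × R3 => holCoef w.2 k)
      (twistorEmb (E := E) x₀ (x₀, a₀)) := fun k =>
    ((contDiff_holCoef k).comp contDiff_snd).contDiffAt
  have hR : ∀ k, ContDiffAt ℝ ∞ (fun w : E × R3 => invForm (chartMetric x₀ g w.1)
      (fun j => chartStructures Q x₀ j w.1) k) (twistorEmb (E := E) x₀ (x₀, a₀)) := fun k =>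
    contDiffAt_comp_fst (f := fun ξ => invForm (chartMetric x₀ g ξ)
      (fun j => chartStructures Q x₀ j ξ) k)
      (w := twistorEmb (E := E) x₀ (x₀, a₀)) (contDiffAt_chart_invForm h x₀ k)
  have := contDiffAt_comb (a := fun w => covFst (fderiv ℝ f w)) (b := fun w => covFst (fderiv ℝ k w))
    hc hR (hd hf) (hd hk)
  exact this.congr_of_eventuallyEq (Eventually.of_forall fun _ => rfl)

theorem formDifferentiableAt_modelBivector (h : Q.IsHyperhermitian g) :
    FormDifferentiableAt (modelBivector Q g x₀) (twistorEmb (E := E) x₀ (x₀, a₀)) ∧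
    ∀ α β U, dForm (modelBivector Q g x₀) (twistorEmb (E := E) x₀ (x₀, a₀)) α β U =
      comb (holCoefDeriv (a₀ : R3) U.2) (invForm (chartMetric x₀ g (extChartAt 𝓘(ℝ, E) x₀ x₀))
        (fun j => chartStructures Q x₀ j (extChartAt 𝓘(ℝ, E) x₀ x₀))) (covFst α) (covFst β) +
      dForm (field (chartMetric x₀ g) (chartStructures Q x₀) (holCoef (a₀ : R3)))
        (extChartAt 𝓘(ℝ, E) x₀ x₀) (covFst α) (covFst β) U.1 := by
  have hq := isQuaternionicAt_chart h x₀
  have hc : ∀ k, HasFDerivAt (fun w : E × R3 => holCoef w.2 k)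
      ((fderiv ℝ (fun m : R3 => holCoef m k) (a₀ : R3)).comp (ContinuousLinearMap.snd ℝ E R3))
      (twistorEmb (E := E) x₀ (x₀, a₀)) := fun k => by
    have h1 : HasFDerivAt (fun m : R3 => holCoef m k) (fderiv ℝ (fun m : R3 => holCoef m k) (a₀ : R3))
        (twistorEmb (E := E) x₀ (x₀, a₀)).2 :=
      ((contDiff_holCoef k).differentiable (by simp)).differentiableAt.hasFDerivAt
    exact h1.comp (twistorEmb (E := E) x₀ (x₀, a₀)) hasFDerivAt_snd
  have hR : ∀ k, HasFDerivAt (fun w : E × R3 => invForm (chartMetric x₀ g w.1)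
      (fun j => chartStructures Q x₀ j w.1) k)
      ((fderiv ℝ (fun ξ => invForm (chartMetric x₀ g ξ) (fun j => chartStructures Q x₀ j ξ) k)
        (extChartAt 𝓘(ℝ, E) x₀ x₀)).comp (ContinuousLinearMap.fst ℝ E R3))
      (twistorEmb (E := E) x₀ (x₀, a₀)) := fun k =>
    hasFDerivAt_comp_fst (f := fun ξ => invForm (chartMetric x₀ g ξ)
      (fun j => chartStructures Q x₀ j ξ) k)
      (w := twistorEmb (E := E) x₀ (x₀, a₀))
      (hq.differentiableAt_invForm k).hasFDerivAt
  have key := formDifferentiableAt_comb (covFst (E := E)) (fun k => (hc k).differentiableAt)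
    (fun k => (hR k).differentiableAt)
  refine ⟨key.1, fun α β U => (key.2 α β U).trans ?_⟩
  simp only [hq.dForm_field, (hc _).fderiv, (hR _).fderiv]
  refine congrArg₂ _ (congrArg (fun c => comb c _ _ _) (funext fun k => ?_)) rfl
  exact fderiv_holCoef k _ _

theorem covFst_dForm_modelBivector (h : Q.IsHyperhermitian g) (α β : Cov (E × R3)) :
    covFst (dForm (modelBivector Q g x₀) (twistorEmb (E := E) x₀ (x₀, a₀)) α β) =
      dForm (field (chartMetric x₀ g) (chartStructures Q x₀) (holCoef (a₀ : R3)))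
        (extChartAt 𝓘(ℝ, E) x₀ x₀) (covFst α) (covFst β) := by
  ext v
  rw [covFst_apply, (formDifferentiableAt_modelBivector x₀ a₀ h).2]
  simp [comb_apply, holCoefDeriv]

omit [FiniteDimensional ℝ E] in
theorem differentiableAt_modelStructure (h : Q.IsHyperhermitian g) :
    DifferentiableAt ℝ (modelStructure Q x₀) (twistorEmb (E := E) x₀ (x₀, a₀)) := by
  have hq := isQuaternionicAt_chart h x₀
  have hS : ∀ k, DifferentiableAt ℝ (fun w : E × R3 => chartStructures Q x₀ k w.1)
      (twistorEmb (E := E) x₀ (x₀, a₀)) := fun k =>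
    DifferentiableAt.comp _ (hq.diff_S k) differentiableAt_fst
  have hm : ∀ j : Fin 3, DifferentiableAt ℝ (fun w : E × R3 => w.2 j)
      (twistorEmb (E := E) x₀ (x₀, a₀)) := fun j =>
    ((EuclideanSpace.proj (𝕜 := ℝ) j).comp (ContinuousLinearMap.snd ℝ E R3)).differentiableAt
  have h1 : DifferentiableAt ℝ
      (fun w : E × R3 => quat w.2 (fun k => chartStructures Q x₀ k w.1))
      (twistorEmb (E := E) x₀ (x₀, a₀)) :=
    (((hm 0).fun_smul (hS 0)).fun_add ((hm 1).fun_smul (hS 1))).fun_add ((hm 2).fun_smul (hS 2))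
  have h2 : DifferentiableAt ℝ (fun w : E × R3 => crossL w.2) (twistorEmb (E := E) x₀ (x₀, a₀)) :=
    (crossL.comp (ContinuousLinearMap.snd ℝ E R3)).differentiableAt
  exact (ContinuousLinearMap.prodMapL ℝ E E R3 R3).differentiableAt.comp _ (h1.prodMk h2)

omit [FiniteDimensional ℝ E] in
theorem fderiv_modelStructure (h : Q.IsHyperhermitian g) (v : E) (U : E × R3) :
    fderiv ℝ (modelStructure Q x₀) (twistorEmb (E := E) x₀ (x₀, a₀)) (v, 0) U =
      (fderiv ℝ (fun ξ => quat (a₀ : R3) (fun k => chartStructures Q x₀ k ξ))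
        (extChartAt 𝓘(ℝ, E) x₀ x₀) v U.1, 0) := by
  have hq := isQuaternionicAt_chart h x₀
  have h1 := (HasFDerivAt.comp (extChartAt 𝓘(ℝ, E) x₀ x₀)
    (differentiableAt_modelStructure x₀ a₀ h).hasFDerivAt
    (hasFDerivAt_prodMk_left (𝕜 := ℝ) (extChartAt 𝓘(ℝ, E) x₀ x₀) (a₀ : R3))).clm_apply
    (hasFDerivAt_const U _)
  have h2 := (((hq.differentiableAt_quat (a₀ : R3)).hasFDerivAt.clm_apply
    (hasFDerivAt_const U.1 _)).prodMk
      (hasFDerivAt_const (crossL (a₀ : R3) U.2) (extChartAt 𝓘(ℝ, E) x₀ x₀)))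
  have h3 := congrArg (fun L : E →L[ℝ] E × R3 => L v) (h1.unique h2)
  simpa using h3

end ModelCalculus

/-! ### Brackets of the twistor bivector field -/

section PoissonCriterion

open Filter Topology

set_option synthInstance.maxHeartbeats 200000

variable {E : Type*} [NormedAddCommGroup E] [NormedSpace ℝ E] [FiniteDimensional ℝ E]
  {M : Type*} [TopologicalSpace M] [ChartedSpace E M] [IsManifold 𝓘(ℝ, E) ∞ M]
  {Q : HypercomplexStructure E M} {g : RiemannianMetricOn E M}

theorem schoutenSelf_twistorBivector (h : Q.IsHyperhermitian g) (x₀ : M) (a₀ : S2)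
    {f₁ f₂ f₃ : M × S2 → ℂ} {f₁' f₂' f₃' : E × R3 → ℂ}
    (h₁' : ContDiffAt ℝ 2 f₁' (twistorEmb (E := E) x₀ (x₀, a₀)))
    (h₂' : ContDiffAt ℝ 2 f₂' (twistorEmb (E := E) x₀ (x₀, a₀)))
    (h₃' : ContDiffAt ℝ 2 f₃' (twistorEmb (E := E) x₀ (x₀, a₀)))
    (h₁ : f₁ =ᶠ[𝓝 (x₀, a₀)] f₁' ∘ twistorEmb (E := E) x₀)
    (h₂ : f₂ =ᶠ[𝓝 (x₀, a₀)] f₂' ∘ twistorEmb (E := E) x₀)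
    (h₃ : f₃ =ᶠ[𝓝 (x₀, a₀)] f₃' ∘ twistorEmb (E := E) x₀) :
    schoutenSelf (twistorModel E) (Q.twistorBivector g) f₁ f₂ f₃ (x₀, a₀) =
      2 * schouten (chartMetric x₀ g) (chartStructures Q x₀) (extChartAt 𝓘(ℝ, E) x₀ x₀)
        (holCoef (a₀ : R3)) (holCoef (a₀ : R3))
        (covFst (fderiv ℝ f₁' (twistorEmb (E := E) x₀ (x₀, a₀))))
        (covFst (fderiv ℝ f₂' (twistorEmb (E := E) x₀ (x₀, a₀))))
        (covFst (fderiv ℝ f₃' (twistorEmb (E := E) x₀ (x₀, a₀)))) := by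
  rw [(isLocalModel_twistor x₀ a₀).schoutenSelf_eq (represents_twistorBivector h x₀ a₀)
    (formDifferentiableAt_modelBivector x₀ a₀ h).1
    (isBivector_modelBivector h (mem_extChartAt_source x₀)) h₁' h₂' h₃' h₁ h₂ h₃]
  simp only [schouten, ← covFst_dForm_modelBivector x₀ a₀ h]
  rfl

theorem crossL_self (m : R3) (t : ℝ) : crossL m (t • m) = 0 := by
  rw [map_smul, show crossL m m = 0 from WithLp.ofLp_injective 2 (by
    rw [crossL_apply, cross_self]; rfl), smul_zero]

omit [FiniteDimensional ℝ E] in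
theorem modelStructure_apply (x₀ : M) (w U : E × R3) : modelStructure Q x₀ w U =
    (quat w.2 (fun k => chartStructures Q x₀ k w.1) U.1, crossL w.2 U.2) := rfl

omit [FiniteDimensional ℝ E] in
/-- A function whose radial derivative vanishes has a differential of type `(1,0)` in `E × ℝ³` as
soon as it is so on `Z`. -/
theorem fderiv_modelStructure_apply {x₀ : M} {a₀ : S2} {f : M × S2 → ℂ} {f' : E × R3 → ℂ}
    (hd : DifferentiableAt ℝ f' (twistorEmb (E := E) x₀ (x₀, a₀)))
    (hf : f =ᶠ[𝓝 (x₀, a₀)] f' ∘ twistorEmb (E := E) x₀)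
    (hr : fderiv ℝ f' (twistorEmb (E := E) x₀ (x₀, a₀)) (0, (a₀ : R3)) = 0)
    (ht : IsCovectorOneZero (twistorModel E) (Q.twistorStructure (x₀, a₀))
      (mvfderiv (twistorModel E) f (x₀, a₀))) (w : E × R3) :
    fderiv ℝ f' (twistorEmb (E := E) x₀ (x₀, a₀))
      (modelStructure Q x₀ (twistorEmb (E := E) x₀ (x₀, a₀)) w) =
      Complex.I * fderiv ℝ f' (twistorEmb (E := E) x₀ (x₀, a₀)) w := by
  have : IsManifold (twistorModel E) 1 (M × S2) := IsManifold.of_le (n := ∞) (by simp)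
  have hx : ((x₀, a₀) : M × S2).1 ∈ (extChartAt 𝓘(ℝ, E) x₀).source := mem_extChartAt_source x₀
  obtain ⟨e, he, -⟩ := exists_chart_equiv hx
  obtain ⟨v, t, hv⟩ := exists_dIncl a₀ w.2
  let u : TangentSpace (twistorModel E) ((x₀, a₀) : M × S2) := (e.symm w.1, v)
  have hu : mvfderiv (twistorModel E) (twistorEmb (E := E) x₀) (x₀, a₀) u =
      (w.1, S2.dIncl a₀ v) :=
    (mvfderiv_twistorEmb x₀ hx u).trans (congrArg (fun y => (y, S2.dIncl a₀ v))
      ((he _).symm.trans (e.apply_symm_apply w.1)))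
  have hw : w = mvfderiv (twistorModel E) (twistorEmb (E := E) x₀) (x₀, a₀) u +
      t • (0, (a₀ : R3)) := by
    rw [hu]
    exact Prod.ext (by simp) hv
  have hm : mvfderiv (twistorModel E) f (x₀, a₀) = _ :=
    mvfderiv_eq_of_comp (isLocalModel_twistor (E := E) x₀ a₀).eventually_mdifferentiableAt.self_of_nhds
      hd hf
  have h1 := ht u
  rw [hm, ContinuousLinearMap.comp_apply, ContinuousLinearMap.comp_apply,
    mvfderiv_twistorStructure hx] at h1
  have h2 : modelStructure Q x₀ (twistorEmb (E := E) x₀ (x₀, a₀)) (t • (0, (a₀ : R3))) = 0 := by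
    rw [modelStructure_apply]
    refine Prod.ext ?_ (crossL_self (a₀ : R3) t)
    exact (congrArg _ (smul_zero t)).trans (map_zero _)
  generalize modelStructure Q x₀ (twistorEmb (E := E) x₀ (x₀, a₀)) = A at h1 h2 ⊢
  generalize fderiv ℝ f' (twistorEmb (E := E) x₀ (x₀, a₀)) = L at h1 hr ⊢
  rw [hw, map_add, map_add, map_add, h1, h2, map_zero, map_smul, hr, smul_zero, add_zero, add_zero]

theorem lieDerivZeroOne_twistorBivector (h : Q.IsHyperhermitian g) (x₀ : M) (a₀ : S2)
    {V : ∀ z : M × S2, TangentSpace (twistorModel E) z}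
    (hV : SmoothVectorAt (twistorModel E) V (x₀, a₀))
    {f₁ f₂ : M × S2 → ℂ} {f₁' f₂' : E × R3 → ℂ}
    (h₁' : ContDiffAt ℝ 2 f₁' (twistorEmb (E := E) x₀ (x₀, a₀)))
    (h₂' : ContDiffAt ℝ 2 f₂' (twistorEmb (E := E) x₀ (x₀, a₀)))
    (h₁ : f₁ =ᶠ[𝓝 (x₀, a₀)] f₁' ∘ twistorEmb (E := E) x₀)
    (h₂ : f₂ =ᶠ[𝓝 (x₀, a₀)] f₂' ∘ twistorEmb (E := E) x₀)
    (hr₁ : fderiv ℝ f₁' (twistorEmb (E := E) x₀ (x₀, a₀)) (0, (a₀ : R3)) = 0)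
    (hr₂ : fderiv ℝ f₂' (twistorEmb (E := E) x₀ (x₀, a₀)) (0, (a₀ : R3)) = 0)
    (ht₁ : IsCovectorOneZero (twistorModel E) (Q.twistorStructure (x₀, a₀))
      (mvfderiv (twistorModel E) f₁ (x₀, a₀)))
    (ht₂ : IsCovectorOneZero (twistorModel E) (Q.twistorStructure (x₀, a₀))
      (mvfderiv (twistorModel E) f₂ (x₀, a₀))) :
    (∀ v, covFst (fderiv ℝ f₁' (twistorEmb (E := E) x₀ (x₀, a₀))) (quat (a₀ : R3)
      (fun k => chartStructures Q x₀ k (extChartAt 𝓘(ℝ, E) x₀ x₀)) v) =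
      Complex.I * covFst (fderiv ℝ f₁' (twistorEmb (E := E) x₀ (x₀, a₀))) v) ∧
    (∀ v, covFst (fderiv ℝ f₂' (twistorEmb (E := E) x₀ (x₀, a₀))) (quat (a₀ : R3)
      (fun k => chartStructures Q x₀ k (extChartAt 𝓘(ℝ, E) x₀ x₀)) v) =
      Complex.I * covFst (fderiv ℝ f₂' (twistorEmb (E := E) x₀ (x₀, a₀))) v) ∧
    lieDerivZeroOne (twistorModel E) Q.twistorStructure (Q.twistorBivector g) V f₁ f₂ (x₀, a₀) =
      (1 / 2 : ℂ) * dbarTensor (chartMetric x₀ g) (chartStructures Q x₀)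
        (extChartAt 𝓘(ℝ, E) x₀ x₀) (a₀ : R3) (holCoef (a₀ : R3))
        (mvfderiv (twistorModel E) (twistorEmb (E := E) x₀) (x₀, a₀) (V (x₀, a₀))).1
        (covFst (fderiv ℝ f₁' (twistorEmb (E := E) x₀ (x₀, a₀))))
        (covFst (fderiv ℝ f₂' (twistorEmb (E := E) x₀ (x₀, a₀)))) := by
  have hx : ((x₀, a₀) : M × S2).1 ∈ (extChartAt 𝓘(ℝ, E) x₀).source := mem_extChartAt_source x₀
  have hJ₁ := fderiv_modelStructure_apply (h₁'.differentiableAt two_ne_zero) h₁ hr₁ ht₁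
  have hJ₂ := fderiv_modelStructure_apply (h₂'.differentiableAt two_ne_zero) h₂ hr₂ ht₂
  have hJ : ∀ᶠ z : M × S2 in 𝓝 (x₀, a₀), ∀ v,
      mvfderiv (twistorModel E) (twistorEmb (E := E) x₀) z (Q.twistorStructure z v) =
      modelStructure Q x₀ (twistorEmb (E := E) x₀ z)
        (mvfderiv (twistorModel E) (twistorEmb (E := E) x₀) z v) := by
    have : ∀ᶠ z : M × S2 in 𝓝 (x₀, a₀), z.1 ∈ (extChartAt 𝓘(ℝ, E) x₀).source :=
      continuousAt_fst.eventually (extChartAt_source_mem_nhds (I := 𝓘(ℝ, E)) x₀)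
    filter_upwards [this] with z hz v using mvfderiv_twistorStructure hz v
  have key := (isLocalModel_twistor x₀ a₀).lieDerivZeroOne_eq (represents_twistorBivector h x₀ a₀)
    (formDifferentiableAt_modelBivector x₀ a₀ h).1 (isBivector_modelBivector h hx)
    (differentiableAt_modelStructure x₀ a₀ h) hJ hV h₁' h₂' h₁ h₂ hJ₁ hJ₂
  set w₀ := twistorEmb (E := E) x₀ (x₀, a₀) with hw₀
  have hJE : ∀ v, modelStructure Q x₀ w₀ (v, 0) = (quat (a₀ : R3)
      (fun k => chartStructures Q x₀ k (extChartAt 𝓘(ℝ, E) x₀ x₀)) v, 0) := fun v => by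
    rw [modelStructure_apply]
    exact Prod.ext rfl (map_zero (crossL (a₀ : R3)))
  have hc₁ : ∀ v, covFst (fderiv ℝ f₁' w₀) (quat (a₀ : R3)
      (fun k => chartStructures Q x₀ k (extChartAt 𝓘(ℝ, E) x₀ x₀)) v) =
      Complex.I * covFst (fderiv ℝ f₁' w₀) v := fun v => by
    rw [covFst_apply, covFst_apply, ← hJE, hJ₁]
  have hc₂ : ∀ v, covFst (fderiv ℝ f₂' w₀) (quat (a₀ : R3)
      (fun k => chartStructures Q x₀ k (extChartAt 𝓘(ℝ, E) x₀ x₀)) v) =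
      Complex.I * covFst (fderiv ℝ f₂' w₀) v := fun v => by
    rw [covFst_apply, covFst_apply, ← hJE, hJ₂]
  refine ⟨hc₁, hc₂, key.trans ?_⟩
  have hU : mvfderiv (twistorModel E) (twistorEmb (E := E) x₀) (x₀, a₀) (V (x₀, a₀)) = _ :=
    mvfderiv_twistorEmb x₀ hx (V (x₀, a₀))
  have horth := dIncl_orthogonal a₀ (V (x₀, a₀)).2
  have hU2 := congrArg Prod.snd hU
  change _ = S2.dIncl a₀ (V (x₀, a₀)).2 at hU2
  rw [← hU2] at horth
  generalize mvfderiv (twistorModel E) (twistorEmb (E := E) x₀) (x₀, a₀) (V (x₀, a₀)) = U at horth ⊢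
  have hflip : ∀ γ : Cov (E × R3), covFst (γ.comp ((fderiv ℝ (modelStructure Q x₀) w₀).flip U)) =
      (covFst γ).comp ((fderiv ℝ (fun ξ => quat (a₀ : R3) (fun k => chartStructures Q x₀ k ξ))
        (extChartAt 𝓘(ℝ, E) x₀ x₀)).flip U.1) := by
    intro γ
    ext v
    exact congrArg γ (fderiv_modelStructure x₀ a₀ h v U)
  have hB : ∀ α β, modelBivector Q g x₀ w₀ α β =
      field (chartMetric x₀ g) (chartStructures Q x₀) (holCoef (a₀ : R3))
        (extChartAt 𝓘(ℝ, E) x₀ x₀) (covFst α) (covFst β) := fun _ _ => rfl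
  have hS := (isQuaternionic_chart h hx).comb_sphere_derivative
    horth (S2.sq_sum a₀) hc₁ hc₂
  rw [hB, hB, hflip, hflip, (formDifferentiableAt_modelBivector x₀ a₀ h).2,
    (formDifferentiableAt_modelBivector x₀ a₀ h).2, dbarTensor]
  have e1 : (modelStructure Q x₀ w₀ U).1 = quat (a₀ : R3)
      (fun k => chartStructures Q x₀ k (extChartAt 𝓘(ℝ, E) x₀ x₀)) U.1 := rfl
  have e2 : ((modelStructure Q x₀ w₀ U).2).ofLp = crossProduct (a₀ : R3).ofLp U.2.ofLp := rfl
  rw [e1, e2]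
  linear_combination (1 / 2 : ℂ) * hS

end PoissonCriterion

/-! ### Holomorphic Poisson structures and hyperkähler metrics -/

section PoissonCriterion

open Filter Topology

set_option synthInstance.maxHeartbeats 200000

variable {E : Type*} [NormedAddCommGroup E] [NormedSpace ℝ E] [FiniteDimensional ℝ E]
  {M : Type*} [TopologicalSpace M] [ChartedSpace E M] [IsManifold 𝓘(ℝ, E) ∞ M]
  {Q : HypercomplexStructure E M} {g : RiemannianMetricOn E M}

omit [FiniteDimensional ℝ E] in
theorem fderiv_comp_retract_radial (x₀ : M) (a₀ : S2) {f : M × S2 → ℂ}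
    (hf : SmoothFunAt (twistorModel E) f (x₀, a₀)) :
    fderiv ℝ (f ∘ twistorRetract (E := E) x₀) (twistorEmb (E := E) x₀ (x₀, a₀)) (0, (a₀ : R3)) = 0 := by
  have hd : DifferentiableAt ℝ (f ∘ twistorRetract (E := E) x₀) (twistorEmb (E := E) x₀ (x₀, a₀)) :=
    ((isLocalModel_twistor x₀ a₀).contDiffAt le_rfl hf).differentiableAt (by simp)
  rw [← hd.lineDeriv_eq_fderiv, lineDeriv]
  have hev : (fun t : ℝ => (f ∘ twistorRetract (E := E) x₀)
      (twistorEmb (E := E) x₀ (x₀, a₀) + t • (0, (a₀ : R3)))) =ᶠ[𝓝 0] fun _ =>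
      f ((extChartAt 𝓘(ℝ, E) x₀).symm (extChartAt 𝓘(ℝ, E) x₀ x₀), a₀) := by
    filter_upwards [lt_mem_nhds (show (-1 : ℝ) < 0 by norm_num)] with t ht
    have h1 : (a₀ : R3) + t • (a₀ : R3) = (1 + t) • (a₀ : R3) := by module
    have h2 : extChartAt 𝓘(ℝ, E) x₀ x₀ + t • (0 : E) = extChartAt 𝓘(ℝ, E) x₀ x₀ := by simp
    change f ((extChartAt 𝓘(ℝ, E) x₀).symm (extChartAt 𝓘(ℝ, E) x₀ x₀ + t • (0 : E)),
      radial ((a₀ : R3) + t • (a₀ : R3))) = _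
    rw [h1, h2, radial_smul a₀ (by linarith)]
  rw [hev.deriv_eq, deriv_const]

theorem isSmoothBivector_twistorBivector (h : Q.IsHyperhermitian g) :
    IsSmoothBivector (twistorModel E) (Q.twistorBivector g) := by
  constructor
  · intro z α
    have hz : z.1 ∈ (extChartAt 𝓘(ℝ, E) z.1).source := mem_extChartAt_source z.1
    obtain ⟨α, rfl⟩ := exists_cov_comp hz α
    rw [twistorBivector_apply h hz]
    exact self_eq_neg.1 ((isBivector_modelBivector h hz).skew α α)
  · rintro ⟨x₀, a₀⟩ f k hf hk
    have hm := isLocalModel_twistor (E := E) x₀ a₀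
    have hf' := hm.contDiffAt le_rfl hf
    have hk' := hm.contDiffAt le_rfl hk
    have hb := contDiffAt_bracket_modelBivector x₀ a₀ h hf' hk'
    have h1 : ContMDiffAt (twistorModel E) 𝓘(ℝ, ℂ) ∞ (bracket (modelBivector Q g x₀)
        (f ∘ twistorRetract (E := E) x₀) (k ∘ twistorRetract (E := E) x₀) ∘ twistorEmb (E := E) x₀)
        (x₀, a₀) := hb.contMDiffAt.comp _ hm.smooth
    exact h1.congr_of_eventuallyEq (hm.poissonBracket_eventuallyEq
      (represents_twistorBivector h x₀ a₀) (hf'.of_le (by simp)) (hk'.of_le (by simp))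
      (hm.eventuallyEq f) (hm.eventuallyEq k))

theorem IsQuaternionic.comb_holCoef_projOneZero {G : E →L[ℝ] E →L[ℝ] ℝ} {S : Fin 3 → E →L[ℝ] E}
    (h : IsQuaternionic G S) {n : Fin 3 → ℝ} (hn : n 0 ^ 2 + n 1 ^ 2 + n 2 ^ 2 = 1) (α β : Cov E) :
    comb (holCoef n) (invForm G S) (projOneZero (quat n S) α) (projOneZero (quat n S) β) =
      comb (holCoef n) (invForm G S) α β := by
  have hb := h.isBivector_comb (holCoef n)
  have key : ∀ α β, comb (holCoef n) (invForm G S) (projOneZero (quat n S) α) β =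
      comb (holCoef n) (invForm G S) α β := by
    intro α β
    rw [projOneZero, comb_smul_left, sub_eq_add_neg, ← neg_one_smul ℂ, comb_add_left,
      comb_smul_left, comb_smul_left, h.comb_holCoef_comp hn]
    linear_combination (-1 / 2 : ℂ) * comb (holCoef n) (invForm G S) α β * Complex.I_sq
  rw [key, hb.skew, key, ← hb.skew]

theorem isTypeTwoZero_twistorBivector (h : Q.IsHyperhermitian g) :
    IsTypeTwoZero (twistorModel E) Q.twistorStructure (Q.twistorBivector g) := by
  intro z
  have hz : z.1 ∈ (extChartAt 𝓘(ℝ, E) z.1).source := mem_extChartAt_source z.1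
  have hone : ∀ α : Cov (E × R3), oneZeroPart (twistorModel E) (Q.twistorStructure z)
      (α.comp (mvfderiv (twistorModel E) (twistorEmb (E := E) z.1) z)) =
      (projOneZero (modelStructure Q z.1 (twistorEmb (E := E) z.1 z)) α).comp
        (mvfderiv (twistorModel E) (twistorEmb (E := E) z.1) z) := by
    intro α
    ext v
    change (1 / 2 : ℂ) * (α _ - Complex.I * α (mvfderiv (twistorModel E) (twistorEmb (E := E) z.1) z
      (Q.twistorStructure z v))) = _
    rw [mvfderiv_twistorStructure hz]
    rfl
  have hcov : ∀ α : Cov (E × R3), covFst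
      (projOneZero (modelStructure Q z.1 (twistorEmb (E := E) z.1 z)) α) =
      projOneZero (quat (z.2 : R3) (fun k => chartStructures Q z.1 k
        (extChartAt 𝓘(ℝ, E) z.1 z.1))) (covFst α) := by
    intro α
    ext v
    change (1 / 2 : ℂ) * (α (v, 0) - Complex.I * α (modelStructure Q z.1 _ (v, 0))) = _
    rw [modelStructure_apply, map_zero]
    rfl
  refine LinearMap.ext₂ fun α β => ?_
  obtain ⟨α, rfl⟩ := exists_cov_comp hz α
  obtain ⟨β, rfl⟩ := exists_cov_comp hz β
  rw [twoZeroPart, LinearMap.compl₁₂_apply, hone, hone, twistorBivector_apply h hz,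
    twistorBivector_apply h hz]
  change comb _ _ (covFst _) (covFst _) = _
  rw [hcov, hcov]
  exact (isQuaternionic_chart h hz).comb_holCoef_projOneZero (S2.sq_sum z.2) _ _

theorem isHolomorphicPoisson_twistorBivector (hk : Q.IsHyperkahler g) :
    IsHolomorphicPoisson (twistorModel E) Q.twistorStructure (Q.twistorBivector g) := by
  have h := hk.1
  have htwo : (2 : WithTop ℕ∞) ≤ ∞ := WithTop.coe_le_coe.2 le_top
  have hc := (isHyperkahler_iff h).1 hk
  refine ⟨isSmoothBivector_twistorBivector h, isTypeTwoZero_twistorBivector h, ?_, ?_⟩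
  · rintro ⟨x₀, a₀⟩ V f₁ f₂ hV h₁ h₂ ht₁ ht₂
    have hm := isLocalModel_twistor (E := E) x₀ a₀
    obtain ⟨hα, hβ, hL⟩ := lieDerivZeroOne_twistorBivector h x₀ a₀ hV
      ((hm.contDiffAt le_rfl h₁).of_le htwo) ((hm.contDiffAt le_rfl h₂).of_le htwo)
      (hm.eventuallyEq f₁) (hm.eventuallyEq f₂) (fderiv_comp_retract_radial x₀ a₀ h₁)
      (fderiv_comp_retract_radial x₀ a₀ h₂) ht₁ ht₂
    rw [hL, (isQuaternionicAt_chart h x₀).dbarTensor_eq_zero (fun k a b c => hc k x₀ a b c)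
      (S2.sq_sum a₀) hα hβ, mul_zero]
  · rintro ⟨x₀, a₀⟩ f₁ f₂ f₃ h₁ h₂ h₃
    have hm := isLocalModel_twistor (E := E) x₀ a₀
    rw [schoutenSelf_twistorBivector h x₀ a₀ ((hm.contDiffAt le_rfl h₁).of_le htwo)
      ((hm.contDiffAt le_rfl h₂).of_le htwo) ((hm.contDiffAt le_rfl h₃).of_le htwo)
      (hm.eventuallyEq f₁) (hm.eventuallyEq f₂) (hm.eventuallyEq f₃), two_mul]
    exact (isQuaternionicAt_chart h x₀).schouten_symm_eq_zero_of_extDeriv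
      (fun k a b c => hc k x₀ a b c) _ _ _ _ _

/-- Holomorphy and the Poisson condition are tested on functions which are linear in a chart and
constant along the sphere; this is enough because both conditions are tensorial. -/
theorem isHyperkahler_of_isHolomorphicPoisson (h : Q.IsHyperhermitian g)
    (hP : IsHolomorphicPoisson (twistorModel E) Q.twistorStructure (Q.twistorBivector g)) :
    Q.IsHyperkahler g := by
  refine (isHyperkahler_iff h).2 fun k x₀ a b c => ?_
  have hx : x₀ ∈ (extChartAt 𝓘(ℝ, E) x₀).source := mem_extChartAt_source x₀
  have hpt : ∀ n : Fin 3 → ℝ, n 0 ^ 2 + n 1 ^ 2 + n 2 ^ 2 = 1 → ∃ a₀ : S2, (a₀ : R3).ofLp = n := by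
    intro n hn
    refine ⟨⟨WithLp.toLp 2 n, ?_⟩, rfl⟩
    rw [mem_sphere_zero_iff_norm, EuclideanSpace.norm_eq, Real.sqrt_eq_one, Fin.sum_univ_three]
    simpa using hn
  let lin : Cov E → M × S2 → ℂ := fun α z => α (extChartAt 𝓘(ℝ, E) x₀ z.1)
  let lin' : Cov E → Cov (E × R3) := fun α => α.comp (ContinuousLinearMap.fst ℝ E R3)
  have hlin : ∀ α a₀, SmoothFunAt (twistorModel E) (lin α) (x₀, a₀) := by
    intro α a₀
    exact ((lin' α).contDiff.contMDiff.contMDiffAt).comp _ (contMDiffAt_twistorEmb x₀ hx)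
  have hfd : ∀ α w, fderiv ℝ (lin' α) w = lin' α := fun α w => (lin' α).fderiv
  have hcov : ∀ α, covFst (lin' α) = α := fun α => rfl
  refine (isQuaternionicAt_chart h x₀).extDeriv_eq_zero ?_ ?_ k a b c
  · intro n hn α β hα hβ V₀
    obtain ⟨a₀, rfl⟩ := hpt n hn
    obtain ⟨e, he, -⟩ := exists_chart_equiv hx
    let u : TangentSpace (twistorModel E) ((x₀, a₀) : M × S2) := (e.symm V₀, 0)
    have ht : ∀ α : Cov E, (∀ v, α (quat (a₀ : R3)
        (fun k => chartStructures Q x₀ k (extChartAt 𝓘(ℝ, E) x₀ x₀)) v) = Complex.I * α v) →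
        IsCovectorOneZero (twistorModel E) (Q.twistorStructure (x₀, a₀))
          (mvfderiv (twistorModel E) (lin α) (x₀, a₀)) := by
      intro α hα v
      have : IsManifold (twistorModel E) 1 (M × S2) := IsManifold.of_le (n := ∞) (by simp)
      have hm : mvfderiv (twistorModel E) (lin α) (x₀, a₀) = _ := mvfderiv_eq_of_comp
        (isLocalModel_twistor (E := E) x₀ a₀).eventually_mdifferentiableAt.self_of_nhds
        (lin' α).differentiableAt (Eventually.of_forall fun _ => rfl)
      rw [hm, hfd, ContinuousLinearMap.comp_apply, ContinuousLinearMap.comp_apply,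
        mvfderiv_twistorStructure (z := (x₀, a₀)) hx]
      exact hα _
    obtain ⟨-, -, hL⟩ := lieDerivZeroOne_twistorBivector h x₀ a₀
      (V := FiberBundle.extend (E × EuclideanSpace ℝ (Fin 2)) u) (FiberBundle.contMDiffAt_extend ..)
      (f₁ := lin α) (f₂ := lin β) (f₁' := lin' α) (f₂' := lin' β) (lin' α).contDiff.contDiffAt
      (lin' β).contDiff.contDiffAt (Eventually.of_forall fun _ => rfl)
      (Eventually.of_forall fun _ => rfl) (by rw [hfd]; exact map_zero α)
      (by rw [hfd]; exact map_zero β) (ht α hα) (ht β hβ)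
    have hu : (mvfderiv (twistorModel E) (twistorEmb (E := E) x₀) (x₀, a₀) u).1 = V₀ :=
      (congrArg Prod.fst (mvfderiv_twistorEmb x₀ (z := (x₀, a₀)) hx u)).trans
        ((he _).symm.trans (e.apply_symm_apply V₀))
    rw [hfd, hfd, hcov, hcov, FiberBundle.extend_apply_self, hu, hP.holomorphic (x₀, a₀) _ _ _
      (FiberBundle.contMDiffAt_extend ..) (hlin α a₀) (hlin β a₀) (ht α hα) (ht β hβ)] at hL
    simpa using hL.symm
  · intro n hn α β γ
    obtain ⟨a₀, rfl⟩ := hpt n hn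
    have hS := schoutenSelf_twistorBivector h x₀ a₀ (f₁ := lin α) (f₂ := lin β) (f₃ := lin γ)
      (f₁' := lin' α) (f₂' := lin' β) (f₃' := lin' γ) (lin' α).contDiff.contDiffAt
      (lin' β).contDiff.contDiffAt (lin' γ).contDiff.contDiffAt (Eventually.of_forall fun _ => rfl)
      (Eventually.of_forall fun _ => rfl) (Eventually.of_forall fun _ => rfl)
    rw [hfd, hfd, hfd, hcov, hcov, hcov,
      hP.poisson (x₀, a₀) _ _ _ (hlin α a₀) (hlin β a₀) (hlin γ a₀)] at hS
    simpa using hS.symm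

end PoissonCriterion

/-! ### The symplectic leaves -/

section Leaves

open Filter Topology

set_option synthInstance.maxHeartbeats 200000

theorem holCoef_pole {a : S2} (ha : a = S2.poleI ∨ a = -S2.poleI) : holCoef (a : R3) = 0 := by
  have h : ∀ m : R3, m 0 ^ 2 = 1 → m 1 = 0 → m 2 = 0 → holCoef m = 0 := by
    intro m h0 h1 h2
    have h0' : (m 0 : ℂ) ^ 2 = 1 := by rw [← Complex.ofReal_pow, h0, Complex.ofReal_one]
    ext k
    fin_cases k <;> simp [holCoef, h0', h1, h2]
  rcases ha with rfl | rfl <;> refine h _ ?_ ?_ ?_ <;> simp [S2.poleI]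

theorem one_sub_sq_ne_zero {a : S2} (h1 : a ≠ S2.poleI) (h2 : a ≠ -S2.poleI) :
    1 - (a : R3) 0 ^ 2 ≠ 0 := by
  intro h
  have hs := S2.sq_sum a
  have e1 : (a : R3) 1 = 0 := by nlinarith [sq_nonneg ((a : R3) 1), sq_nonneg ((a : R3) 2)]
  have e2 : (a : R3) 2 = 0 := by nlinarith [sq_nonneg ((a : R3) 1), sq_nonneg ((a : R3) 2)]
  have h3 : ((a : R3) 0 - 1) * ((a : R3) 0 + 1) = 0 := by linear_combination -h
  rcases mul_eq_zero.1 h3 with h3 | h3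
  · refine h1 (Subtype.ext ?_)
    ext j
    fin_cases j
    · simpa [S2.poleI] using sub_eq_zero.1 h3
    · simpa [S2.poleI] using e1
    · simpa [S2.poleI] using e2
  · refine h2 (Subtype.ext ?_)
    ext j
    fin_cases j
    · simpa [S2.poleI] using eq_neg_of_add_eq_zero_left h3
    · simpa [S2.poleI] using e1
    · simpa [S2.poleI] using e2

theorem eq_of_forall_dual {X : Type*} [NormedAddCommGroup X] [NormedSpace ℝ X] {v w : X}
    (h : ∀ β : X →L[ℝ] ℝ, β v = β w) : v = w :=
  (SeparatingDual.eq_iff_forall_dual_eq (R := ℝ)).2 h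

variable {E : Type*} [NormedAddCommGroup E] [NormedSpace ℝ E] [FiniteDimensional ℝ E]
  {M : Type*} [TopologicalSpace M] [ChartedSpace E M] [IsManifold 𝓘(ℝ, E) ∞ M]
  {Q : HypercomplexStructure E M} {g : RiemannianMetricOn E M}

theorem twistorBivector_pole (h : Q.IsHyperhermitian g) {z : M × S2}
    (hz : z.2 = S2.poleI ∨ z.2 = -S2.poleI) : Q.twistorBivector g z = 0 := by
  have hx : z.1 ∈ (extChartAt 𝓘(ℝ, E) z.1).source := mem_extChartAt_source z.1
  refine LinearMap.ext₂ fun α β => ?_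
  obtain ⟨α, rfl⟩ := exists_cov_comp hx α
  obtain ⟨β, rfl⟩ := exists_cov_comp hx β
  rw [twistorBivector_apply h hx]
  change comb (holCoef (z.2 : R3)) _ _ _ = 0
  simp [holCoef_pole hz, comb_apply]

/-- The Hamiltonian vector fields are tangent to the fibres of the projection to the sphere. -/
theorem dIncl_hamiltonian (h : Q.IsHyperhermitian g) {f : M × S2 → ℂ}
    {V : ∀ z : M × S2, TangentSpace (twistorModel E) z}
    (hV : IsRealHamiltonianField (twistorModel E) (Q.twistorBivector g) f V) (z : M × S2) :
    S2.dIncl z.2 (V z).2 = 0 := by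
  have hx : z.1 ∈ (extChartAt 𝓘(ℝ, E) z.1).source := mem_extChartAt_source z.1
  have hΛ := mvfderiv_twistorEmb z.1 hx (V z)
  have hsnd : S2.dIncl z.2 (V z).2 =
      (mvfderiv (twistorModel E) (twistorEmb (E := E) z.1) z (V z)).2 := congrArg Prod.snd hΛ.symm
  rw [hsnd]
  refine eq_of_forall_dual fun θ => ?_
  have h1 := hV z ((θ.comp (ContinuousLinearMap.snd ℝ E R3)).comp
    (mvfderiv (twistorModel E) (twistorEmb (E := E) z.1) z))
  obtain ⟨α, hα⟩ := exists_cov_comp hx (mvfderiv (twistorModel E) f z)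
  have h2 : complexifyCovector (twistorModel E) ((θ.comp (ContinuousLinearMap.snd ℝ E R3)).comp
      (mvfderiv (twistorModel E) (twistorEmb (E := E) z.1) z)) =
      (ofRealCov (θ.comp (ContinuousLinearMap.snd ℝ E R3))).comp
        (mvfderiv (twistorModel E) (twistorEmb (E := E) z.1) z) := rfl
  have h3 : covFst (ofRealCov (θ.comp (ContinuousLinearMap.snd ℝ E R3))) = 0 := by
    ext v
    simp [covFst_apply]
  rw [h2, hα, twistorBivector_apply h hx, modelBivector, h3] at h1
  rw [map_zero]
  exact h1.trans (congrArg Complex.re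
    (((isQuaternionic_chart h hx).isBivector_comb (holCoef (z.2 : R3))).zero_right (covFst α)))

omit [IsManifold 𝓘(ℝ, E) ∞ M] [FiniteDimensional ℝ E] in
/-- A function whose derivative along an integral curve vanishes is locally constant along it. -/
theorem eventually_eq_of_mvfderiv_eq_zero {Y : Type*} [NormedAddCommGroup Y] [NormedSpace ℝ Y]
    {V : ∀ z : M × S2, TangentSpace (twistorModel E) z} {γ : ℝ → M × S2}
    (hγ : IsMIntegralCurveOn γ V (Set.Icc 0 1)) {F : M × S2 → Y} {t : ℝ} (ht : t ∈ Set.Icc (0 : ℝ) 1)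
    (hF : ∀ᶠ z in 𝓝 (γ t), MDifferentiableAt (twistorModel E) 𝓘(ℝ, Y) F z)
    (h0 : ∀ᶠ s in 𝓝[Set.Icc 0 1] t, mvfderiv (twistorModel E) F (γ s) (V (γ s)) = 0) :
    ∀ᶠ s in 𝓝[Set.Icc 0 1] t, F (γ t) = F (γ s) := by
  have hc : Tendsto γ (𝓝[Set.Icc 0 1] t) (𝓝 (γ t)) := (hγ t ht).continuousWithinAt
  have hev := (hc.eventually hF).and h0
  obtain ⟨ε, hε, hball⟩ := Metric.mem_nhdsWithin_iff.1 hev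
  have hconv : Convex ℝ (Metric.ball t ε ∩ Set.Icc 0 1) := (convex_ball t ε).inter (convex_Icc 0 1)
  have hd : ∀ s ∈ Metric.ball t ε ∩ Set.Icc 0 1,
      HasFDerivWithinAt (F ∘ γ) (0 : ℝ →L[ℝ] Y) (Metric.ball t ε ∩ Set.Icc 0 1) s := by
    rintro s ⟨hs1, hs2⟩
    obtain ⟨hFs, h0s⟩ := hball ⟨hs1, hs2⟩
    have h1 := (hFs.hasMFDerivAt.comp_hasMFDerivWithinAt s (hγ s hs2)).mono
      (Set.inter_subset_right : Metric.ball t ε ∩ Set.Icc 0 1 ⊆ Set.Icc 0 1)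
    have h2 : HasFDerivWithinAt (F ∘ γ) _ (Metric.ball t ε ∩ Set.Icc 0 1) s :=
      hasMFDerivWithinAt_iff_hasFDerivWithinAt.1 h1
    refine h2.congr_fderiv ?_
    ext
    change mvfderiv (twistorModel E) F (γ s) ((1 : ℝ) • V (γ s)) = 0
    rw [one_smul, h0s]
  filter_upwards [inter_mem (mem_nhdsWithin_of_mem_nhds (Metric.ball_mem_nhds t hε))
    self_mem_nhdsWithin] with s hs
  have hle := hconv.norm_image_sub_le_of_norm_hasFDerivWithin_le (C := 0) hd (by simp) hs
    ⟨Metric.mem_ball_self hε, ht⟩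
  rw [zero_mul, norm_le_zero_iff, sub_eq_zero] at hle
  exact hle

omit [FiniteDimensional ℝ E] in
theorem mvfderiv_coe_snd (z : M × S2) (v : TangentSpace (twistorModel E) z) :
    MDifferentiableAt (twistorModel E) 𝓘(ℝ, R3) (fun z : M × S2 => (z.2 : R3)) z ∧
    mvfderiv (twistorModel E) (fun z : M × S2 => (z.2 : R3)) z v = S2.dIncl z.2 v.2 := by
  have hx : z.1 ∈ (extChartAt 𝓘(ℝ, E) z.1).source := mem_extChartAt_source z.1
  have hι : MDifferentiableAt (twistorModel E) 𝓘(ℝ, E × R3) (twistorEmb (E := E) z.1) z :=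
    (contMDiffAt_twistorEmb z.1 hx).mdifferentiableAt (by simp)
  constructor
  · exact (differentiableAt_snd (𝕜 := ℝ) (p := twistorEmb (E := E) z.1 z)).mdifferentiableAt.comp z hι
  have h1 := mvfderiv_eq_of_comp (f := fun z : M × S2 => (z.2 : R3)) hι
    (differentiableAt_snd (𝕜 := ℝ)) (Eventually.of_forall fun _ => rfl)
  rw [h1, fderiv_snd]
  exact congrArg Prod.snd (mvfderiv_twistorEmb z.1 hx v)

theorem integralCurve_snd (h : Q.IsHyperhermitian g) {f : M × S2 → ℂ}
    {V : ∀ z : M × S2, TangentSpace (twistorModel E) z} {γ : ℝ → M × S2}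
    (hV : IsRealHamiltonianField (twistorModel E) (Q.twistorBivector g) f V)
    (hγ : IsMIntegralCurveOn γ V (Set.Icc 0 1)) {s t : ℝ} (hs : s ∈ Set.Icc (0 : ℝ) 1)
    (ht : t ∈ Set.Icc (0 : ℝ) 1) : (γ s).2 = (γ t).2 := by
  refine isPreconnected_Icc.induction₂ (fun s t => (γ s).2 = (γ t).2) (fun t ht => ?_)
    (fun _ _ _ _ _ _ h1 h2 => h1.trans h2) (fun _ _ _ _ h1 => h1.symm) hs ht
  filter_upwards [eventually_eq_of_mvfderiv_eq_zero (F := fun z : M × S2 => (z.2 : R3)) hγ ht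
    (Eventually.of_forall fun z => (mvfderiv_coe_snd z (V z)).1) (Eventually.of_forall fun s =>
      (mvfderiv_coe_snd (γ s) (V (γ s))).2.trans (dIncl_hamiltonian h hV (γ s)))] with s hs
  exact Subtype.ext hs

/-- Hamiltonian trajectories stay in a connected component of a fibre. -/
theorem mem_connectedComponentIn_of_hamiltonianStep (h : Q.IsHyperhermitian g) {z w : M × S2}
    (hzw : HamiltonianStep (twistorModel E) (Q.twistorBivector g) z w) :
    w ∈ connectedComponentIn (Prod.snd ⁻¹' {z.2}) z := by
  obtain ⟨f, V, γ, -, hV, hγ, rfl, rfl⟩ := hzw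
  have h0 : (0 : ℝ) ∈ Set.Icc (0 : ℝ) 1 := by simp
  have h1 : (1 : ℝ) ∈ Set.Icc (0 : ℝ) 1 := by simp
  have hc : ContinuousOn γ (Set.Icc 0 1) := fun t ht => (hγ t ht).continuousWithinAt
  refine (isPreconnected_Icc.image γ hc).subset_connectedComponentIn ⟨0, h0, rfl⟩ ?_ ⟨1, h1, rfl⟩
  rintro _ ⟨t, ht, rfl⟩
  exact integralCurve_snd h hV hγ ht h0

/-- Over the poles the trajectories are constant. No uniqueness theorem for integral curves is
needed: a trajectory stays over the pole, where the Hamiltonian field vanishes identically. -/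
theorem eq_of_hamiltonianStep_pole (h : Q.IsHyperhermitian g) {z w : M × S2}
    (hp : z.2 = S2.poleI ∨ z.2 = -S2.poleI)
    (hzw : HamiltonianStep (twistorModel E) (Q.twistorBivector g) z w) : z = w := by
  obtain ⟨f, V, γ, -, hV, hγ, rfl, rfl⟩ := hzw
  have h0 : (0 : ℝ) ∈ Set.Icc (0 : ℝ) 1 := by simp
  have h1 : (1 : ℝ) ∈ Set.Icc (0 : ℝ) 1 := by simp
  have hV0 : ∀ t ∈ Set.Icc (0 : ℝ) 1, V (γ t) = 0 := by
    intro t ht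
    have hpt : (γ t).2 = S2.poleI ∨ (γ t).2 = -S2.poleI := by
      rwa [integralCurve_snd h hV hγ ht h0]
    refine eq_of_forall_dual (X := E × EuclideanSpace ℝ (Fin 2)) fun β => ?_
    refine (hV (γ t) β).trans ?_
    rw [twistorBivector_pole h hpt]
    exact (map_zero β).symm
  refine isPreconnected_Icc.induction₂ (fun s t => γ s = γ t) (fun t ht => ?_)
    (fun _ _ _ _ _ _ h1 h2 => h1.trans h2) (fun _ _ _ _ h1 => h1.symm) h0 h1
  have hx : (γ t).1 ∈ (extChartAt 𝓘(ℝ, E) (γ t).1).source := mem_extChartAt_source (γ t).1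
  have hsrc : ∀ᶠ z in 𝓝 (γ t), z.1 ∈ (extChartAt 𝓘(ℝ, E) (γ t).1).source :=
    continuousAt_fst.eventually (extChartAt_source_mem_nhds (I := 𝓘(ℝ, E)) (γ t).1)
  have hc : Tendsto γ (𝓝[Set.Icc 0 1] t) (𝓝 (γ t)) := (hγ t ht).continuousWithinAt
  filter_upwards [eventually_eq_of_mvfderiv_eq_zero hγ ht (F := twistorEmb (E := E) (γ t).1)
    (hsrc.mono fun z hz => (contMDiffAt_twistorEmb _ hz).mdifferentiableAt (by simp))
    (by
      filter_upwards [self_mem_nhdsWithin] with s hs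
      rw [hV0 s hs, map_zero]), hc.eventually hsrc] with s hs hs'
  exact Prod.ext ((extChartAt 𝓘(ℝ, E) (γ t).1).injOn hx hs' (congrArg Prod.fst hs))
    (Subtype.ext (congrArg Prod.snd hs))

theorem symplecticLeaf_pole (h : Q.IsHyperhermitian g) {z : M × S2}
    (hp : z.2 = S2.poleI ∨ z.2 = -S2.poleI) :
    symplecticLeaf (twistorModel E) (Q.twistorBivector g) z = {z} := by
  have key : ∀ z w : M × S2,
      Relation.EqvGen (HamiltonianStep (twistorModel E) (Q.twistorBivector g)) z w →
      (z.2 = S2.poleI ∨ z.2 = -S2.poleI) ∨ (w.2 = S2.poleI ∨ w.2 = -S2.poleI) → z = w := by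
    intro z w hzw
    induction hzw with
    | rel z w hzw =>
      rintro (hz | hw)
      · exact eq_of_hamiltonianStep_pole h hz hzw
      · have := connectedComponentIn_subset _ _ (mem_connectedComponentIn_of_hamiltonianStep h hzw)
        exact eq_of_hamiltonianStep_pole h (by rwa [← show w.2 = z.2 from this]) hzw
    | refl z => exact fun _ => rfl
    | symm z w _ ih => exact fun hp => (ih hp.symm).symm
    | trans x y z _ _ ih1 ih2 =>
      rintro (hx | hz)
      · have e := ih1 (Or.inl hx)
        exact e.trans (ih2 (Or.inl (e ▸ hx)))
      · have e := ih2 (Or.inr hz)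
        exact (ih1 (Or.inr (e.symm ▸ hz))).trans e
  ext w
  exact ⟨fun hw => (key z w hw (Or.inl hp)).symm, fun hw => by
    rw [Set.mem_singleton_iff.1 hw]
    exact Relation.EqvGen.refl z⟩

end Leaves

section Leaves

open Filter Topology

set_option synthInstance.maxHeartbeats 200000

/-- If the covector field `T` vanishes on `v` and `p - q` is a multiple of `v`, then the derivatives
of `T` do not contribute to the differential of `ξ ↦ T_ξ (ξ - q)` at `p`. -/
theorem hasFDerivAt_apply_sub {E : Type*} [NormedAddCommGroup E] [NormedSpace ℝ E]
    {T : E → E →L[ℝ] ℝ} {p q v : E} {t : ℝ} (hT : DifferentiableAt ℝ T p)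
    (h0 : ∀ᶠ ξ in 𝓝 p, T ξ v = 0) (hp : p - q = t • v) :
    HasFDerivAt (fun ξ => T ξ (ξ - q)) (T p) p := by
  have h1 : HasFDerivAt (fun ξ => T ξ (ξ - q)) _ p :=
    hT.hasFDerivAt.clm_apply ((hasFDerivAt_id p).sub_const q)
  have h2 : HasFDerivAt (fun ξ => T ξ v) _ p := hT.hasFDerivAt.clm_apply (hasFDerivAt_const v p)
  refine h1.congr_fderiv ?_
  ext w
  have h3 := congrArg (fun L : E →L[ℝ] ℝ => L w)
    (h2.unique ((hasFDerivAt_const 0 p).congr_of_eventuallyEq h0))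
  simp only [add_apply, ContinuousLinearMap.comp_apply, ContinuousLinearMap.flip_apply,
    zero_apply, map_zero, zero_add] at h3
  simp [hp, h3]

variable {E : Type*} [NormedAddCommGroup E] [NormedSpace ℝ E] [FiniteDimensional ℝ E]

theorem IsQuaternionic.comb_holCoef_ofReal {G : E →L[ℝ] E →L[ℝ] ℝ} {S : Fin 3 → E →L[ℝ] E}
    (h : IsQuaternionic G S) {n : Fin 3 → ℝ} (hn : n 0 ^ 2 + n 1 ^ 2 + n 2 ^ 2 = 1)
    (h0 : 1 - n 0 ^ 2 ≠ 0) (v : E) (δ : Cov E) :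
    comb (holCoef n) (invForm G S) (ofRealCov ((2 / (1 - n 0 ^ 2)) • G (quat (perp n) S v))) δ =
      δ v - Complex.I * δ (quat n S v) := by
  have h1 := h.comb_holCoef_neg_ofReal (n := -n) (by simpa using hn)
    ((2 / (1 - n 0 ^ 2)) • G (quat (perp n) S v)) δ
  have h2 : -quat (perp (-n)) S (G.inverse ((2 / (1 - n 0 ^ 2)) • G (quat (perp n) S v))) =
      (2 : ℝ) • v := by
    have e : perp (-n) = perp n := by
      ext j
      fin_cases j <;> simp [perp]
    rw [e, map_smul, h.inverse_apply, map_smul, h.quat_sq, perp_sq hn, smul_smul, ← neg_smul]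
    congr 1
    field_simp
  rw [neg_neg, h2, quat_neg, neg_apply] at h1
  rw [h1]
  simp only [map_smul, map_neg, Complex.real_smul]
  push_cast
  ring

variable {M : Type*} [TopologicalSpace M] [ChartedSpace E M] [IsManifold 𝓘(ℝ, E) ∞ M]
  {Q : HypercomplexStructure E M} {g : RiemannianMetricOn E M}

omit [FiniteDimensional ℝ E] in
theorem exists_mvfderiv_twistorEmb {x₀ : M} {z : M × S2}
    (hz : z.1 ∈ (extChartAt 𝓘(ℝ, E) x₀).source) (v : E) : ∃ u : TangentSpace (twistorModel E) z,
      mvfderiv (twistorModel E) (twistorEmb (E := E) x₀) z u = (v, 0) := by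
  obtain ⟨e, he, -⟩ := exists_chart_equiv hz
  let u : TangentSpace (twistorModel E) z := (e.symm v, 0)
  exact ⟨u, (mvfderiv_twistorEmb x₀ hz u).trans
    (Prod.ext ((he _).symm.trans (e.apply_symm_apply v)) (map_zero (S2.dIncl z.2)))⟩

/-- A tangent vector `u` of `Z` is the real part of the contraction of the twistor bivector with a
covector if, in the chart, it is the real part `b₁` of the contraction `b₁ + i b₂`. -/
theorem apply_eq_re_twistorBivector (h : Q.IsHyperhermitian g) {x₀ : M} {z : M × S2}
    (hz : z.1 ∈ (extChartAt 𝓘(ℝ, E) x₀).source) {α : Cov (E × R3)} {b₁ b₂ : E}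
    (hb : ∀ δ : Cov E, comb (holCoef (z.2 : R3)) (invForm (chartMetric x₀ g
      (extChartAt 𝓘(ℝ, E) x₀ z.1)) (fun k => chartStructures Q x₀ k (extChartAt 𝓘(ℝ, E) x₀ z.1)))
      (covFst α) δ = δ b₁ + Complex.I * δ b₂) {u : TangentSpace (twistorModel E) z}
    (hu : mvfderiv (twistorModel E) (twistorEmb (E := E) x₀) z u = (b₁, 0))
    (β : TangentSpace (twistorModel E) z →L[ℝ] ℝ) :
    β u = (Q.twistorBivector g z
      (α.comp (mvfderiv (twistorModel E) (twistorEmb (E := E) x₀) z))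
      (complexifyCovector (twistorModel E) β)).re := by
  obtain ⟨u₂, hu₂⟩ := exists_mvfderiv_twistorEmb hz b₂
  obtain ⟨δ, hδ⟩ := exists_cov_comp hz (complexifyCovector (twistorModel E) β)
  have hδu : ∀ u : TangentSpace (twistorModel E) z,
      δ (mvfderiv (twistorModel E) (twistorEmb (E := E) x₀) z u) = (β u : ℂ) := fun u =>
    (congrArg (fun L : ComplexCotangent (twistorModel E) z => L u) hδ).symm
  have h1 : modelBivector Q g x₀ (twistorEmb (E := E) x₀ z) α δ =
      δ (b₁, 0) + Complex.I * δ (b₂, 0) := hb (covFst δ)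
  rw [hδ, twistorBivector_apply h hz, h1, ← hu, ← hu₂, hδu, hδu]
  simp

theorem exists_isRealHamiltonianField (h : Q.IsHyperhermitian g) (f : M × S2 → ℂ) :
    ∃ V, IsRealHamiltonianField (twistorModel E) (Q.twistorBivector g) f V := by
  have key : ∀ z : M × S2, ∃ u : TangentSpace (twistorModel E) z,
      ∀ β : TangentSpace (twistorModel E) z →L[ℝ] ℝ, β u = (Q.twistorBivector g z
        (mvfderiv (twistorModel E) f z) (complexifyCovector (twistorModel E) β)).re := by
    intro z
    have hx : z.1 ∈ (extChartAt 𝓘(ℝ, E) z.1).source := mem_extChartAt_source z.1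
    obtain ⟨α, hα⟩ := exists_cov_comp hx (mvfderiv (twistorModel E) f z)
    obtain ⟨b₁, b₂, hb⟩ := ((isQuaternionic_chart h hx).isBivector_comb
      (holCoef (z.2 : R3))).vec (covFst α)
    obtain ⟨u, hu⟩ := exists_mvfderiv_twistorEmb hx b₁
    refine ⟨u, fun β => ?_⟩
    rw [hα]
    exact apply_eq_re_twistorBivector h hx hb hu β
  choose V hV using key
  exact ⟨V, hV⟩

variable (Q g) in
/-- The real covector `(2 / (1 - a²)) ω(v, ·)` for `ω = g(A ·, ·)`, `A = (1 - a²) I - ab J - ac K`,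
in the chart at `x₀`, at the point `(a, b, c)` of the sphere. The real part of the contraction of
the twistor bivector with it is `v`. -/
def lineCovector (x₀ : M) (a₀ : S2) (v ξ : E) : E →L[ℝ] ℝ :=
  (2 / (1 - (a₀ : R3) 0 ^ 2)) • chartMetric x₀ g ξ
    (quat (perp (a₀ : R3)) (fun k => chartStructures Q x₀ k ξ) v)

omit [FiniteDimensional ℝ E] in
theorem contDiffAt_lineCovector {x₀ y : M} (hy : y ∈ (extChartAt 𝓘(ℝ, E) x₀).source) (a₀ : S2)
    (v : E) : ContDiffAt ℝ ∞ (lineCovector Q g x₀ a₀ v) (extChartAt 𝓘(ℝ, E) x₀ y) := by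
  have hS : ∀ k, ContDiffAt ℝ ∞ (fun ξ => chartStructures Q x₀ k ξ v) (extChartAt 𝓘(ℝ, E) x₀ y) :=
    fun k => (contDiffAt_chartEnd hy (smooth_structures Q k)).clm_apply contDiffAt_const
  have h1 : ContDiffAt ℝ ∞ (fun ξ => quat (perp (a₀ : R3)) (fun k => chartStructures Q x₀ k ξ) v)
      (extChartAt 𝓘(ℝ, E) x₀ y) :=
    (((hS 0).const_smul _).add ((hS 1).const_smul _)).add ((hS 2).const_smul _)
  exact ((contDiffAt_chartMetric hy g).clm_apply h1).const_smul _

omit [FiniteDimensional ℝ E] in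
theorem lineCovector_self (h : Q.IsHyperhermitian g) {x₀ y : M}
    (hy : y ∈ (extChartAt 𝓘(ℝ, E) x₀).source) (a₀ : S2) (v : E) :
    lineCovector Q g x₀ a₀ v (extChartAt 𝓘(ℝ, E) x₀ y) v = 0 := by
  have hq := isQuaternionic_chart h hy
  have h1 := hq.quat_skew (perp (a₀ : R3)) v v
  rw [hq.symm v] at h1
  rw [lineCovector, smul_apply, self_eq_neg.1 h1, smul_zero]

/-- The real part of the Hamiltonian vector of a function which near `(y, a₀)` is
`x ↦ τ(x)(φ(x) - φ(x₀))`, where `τ` is the covector field above and `φ` the chart. Although `τ` need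
not be closed, on the straight line from `x₀` in the direction `v` the differential of this function
is `τ`, because `τ(v) = 0`. -/
theorem apply_eq_re_twistorBivector_line (h : Q.IsHyperhermitian g) {x₀ y : M}
    (hy : y ∈ (extChartAt 𝓘(ℝ, E) x₀).source) {a₀ : S2} (h0 : 1 - (a₀ : R3) 0 ^ 2 ≠ 0) {v : E} {t : ℝ}
    (ht : extChartAt 𝓘(ℝ, E) x₀ y - extChartAt 𝓘(ℝ, E) x₀ x₀ = t • v) {f : M × S2 → ℂ}
    (hf : ∀ᶠ z in 𝓝 (y, a₀), f z = (lineCovector Q g x₀ a₀ v (extChartAt 𝓘(ℝ, E) x₀ z.1)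
      (extChartAt 𝓘(ℝ, E) x₀ z.1 - extChartAt 𝓘(ℝ, E) x₀ x₀) : ℝ))
    {u : TangentSpace (twistorModel E) ((y, a₀) : M × S2)}
    (hu : mvfderiv (twistorModel E) (twistorEmb (E := E) x₀) (y, a₀) u = (v, 0))
    (β : TangentSpace (twistorModel E) ((y, a₀) : M × S2) →L[ℝ] ℝ) :
    β u = (Q.twistorBivector g (y, a₀) (mvfderiv (twistorModel E) f (y, a₀))
      (complexifyCovector (twistorModel E) β)).re := by
  have h1 : HasFDerivAt (fun ξ => lineCovector Q g x₀ a₀ v ξ (ξ - extChartAt 𝓘(ℝ, E) x₀ x₀))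
      (lineCovector Q g x₀ a₀ v (extChartAt 𝓘(ℝ, E) x₀ y)) (extChartAt 𝓘(ℝ, E) x₀ y) := by
    refine hasFDerivAt_apply_sub ((contDiffAt_lineCovector hy a₀ v).differentiableAt (by simp)) ?_ ht
    filter_upwards [extChartAt_target_mem_nhds' (I := 𝓘(ℝ, E))
      ((extChartAt 𝓘(ℝ, E) x₀).map_source hy)] with ξ hξ
    have := lineCovector_self h ((extChartAt 𝓘(ℝ, E) x₀).map_target hξ) a₀ v
    rwa [(extChartAt 𝓘(ℝ, E) x₀).right_inv hξ] at this
  have h2 : HasFDerivAt (fun w : E × R3 => ((lineCovector Q g x₀ a₀ v w.1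
      (w.1 - extChartAt 𝓘(ℝ, E) x₀ x₀) : ℝ) : ℂ)) _ (twistorEmb (E := E) x₀ (y, a₀)) :=
    Complex.ofRealCLM.hasFDerivAt.comp _ (hasFDerivAt_comp_fst
      (f := fun ξ => lineCovector Q g x₀ a₀ v ξ (ξ - extChartAt 𝓘(ℝ, E) x₀ x₀))
      (w := twistorEmb (E := E) x₀ (y, a₀)) h1)
  have hm : mvfderiv (twistorModel E) f (y, a₀) = _ := mvfderiv_eq_of_comp
    ((contMDiffAt_twistorEmb x₀ (z := (y, a₀)) hy).mdifferentiableAt (by simp))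
    h2.differentiableAt hf
  rw [hm, h2.fderiv]
  refine apply_eq_re_twistorBivector h (z := (y, a₀)) hy (b₂ := -quat (a₀ : R3)
    (fun k => chartStructures Q x₀ k (extChartAt 𝓘(ℝ, E) x₀ y)) v) (fun δ => ?_) hu β
  refine ((isQuaternionic_chart h hy).comb_holCoef_ofReal (S2.sq_sum a₀) h0 v δ).trans ?_
  rw [map_neg]
  ring

/-- Away from the two special fibres, all points of the fibre near a given one can be reached along
a Hamiltonian trajectory, which is a segment in a chart. -/
theorem eventually_hamiltonianStep [T2Space M] (h : Q.IsHyperhermitian g) (x₀ : M) {a₀ : S2}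
    (h0 : 1 - (a₀ : R3) 0 ^ 2 ≠ 0) : ∀ᶠ y in 𝓝 x₀,
      HamiltonianStep (twistorModel E) (Q.twistorBivector g) (x₀, a₀) (y, a₀) := by
  obtain ⟨χ⟩ : Nonempty (SmoothBumpFunction 𝓘(ℝ, E) x₀) := inferInstance
  set φ := extChartAt 𝓘(ℝ, E) x₀ with hφ
  have hball : ∀ ξ, dist ξ (φ x₀) < χ.rIn → ξ ∈ φ.target := fun ξ hξ =>
    χ.ball_subset ⟨hξ.trans χ.rIn_lt_rOut, by simp⟩
  have hc : Tendsto φ (𝓝 x₀) (𝓝 (φ x₀)) := continuousAt_extChartAt x₀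
  filter_upwards [hc.eventually (Metric.ball_mem_nhds (φ x₀) χ.rIn_pos),
    extChartAt_source_mem_nhds (I := 𝓘(ℝ, E)) x₀] with y hyd hy
  set v := φ y - φ x₀ with hv
  let G : M → ℝ := fun x => lineCovector Q g x₀ a₀ v (φ x) (φ x - φ x₀)
  let f : M × S2 → ℂ := fun z => ((χ z.1 • G z.1 : ℝ) : ℂ)
  have hG : ContMDiffOn 𝓘(ℝ, E) 𝓘(ℝ, ℝ) ∞ G (chartAt E x₀).source := by
    intro x hx
    have hx' : x ∈ φ.source := by rwa [hφ, extChartAt_source]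
    have h1 : ContDiffAt ℝ ∞ (fun ξ => lineCovector Q g x₀ a₀ v ξ (ξ - φ x₀)) (φ x) :=
      (contDiffAt_lineCovector hx' a₀ v).clm_apply (contDiffAt_id.sub contDiffAt_const)
    exact (h1.contMDiffAt.comp x (contMDiffAt_extChartAt' hx)).contMDiffWithinAt
  have hf : ContMDiff (twistorModel E) 𝓘(ℝ, ℂ) ∞ f :=
    Complex.ofRealCLM.contDiff.contMDiff.comp ((χ.contMDiff_smul hG).comp contMDiff_fst)
  obtain ⟨V, hV⟩ := exists_isRealHamiltonianField h f
  refine ⟨f, V, fun t => (φ.symm (φ x₀ + t • v), a₀), hf, hV, fun t ht => ?_, ?_, ?_⟩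
  · have hdist : dist (φ x₀ + t • v) (φ x₀) < χ.rIn := by
      rw [dist_eq_norm, add_sub_cancel_left, norm_smul, Real.norm_eq_abs, abs_of_nonneg ht.1]
      rw [dist_eq_norm] at hyd
      exact (mul_le_of_le_one_left (norm_nonneg v) ht.2).trans_lt hyd
    have htar := hball _ hdist
    set x := φ.symm (φ x₀ + t • v) with hx
    have hxs : x ∈ φ.source := φ.map_target htar
    have hφx : φ x = φ x₀ + t • v := φ.right_inv htar
    have hline : HasFDerivAt (fun s : ℝ => φ x₀ + s • v)
        ((1 : ℝ →L[ℝ] ℝ).smulRight v) t :=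
      ((hasFDerivAt_id t).smul_const v).const_add (φ x₀)
    have hsymm : MDifferentiableAt 𝓘(ℝ, E) 𝓘(ℝ, E) φ.symm (φ x₀ + t • v) :=
      ((contMDiffOn_extChartAt_symm (I := 𝓘(ℝ, E)) (n := ∞) x₀).contMDiffAt
        ((isOpen_extChartAt_target x₀).mem_nhds htar)).mdifferentiableAt (by simp)
    have hγ : MDifferentiableAt 𝓘(ℝ, ℝ) (twistorModel E)
        (fun s : ℝ => ((φ.symm (φ x₀ + s • v), a₀) : M × S2)) t :=
      (hsymm.comp t hline.differentiableAt.mdifferentiableAt).prodMk mdifferentiableAt_const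
    have hι : MDifferentiableAt (twistorModel E) 𝓘(ℝ, E × R3) (twistorEmb (E := E) x₀) (x, a₀) :=
      (contMDiffAt_twistorEmb x₀ (z := (x, a₀)) hxs).mdifferentiableAt (by simp)
    let u : TangentSpace (twistorModel E) ((x, a₀) : M × S2) :=
      mfderiv 𝓘(ℝ, ℝ) (twistorModel E) (fun s : ℝ => ((φ.symm (φ x₀ + s • v), a₀) : M × S2)) t
        (1 : ℝ)
    have hu : mvfderiv (twistorModel E) (twistorEmb (E := E) x₀) (x, a₀) u = (v, 0) := by
      have e1 : HasMFDerivAt 𝓘(ℝ, ℝ) 𝓘(ℝ, E × R3) (twistorEmb (E := E) x₀ ∘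
        fun s : ℝ => ((φ.symm (φ x₀ + s • v), a₀) : M × S2)) t _ :=
        HasMFDerivAt.comp t hι.hasMFDerivAt hγ.hasMFDerivAt
      have e2 : HasFDerivAt (fun s : ℝ => (φ x₀ + s • v, (a₀ : R3))) _ t :=
        hline.prodMk (hasFDerivAt_const (a₀ : R3) t)
      have e3 : (twistorEmb (E := E) x₀ ∘
          fun s : ℝ => ((φ.symm (φ x₀ + s • v), a₀) : M × S2)) =ᶠ[𝓝 t]
          fun s : ℝ => (φ x₀ + s • v, (a₀ : R3)) := by
        filter_upwards [hline.continuousAt ((isOpen_extChartAt_target x₀).mem_nhds htar)] with s hs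
        exact Prod.ext (φ.right_inv hs) rfl
      have e4 := hasMFDerivAt_unique e1 (e2.congr_of_eventuallyEq e3).hasMFDerivAt
      refine (congrArg (fun L : ℝ →L[ℝ] E × R3 => L 1) e4).trans ?_
      simp
    have hfx : ∀ᶠ z in 𝓝 ((x, a₀) : M × S2), f z = (lineCovector Q g x₀ a₀ v (φ z.1)
        (φ z.1 - φ x₀) : ℝ) := by
      have hχ : ∀ᶠ x' in 𝓝 x, χ x' = 1 := χ.eventuallyEq_one_of_dist_lt
        (by rwa [← extChartAt_source 𝓘(ℝ, E)]) (by change dist (φ x) (φ x₀) < χ.rIn; rwa [hφx])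
      filter_upwards [(continuousAt_fst (p := ((x, a₀) : M × S2))).eventually hχ] with z hz
      simp only [f, G, hz, one_smul]
    have hVu : V (x, a₀) = u := by
      refine eq_of_forall_dual (X := E × EuclideanSpace ℝ (Fin 2)) fun β => ?_
      exact (hV (x, a₀) β).trans (apply_eq_re_twistorBivector_line h hxs h0
        (by change φ x - φ x₀ = t • v; rw [hφx, add_sub_cancel_left]) hfx hu β).symm
    refine (hγ.hasMFDerivAt.congr_mfderiv ?_).hasMFDerivWithinAt
    ext
    change u = (1 : ℝ) • V (x, a₀)
    rw [one_smul, hVu]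
  · change (φ.symm (φ x₀ + (0 : ℝ) • v), a₀) = (x₀, a₀)
    rw [zero_smul, add_zero, φ.left_inv (mem_extChartAt_source x₀)]
  · change (φ.symm (φ x₀ + (1 : ℝ) • v), a₀) = (y, a₀)
    rw [one_smul, hv, add_sub_cancel, φ.left_inv hy]

/-- Each leaf lies in a connected component of a fibre. Nearby points of a fibre lie in the same
leaf, so a connected component of a fibre is a single leaf. -/
theorem symplecticLeaf_eq_connectedComponentIn [T2Space M] (h : Q.IsHyperhermitian g) {z : M × S2}
    (h1 : z.2 ≠ S2.poleI) (h2 : z.2 ≠ -S2.poleI) :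
    symplecticLeaf (twistorModel E) (Q.twistorBivector g) z =
      connectedComponentIn (Prod.snd ⁻¹' {z.2}) z := by
  have hmem : ∀ w : M × S2, w ∈ connectedComponentIn (Prod.snd ⁻¹' {w.2}) w := fun w =>
    mem_connectedComponentIn rfl
  have key : ∀ z w : M × S2,
      Relation.EqvGen (HamiltonianStep (twistorModel E) (Q.twistorBivector g)) z w →
      connectedComponentIn (Prod.snd ⁻¹' {z.2}) z = connectedComponentIn (Prod.snd ⁻¹' {w.2}) w := by
    intro z w hzw
    induction hzw with
    | rel z w hzw =>
      have hw := mem_connectedComponentIn_of_hamiltonianStep h hzw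
      have hw' : w ∈ Prod.snd ⁻¹' {z.2} := connectedComponentIn_subset _ _ hw
      have h2 : w.2 = z.2 := hw'
      rw [connectedComponentIn_eq hw, h2]
    | refl z => rfl
    | symm z w _ ih => exact ih.symm
    | trans x y z _ _ ih1 ih2 => exact ih1.trans ih2
  refine Set.Subset.antisymm (fun w hw => ?_) fun w hw => ?_
  · rw [key z w hw]
    exact hmem w
  · refine isPreconnected_connectedComponentIn.induction₂
      (Relation.EqvGen (HamiltonianStep (twistorModel E) (Q.twistorBivector g)))
      (fun p hp => ?_) (fun _ _ _ _ _ _ h1 h2 => h1.trans _ _ _ h2) (fun _ _ _ _ h1 => h1.symm _ _)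
      (hmem z) hw
    have hp' : p ∈ Prod.snd ⁻¹' {z.2} := connectedComponentIn_subset _ _ hp
    have hp2 : p.2 = z.2 := hp'
    have hev := (continuousAt_fst (p := p)).eventually (eventually_hamiltonianStep h p.1
      (one_sub_sq_ne_zero h1 h2))
    filter_upwards [mem_nhdsWithin_of_mem_nhds hev, self_mem_nhdsWithin] with w hw hw'
    have hw'' : w ∈ Prod.snd ⁻¹' {z.2} := connectedComponentIn_subset _ _ hw'
    have hw2 : w.2 = z.2 := hw''
    have ep : p = (p.1, z.2) := Prod.ext rfl hp2
    have ew : w = (w.1, z.2) := Prod.ext rfl hw2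
    rw [ep, ew]
    exact Relation.EqvGen.rel _ _ hw

end Leaves

end HypercomplexTwistor

end

theorem theorem5p1 {E : Type*} [NormedAddCommGroup E] [NormedSpace ℝ E] [FiniteDimensional ℝ E]
    {M : Type*} [TopologicalSpace M] [T2Space M] [ChartedSpace E M] [IsManifold 𝓘(ℝ, E) ∞ M]
    (Q : HypercomplexStructure E M) (g : RiemannianMetricOn E M) :
    (Q.IsHyperkahler g →
      IsHolomorphicPoisson (twistorModel E) Q.twistorStructure (Q.twistorBivector g) ∧
      (∀ z : M × S2, z.2 = S2.poleI ∨ z.2 = -S2.poleI → Q.twistorBivector g z = 0) ∧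
      (∀ z : M × S2, z.2 ≠ S2.poleI → z.2 ≠ -S2.poleI →
        symplecticLeaf (twistorModel E) (Q.twistorBivector g) z =
          connectedComponentIn (Prod.snd ⁻¹' {z.2}) z) ∧
      (∀ z : M × S2, z.2 = S2.poleI ∨ z.2 = -S2.poleI →
        symplecticLeaf (twistorModel E) (Q.twistorBivector g) z = {z})) ∧
    (Q.IsHyperhermitian g →
      IsHolomorphicPoisson (twistorModel E) Q.twistorStructure (Q.twistorBivector g) →
      Q.IsHyperkahler g) := by
  refine ⟨fun hk => ⟨HypercomplexTwistor.isHolomorphicPoisson_twistorBivector hk,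
    fun z hz => HypercomplexTwistor.twistorBivector_pole hk.1 hz,
    fun z h1 h2 => HypercomplexTwistor.symplecticLeaf_eq_connectedComponentIn hk.1 h1 h2,
    fun z hz => HypercomplexTwistor.symplecticLeaf_pole hk.1 hz⟩,
    HypercomplexTwistor.isHyperkahler_of_isHolomorphicPoisson⟩
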